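/- **Setting.** Let $d\ge 1$, $0<\delta<\tfrac12$, $0<\beta<1$, $\varepsilon_0>0$, $N\in\mathbb N$, and put $a:=1-2\delta$, $K(\varepsilon):=\lfloor \varepsilon^{-\beta}\rfloor+1$. A family $\{f_\varepsilon\}_{0<\varepsilon<\varepsilon_0}\subset C^\infty(\mathbb R^d\times\mathbb T^d)$, $\mathbb T^d=\mathbb R^d/2\pi\mathbb Z^d$, is a *symbol of order $m$* ($f\in\mathcal P^{m,\delta}$) if for all multi-indices $\alpha,\beta'$ $$\sup_{0<\varepsilon<\varepsilon_0}\ \sup_{p,q}\ \Big|\frac{\partial_p^{\alpha}\partial_q^{\beta'}f_\varepsilon(p,q)}{\varepsilon^{m}}\Big|\,\varepsilon^{|\alpha|\delta}<\infty .$$ It is a *remainder of order $N$* if this bound holds with $m=1+Na$ for all $|\alpha|+|\beta'|\le 1$. A family $Z_\varepsilon$ is *in normal form* if $Z_\varepsilon(p,q)=\sum_{|k|\le K(\varepsilon)}\hat Z_k(\varepsilon,p)e^{ik\cdot q}$ (with $\hat Z_k$ the Fourier coefficients in $q$, $|k|$ the Euclidean norm of $k\in\mathbb Z^d$) and, for every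 $k\neq 0$, $\hat Z_k(\varepsilon,p)\ne 0$ implies $|p\cdot k|\le \varepsilon^{\delta}$. Let $H_0(p)=\sum_{j=1}^d p_j^2/2$ and $H_\varepsilon=H_0+P_\varepsilon$ with $P\in\mathcal P^{1,\delta}$. We say that a family $\mathcal T=\{\mathcal T_\varepsilon\}_{0<\varepsilon<\varepsilon_0}$ of canonical transformations ($C^\infty$ symplectic diffeomorphisms of $\mathbb R^d\times\mathbb T^d$) *normalizes $H$ to order $N$* if $$H_\varepsilon\circ\mathcal T_\varepsilon=H_0+\sum_{j=1}^N Z_j+\mathcal R^{(N)}$$ with $Z_j\in\mathcal P^{1+a(j-1),\delta}$ in normal form and $\mathcal R^{(N)}$ a remainder of order $N$. **Proposition.** There is a family $\mathcal T$ that normalizes $H$ to order $N$ and is close to the identity, that is, there is $C$ with $\sup_{p,q}|p_j\circ\mathcal T_\varepsilon-p_j|\le C\varepsilon^{1-\delta}$ for all $j$ and all $0<\varepsilon<\varepsilon_0$, and for every $m\in\mathbb R$ and $f\in\mathcal P^{m,\delta}$ there is $C_f$ with $\sup_{p,q}|f_\varepsilon\circ\mathcal T_\varepsilon-f_\varepsilon|\le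 C_f\,\varepsilon^{m+1-2\delta}$ for all $0<\varepsilon<\varepsilon_0$. Moreover, for every family $\mathcal T$ that normalizes $H$ to order $N$ there exists $\varepsilon_N\in(0,\varepsilon_0)$ such that for all $0<\varepsilon\le\varepsilon_N$ and all initial data $(p,q)\in\mathbb R^d\times\mathbb T^d$ the orbit $(\overline p(t),\overline q(t))=\Phi^t_{H_\varepsilon\circ\mathcal T_\varepsilon}(p,q)$ exists for all $t\in\mathbb R$ and satisfies $$|\overline p(t)-p|\le \varepsilon^{\delta-((d-1)(d+1)+2)\beta}\qquad\text{for all } |t|\le\varepsilon^{-Na}.$$ -/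

import Mathlib

open MeasureTheory

noncomputable section

/-- The action space `ℝ^d` with its Euclidean norm. -/
abbrev ActionSpace (d : ℕ) : Type := EuclideanSpace ℝ (Fin d)

/-- Points `(p, q)`. The torus `𝕋^d = ℝ^d / 2πℤ^d` is represented by its universal cover: functions
on `ℝ^d × 𝕋^d` are functions of `(p, q)` that are `2π`-periodic in each `q_i`. -/
abbrev Phase (d : ℕ) : Type := ActionSpace d × ActionSpace d

/-- `x` and `y` are lifts of the same point of `ℝ^d × 𝕋^d`. -/
def SamePoint {d : ℕ} (x y : Phase d) : Prop :=
  x.1 = y.1 ∧ ∃ n : Fin d → ℤ, ∀ i, y.2 i = x.2 i + 2 * Real.pi * n i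

/-- `f` is (the lift of) a `C^∞` function on `ℝ^d × 𝕋^d`. -/
def IsSmoothOnPhase {d : ℕ} (f : Phase d → ℝ) : Prop :=
  ContDiff ℝ ((⊤ : ℕ∞) : WithTop ℕ∞) f ∧ ∀ x y, SamePoint x y → f x = f y

/-- `∂f/∂p_i` -/
def dP {d : ℕ} (i : Fin d) (f : Phase d → ℝ) : Phase d → ℝ :=
  fun x => fderiv ℝ f x (EuclideanSpace.single i 1, 0)

/-- `∂f/∂q_i` -/
def dQ {d : ℕ} (i : Fin d) (f : Phase d → ℝ) : Phase d → ℝ :=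
  fun x => fderiv ℝ f x (0, EuclideanSpace.single i 1)

/-- The iterated partial derivative `∂_p^α ∂_q^β f`, where the multi-index `α` is given as the list
of the indices of the `p`-derivatives (so `|α|` is its length), and `β` likewise for `q`. -/
def partialPQ {d : ℕ} (α β : List (Fin d)) (f : Phase d → ℝ) : Phase d → ℝ :=
  α.foldr dP (β.foldr dQ f)

/-- `sup_{0<ε<ε₀} sup_{p,q} |∂_p^α ∂_q^β f_ε| ε^{|α|δ} / ε^m < ∞`. -/
def SymbolBound {d : ℕ} (δ ε₀ m : ℝ) (α β : List (Fin d)) (f : ℝ → Phase d → ℝ) : Prop :=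
  ∃ C : ℝ, ∀ ε : ℝ, 0 < ε → ε < ε₀ → ∀ x : Phase d,
    |partialPQ α β (f ε) x / ε ^ m * ε ^ ((α.length : ℝ) * δ)| ≤ C

/-- The class of symbols of order `m`, for families indexed by `0 < ε < ε₀`. -/
def IsSymbol {d : ℕ} (δ ε₀ m : ℝ) (f : ℝ → Phase d → ℝ) : Prop :=
  (∀ ε : ℝ, 0 < ε → ε < ε₀ → IsSmoothOnPhase (f ε)) ∧
    ∀ α β : List (Fin d), SymbolBound δ ε₀ m α β f

/-- Remainders of order `N`: the bounds of a symbol of order `1 + N (1 - 2δ)`, required only of the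
function and its first derivatives. -/
def IsRemainder {d : ℕ} (δ ε₀ : ℝ) (N : ℕ) (R : ℝ → Phase d → ℝ) : Prop :=
  (∀ ε : ℝ, 0 < ε → ε < ε₀ → IsSmoothOnPhase (R ε)) ∧
    ∀ α β : List (Fin d), α.length + β.length ≤ 1 →
      SymbolBound δ ε₀ (1 + N * (1 - 2 * δ)) α β R

/-- `p · k` for `p ∈ ℝ^d`, `k ∈ ℤ^d`. -/
def dotZ {d : ℕ} (p : ActionSpace d) (k : Fin d → ℤ) : ℝ := ∑ i, p i * (k i : ℝ)

/-- The Fourier coefficient `(2π)^{-d} ∫_{[0,2π]^d} f(p, q) e^{-i k·q} dq`. -/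
def fourierCoef {d : ℕ} (f : Phase d → ℝ) (k : Fin d → ℤ) (p : ActionSpace d) : ℂ :=
  ((2 * Real.pi : ℝ) : ℂ)⁻¹ ^ d *
    ∫ q in {q : ActionSpace d | ∀ i, q i ∈ Set.Icc 0 (2 * Real.pi)},
      (f (p, q) : ℂ) * Complex.exp (-(Complex.I * (dotZ q k : ℂ)))

/-- The ultraviolet cutoff `K(ε) = [ε^{-β}] + 1`. -/
def cutoffK (β ε : ℝ) : ℕ := ⌊1 / ε ^ β⌋₊ + 1

/-- The integer vectors `k ∈ ℤ^d` of Euclidean length at most `K`. -/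
def modes (d K : ℕ) : Finset (Fin d → ℤ) :=
  (Fintype.piFinset fun _ => Finset.Icc (-(K : ℤ)) (K : ℤ)).filter
    fun k => ∑ i, k i ^ 2 ≤ (K : ℤ) ^ 2

/-- `Z` (at the parameter value `ε`) is in normal form: it has only Fourier modes `|k| ≤ K(ε)`, and
for `k ≠ 0` the `k`-th Fourier coefficient vanishes outside `|p · k| ≤ ε^δ`. -/
def IsInNormalForm {d : ℕ} (δ β ε : ℝ) (Z : Phase d → ℝ) : Prop :=
  (∀ p q : ActionSpace d, (Z (p, q) : ℂ) =
      ∑ k ∈ modes d (cutoffK β ε),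
        fourierCoef Z k p * Complex.exp (Complex.I * (dotZ q k : ℂ))) ∧
    ∀ k : Fin d → ℤ, k ≠ 0 → ∀ p : ActionSpace d,
      fourierCoef Z k p ≠ 0 → |dotZ p k| ≤ ε ^ δ

/-- The standard symplectic form `∑ dp_i ∧ dq_i`. -/
def sympForm {d : ℕ} (u v : Phase d) : ℝ := ∑ i, (u.1 i * v.2 i - u.2 i * v.1 i)

/-- `T` is (the lift of) a canonical transformation of `ℝ^d × 𝕋^d`: a `C^∞` diffeomorphism that
preserves the symplectic form. -/
structure IsCanonical {d : ℕ} (T : Phase d → Phase d) : Prop where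
  smooth : ContDiff ℝ ((⊤ : ℕ∞) : WithTop ℕ∞) T
  descends : ∀ x y, SamePoint x y → SamePoint (T x) (T y)
  inverse : ∃ S : Phase d → Phase d, ContDiff ℝ ((⊤ : ℕ∞) : WithTop ℕ∞) S ∧
    (∀ x y, SamePoint x y → SamePoint (S x) (S y)) ∧
    Function.LeftInverse S T ∧ Function.RightInverse S T
  symplectic : ∀ x u v, sympForm (fderiv ℝ T x u) (fderiv ℝ T x v) = sympForm u v

/-- The unperturbed Hamiltonian `H₀(p) = ∑ p_j² / 2`. -/
def freeHam {d : ℕ} (p : ActionSpace d) : ℝ := ∑ j, p j ^ 2 / 2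

/-- The Hamiltonian `H_ε = H₀ + P_ε`. -/
def fullHam {d : ℕ} (P : ℝ → Phase d → ℝ) (ε : ℝ) (x : Phase d) : ℝ := freeHam x.1 + P ε x

/-- The family `T_ε` of canonical transformations puts `H_ε = H₀ + P_ε` in normal form up to a
remainder of order `N`: `H_ε ∘ T_ε = H₀ + Z_1 + ⋯ + Z_N + R` with `Z_j` in normal form and a symbol
of order `1 + (j - 1) (1 - 2δ)`, and `R` a remainder of order `N`. -/
def Normalizes {d : ℕ} (δ β ε₀ : ℝ) (N : ℕ) (P : ℝ → Phase d → ℝ)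
    (T : ℝ → Phase d → Phase d) : Prop :=
  (∀ ε : ℝ, 0 < ε → ε < ε₀ → IsCanonical (T ε)) ∧
    ∃ (Z : ℕ → ℝ → Phase d → ℝ) (R : ℝ → Phase d → ℝ),
      (∀ j ∈ Finset.Icc 1 N,
        IsSymbol δ ε₀ (1 + (1 - 2 * δ) * ((j : ℝ) - 1)) (Z j) ∧
          ∀ ε : ℝ, 0 < ε → ε < ε₀ → IsInNormalForm δ β ε (Z j ε)) ∧
      IsRemainder δ ε₀ N R ∧
      ∀ ε : ℝ, 0 < ε → ε < ε₀ → ∀ x : Phase d,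
        fullHam P ε (T ε x) = freeHam x.1 + ∑ j ∈ Finset.Icc 1 N, Z j ε x + R ε x

/-- The transformations `T_ε` are close to the identity: they move the actions by `O(ε^{1-δ})`, and
change any symbol of order `m` by `O(ε^{m+1-2δ})`, uniformly on phase space. -/
def IsNearIdentity {d : ℕ} (δ ε₀ : ℝ) (T : ℝ → Phase d → Phase d) : Prop :=
  (∃ C : ℝ, ∀ ε : ℝ, 0 < ε → ε < ε₀ → ∀ (x : Phase d) (j : Fin d),
      |(T ε x).1 j - x.1 j| ≤ C * ε ^ (1 - δ)) ∧
    ∀ (m : ℝ) (f : ℝ → Phase d → ℝ), IsSymbol δ ε₀ m f →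
      ∃ C : ℝ, ∀ ε : ℝ, 0 < ε → ε < ε₀ → ∀ x : Phase d,
        |f ε (T ε x) - f ε x| ≤ C * ε ^ (m + 1 - 2 * δ)

/-- The Hamiltonian vector field `(ṗ, q̇) = (-∂H/∂q, ∂H/∂p)`. -/
def hamField {d : ℕ} (H : Phase d → ℝ) (x : Phase d) : Phase d :=
  (WithLp.toLp 2 fun i => -dQ i H x, WithLp.toLp 2 fun i => dP i H x)

/-- `γ` is the orbit `t ↦ Φ^t_H(x₀)` of the Hamiltonian flow. -/
def IsHamOrbit {d : ℕ} (H : Phase d → ℝ) (x₀ : Phase d) (γ : ℝ → Phase d) : Prop :=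
  γ 0 = x₀ ∧ ∀ t : ℝ, HasDerivAt γ (hamField H (γ t)) t

end

/-! Existence. In the variables p = ε^δ p̃, a symbol of order m becomes a family all of whose
derivatives are O(ε^m), and the Hamiltonian becomes λH₀ + O(e) with λ = ε^(2δ) and e = ε. The
effective small parameter is h = ε^(1-2δ), since e = λh. The transformation is the time-one flow of
one Hamiltonian g of size h, not a composition of N maps. By the Lie series, the transformed
Hamiltonian minus λH₀ is `lieTaylor` up to a small error. A correction of g of size h^(j+1) changes
this polynomial by the bracket of λH₀ with the correction, which has size e h^j, plus terms of size
e h^(j+1). Hence the defect left after j steps can be removed, up to resonant terms, by solving a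
linear homological equation (`exists_homological`), and induction reaches order N
(`exists_generator`).

The homological equation is solved mode by mode, multiplying by ψ(p̃·k) with ψ(s) = (1 - χ(s))/s and
χ a bump function equal to 1 near 0. In the rescaled variables the resonant zone is |p̃·k| ≤ 1, so ψ
and its derivatives are bounded and no small divisor appears. Differentiating ψ(p̃·k) costs powers
of |k|, which the rapid decay of Fourier coefficients pays for. Modes beyond the cutoff K(ε) ≥
ε^(-β) are O(ε^M) relative to the function, for every M. Remainders need only C¹ bounds, so a sup
bound and a Lipschitz bound of the Taylor error along a 2-Lipschitz flow suffice
(`abs_lieTaylor_error_le`).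

Stability. The frequency map of H₀ is the identity, so the argument is pure geometry in action space
and uses no energy conservation. In a direction orthogonal to every k with |k| ≤ K and |p·k| ≤ ε^δ,
the normal form exerts no force (`IsInNormalForm.dirDeriv_eq_zero`), so the actions drift only
through the remainder, by at most ε^δ over the time considered. In the span of the resonant vectors,
the component of p is bounded directly: its inner products with integer vectors of length at most K
are small, and a Gram determinant of integer vectors is at least 1 (`norm_le_of_mem_span_intVec`).

It remains to keep the resonant span from changing. Resonant zones are given widths W_0 < W_1 < ⋯
growing geometrically by powers of K, and the orbit is observed from a time at which its resonance
level s is minimal. While p stays within (W_{s+1} - W_s)/K of that point, the span at width W_s is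
forced to be one fixed space of dimension s (`exists_resonant_decomposition`). This bounds the
displacement by less than the allowed distance, and a bootstrap closes the argument
(`norm_sub_le_of_slow_drift`, `exists_confinement`). -/

open scoped ContDiff

/-! ### Iterated directional derivatives -/

section Words

variable {E : Type*} [NormedAddCommGroup E] [NormedSpace ℝ E]

/-- The derivative of `f` in the direction `v`. -/
noncomputable def dirDeriv (v : E) (f : E → ℝ) : E → ℝ := fun x => fderiv ℝ f x v

/-- The iterated directional derivative of `f` along a list of directions. -/
noncomputable def iterDir (l : List E) (f : E → ℝ) : E → ℝ := l.foldr dirDeriv f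

@[simp] theorem iterDir_nil (f : E → ℝ) : iterDir [] f = f := rfl

@[simp] theorem iterDir_cons (v : E) (l : List E) (f : E → ℝ) :
    iterDir (v :: l) f = dirDeriv v (iterDir l f) := rfl

theorem iterDir_concat (l : List E) (v : E) (f : E → ℝ) :
    iterDir (l ++ [v]) f = iterDir l (dirDeriv v f) := by
  simp [iterDir, List.foldr_append]

theorem ContDiff.dirDeriv {f : E → ℝ} (hf : ContDiff ℝ ∞ f) (v : E) :
    ContDiff ℝ ∞ (dirDeriv v f) :=
  (hf.fderiv_right (m := ∞) (by simp)).clm_apply contDiff_const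

theorem ContDiff.iterDir {f : E → ℝ} (hf : ContDiff ℝ ∞ f) (l : List E) :
    ContDiff ℝ ∞ (iterDir l f) := by
  induction l with
  | nil => exact hf
  | cons v l ih => exact ih.dirDeriv v

theorem ContDiff.differentiable_top {F : Type*} [NormedAddCommGroup F] [NormedSpace ℝ F]
    {f : E → F} (hf : ContDiff ℝ ∞ f) : Differentiable ℝ f :=
  hf.differentiable (by simp)

theorem dirDeriv_add {f g : E → ℝ} (hf : Differentiable ℝ f) (hg : Differentiable ℝ g) (v : E) :
    dirDeriv v (fun x => f x + g x) = fun x => dirDeriv v f x + dirDeriv v g x := by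
  funext x
  simp [dirDeriv, fderiv_fun_add (hf x) (hg x)]

theorem dirDeriv_const_mul {f : E → ℝ} (hf : Differentiable ℝ f) (c : ℝ) (v : E) :
    dirDeriv v (fun x => c * f x) = fun x => c * dirDeriv v f x := by
  funext x
  simp [dirDeriv, fderiv_const_mul (hf x) c]

theorem dirDeriv_mul {f g : E → ℝ} (hf : Differentiable ℝ f) (hg : Differentiable ℝ g) (v : E) :
    dirDeriv v (fun x => f x * g x) = fun x => f x * dirDeriv v g x + g x * dirDeriv v f x := by
  funext x
  simp [dirDeriv, fderiv_fun_mul (hf x) (hg x)]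

theorem dirDeriv_zero (v : E) : dirDeriv v (fun _ : E => (0 : ℝ)) = fun _ => 0 := by
  funext x
  simp [dirDeriv]

theorem iterDir_zero (l : List E) : iterDir l (fun _ : E => (0 : ℝ)) = fun _ => 0 := by
  induction l with
  | nil => rfl
  | cons v l ih => rw [iterDir_cons, ih, dirDeriv_zero]

theorem iterDir_add {f g : E → ℝ} (hf : ContDiff ℝ ∞ f) (hg : ContDiff ℝ ∞ g) (l : List E) :
    iterDir l (fun x => f x + g x) = fun x => iterDir l f x + iterDir l g x := by
  induction l with
  | nil => rfl
  | cons v l ih =>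
    rw [iterDir_cons, ih, dirDeriv_add (hf.iterDir l).differentiable_top
      (hg.iterDir l).differentiable_top]
    rfl

theorem iterDir_const_mul {f : E → ℝ} (hf : ContDiff ℝ ∞ f) (c : ℝ) (l : List E) :
    iterDir l (fun x => c * f x) = fun x => c * iterDir l f x := by
  induction l with
  | nil => rfl
  | cons v l ih =>
    rw [iterDir_cons, ih, dirDeriv_const_mul (hf.iterDir l).differentiable_top]
    rfl

theorem iterDir_sum {κ : Type*} (s : Finset κ) {f : κ → E → ℝ} (hf : ∀ k, ContDiff ℝ ∞ (f k))
    (l : List E) :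
    iterDir l (fun x => ∑ k ∈ s, f k x) = fun x => ∑ k ∈ s, iterDir l (f k) x := by
  classical
  induction s using Finset.induction_on with
  | empty => simpa using iterDir_zero l
  | insert a s ha ih =>
    simp only [Finset.sum_insert ha]
    rw [iterDir_add (hf a) (ContDiff.sum fun k _ => hf k), ih]

/-- The general Leibniz rule, with the list of pairs of words left implicit. -/
theorem exists_leibniz (l : List E) : ∃ s : List (List E × List E), ∀ f g : E → ℝ,
    ContDiff ℝ ∞ f → ContDiff ℝ ∞ g → iterDir l (fun x => f x * g x) =
      fun x => (s.map fun p => iterDir p.1 f x * iterDir p.2 g x).sum := by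
  induction l with
  | nil => exact ⟨[([], [])], fun f g _ _ => by simp⟩
  | cons v l ih =>
    obtain ⟨s, hs⟩ := ih
    refine ⟨s.flatMap fun p => [(p.1, v :: p.2), (v :: p.1, p.2)], fun f g hf hg => ?_⟩
    rw [iterDir_cons, hs f g hf hg]
    clear hs
    induction s with
    | nil => simpa using dirDeriv_zero v
    | cons p s ih =>
      have hsm : ContDiff ℝ ∞
          (fun x => (s.map fun p => iterDir p.1 f x * iterDir p.2 g x).sum) := by
        clear ih
        induction s with
        | nil => simpa using contDiff_const
        | cons p s ih =>
          simp only [List.map_cons, List.sum_cons]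
          exact ((hf.iterDir _).mul (hg.iterDir _)).add ih
      simp only [List.map_cons, List.sum_cons, List.flatMap_cons, List.map_append,
        List.sum_append]
      rw [dirDeriv_add ((hf.iterDir _).mul (hg.iterDir _)).differentiable_top
        hsm.differentiable_top, ih, dirDeriv_mul (hf.iterDir _).differentiable_top
        (hg.iterDir _).differentiable_top]
      funext x
      simp only [iterDir_cons, List.map_nil, List.sum_nil]
      ring

theorem dirDeriv_comp_clm {F : Type*} [NormedAddCommGroup F] [NormedSpace ℝ F] (L : E →L[ℝ] F)
    {f : F → ℝ} (hf : Differentiable ℝ f) (v : E) :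
    dirDeriv v (fun x => f (L x)) = fun x => dirDeriv (L v) f (L x) := by
  funext x
  have := fderiv_comp x (hf (L x)) L.differentiableAt
  simp only [Function.comp_def] at this
  simp [dirDeriv, this]

theorem iterDir_comp_clm {F : Type*} [NormedAddCommGroup F] [NormedSpace ℝ F] (L : E →L[ℝ] F)
    {f : F → ℝ} (hf : ContDiff ℝ ∞ f) (l : List E) :
    iterDir l (fun x => f (L x)) = fun x => iterDir (l.map L) f (L x) := by
  induction l with
  | nil => rfl
  | cons v l ih =>
    rw [iterDir_cons, ih, dirDeriv_comp_clm L (hf.iterDir _).differentiable_top]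
    rfl

theorem dirDeriv_comm {f : E → ℝ} (hf : ContDiff ℝ ∞ f) (u v : E) :
    dirDeriv u (dirDeriv v f) = dirDeriv v (dirDeriv u f) := by
  have key : ∀ u v x, dirDeriv u (dirDeriv v f) x = fderiv ℝ (fderiv ℝ f) x u v := by
    intro u v x
    have hd : DifferentiableAt ℝ (fderiv ℝ f) x :=
      ((hf.fderiv_right (m := ∞) (by simp)).differentiable_top) x
    show fderiv ℝ (fun y => fderiv ℝ f y v) x u = _
    rw [fderiv_clm_apply hd (differentiableAt_const v)]
    simp
  funext x
  rw [key, key]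
  exact (hf.contDiffAt.isSymmSndFDerivAt (by
    rw [minSmoothness_of_isRCLikeNormedField]; exact WithTop.coe_le_coe.2 le_top)) u v

end Words

/-! ### Families of functions with uniformly bounded derivatives -/

section Uniform

variable {E : Type*} [NormedAddCommGroup E] [NormedSpace ℝ E] {ι : Type*}

/-- A family of smooth functions all of whose derivatives are bounded by a multiple of `w`,
uniformly in the point and in the index. -/
structure UniformSymbol (w : ι → ℝ) (f : ι → E → ℝ) : Prop where
  smooth : ∀ i, ContDiff ℝ ∞ (f i)
  bound : ∀ l : List E, ∃ C : ℝ, ∀ i x, |iterDir l (f i) x| ≤ C * w i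

namespace UniformSymbol

variable {w w' : ι → ℝ} {f g : ι → E → ℝ}

theorem dirDeriv (hf : UniformSymbol w f) (v : E) :
    UniformSymbol w (fun i => dirDeriv v (f i)) where
  smooth i := (hf.smooth i).dirDeriv v
  bound l := by
    obtain ⟨C, hC⟩ := hf.bound (l ++ [v])
    exact ⟨C, fun i x => by simpa only [iterDir_concat] using hC i x⟩

theorem add (hf : UniformSymbol w f) (hg : UniformSymbol w g) :
    UniformSymbol w (fun i x => f i x + g i x) where
  smooth i := (hf.smooth i).add (hg.smooth i)
  bound l := by
    obtain ⟨C, hC⟩ := hf.bound l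
    obtain ⟨D, hD⟩ := hg.bound l
    refine ⟨C + D, fun i x => ?_⟩
    rw [iterDir_add (hf.smooth i) (hg.smooth i), add_mul]
    exact (abs_add_le _ _).trans (add_le_add (hC i x) (hD i x))

/-- Multiplication by index-dependent constants. -/
theorem const_mul (hf : UniformSymbol w f) (c : ι → ℝ) :
    UniformSymbol (fun i => |c i| * w i) (fun i x => c i * f i x) where
  smooth i := contDiff_const.mul (hf.smooth i)
  bound l := by
    obtain ⟨C, hC⟩ := hf.bound l
    refine ⟨C, fun i x => ?_⟩
    rw [iterDir_const_mul (hf.smooth i), abs_mul]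
    calc |c i| * |iterDir l (f i) x| ≤ |c i| * (C * w i) := by gcongr; exact hC i x
      _ = C * (|c i| * w i) := by ring

theorem mono (hf : UniformSymbol w f) (hw : ∀ i, 0 ≤ w i) (D : ℝ) (h : ∀ i, w i ≤ D * w' i) :
    UniformSymbol w' f where
  smooth := hf.smooth
  bound l := by
    obtain ⟨C, hC⟩ := hf.bound l
    -- The constant of a bound need not be nonnegative when the family is empty or `w` vanishes,
    -- hence the absolute value.
    refine ⟨|C| * D, fun i x => (hC i x).trans ?_⟩
    calc C * w i ≤ |C| * w i := by gcongr; exacts [hw i, le_abs_self C]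
      _ ≤ |C| * (D * w' i) := by gcongr; exact h i
      _ = |C| * D * w' i := by ring

theorem scalar_mul (hf : UniformSymbol w f) (hw : ∀ i, 0 ≤ w i) (c : ℝ) :
    UniformSymbol w (fun i x => c * f i x) :=
  (hf.const_mul fun _ => c).mono (fun i => mul_nonneg (abs_nonneg _) (hw i)) |c| fun _ => le_rfl

theorem neg (hf : UniformSymbol w f) : UniformSymbol w (fun i x => -f i x) := by
  have := hf.const_mul fun _ => -1
  simpa using this

theorem sub (hf : UniformSymbol w f) (hg : UniformSymbol w g) :
    UniformSymbol w (fun i x => f i x - g i x) := by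
  simpa [sub_eq_add_neg] using hf.add hg.neg

theorem zero : UniformSymbol w (fun (_ : ι) (_ : E) => (0 : ℝ)) where
  smooth _ := contDiff_const
  bound l := ⟨0, fun i x => by simp [iterDir_zero]⟩

theorem sum {κ : Type*} (s : Finset κ) {f : κ → ι → E → ℝ}
    (hf : ∀ k ∈ s, UniformSymbol w (f k)) : UniformSymbol w (fun i x => ∑ k ∈ s, f k i x) := by
  classical
  induction s using Finset.induction_on with
  | empty => simpa using zero
  | insert a s ha ih =>
    simp only [Finset.sum_insert ha]
    exact (hf a (Finset.mem_insert_self a s)).add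
      (ih fun k hk => hf k (Finset.mem_insert_of_mem hk))

theorem mul (hf : UniformSymbol w f) (hg : UniformSymbol w' g) :
    UniformSymbol (fun i => w i * w' i) (fun i x => f i x * g i x) where
  smooth i := (hf.smooth i).mul (hg.smooth i)
  bound l := by
    obtain ⟨s, hs⟩ := exists_leibniz l
    suffices h : ∃ C : ℝ, ∀ i x,
        |(s.map fun p => iterDir p.1 (f i) x * iterDir p.2 (g i) x).sum| ≤ C * (w i * w' i) by
      obtain ⟨C, hC⟩ := h
      exact ⟨C, fun i x => by rw [hs _ _ (hf.smooth i) (hg.smooth i)]; exact hC i x⟩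
    clear hs
    induction s with
    | nil => exact ⟨0, fun i x => by simp⟩
    | cons p s ih =>
      obtain ⟨C, hC⟩ := ih
      obtain ⟨A, hA⟩ := hf.bound p.1
      obtain ⟨B, hB⟩ := hg.bound p.2
      refine ⟨A * B + C, fun i x => ?_⟩
      simp only [List.map_cons, List.sum_cons]
      refine (abs_add_le _ _).trans ?_
      have h1 : |iterDir p.1 (f i) x * iterDir p.2 (g i) x| ≤ (A * w i) * (B * w' i) := by
        rw [abs_mul]
        exact mul_le_mul (hA i x) (hB i x) (abs_nonneg _) ((abs_nonneg _).trans (hA i x))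
      linarith [hC i x]

/-- A class of families of differentiable functions that is closed under directional derivatives
and consists of families bounded by `w` consists of uniform symbols. -/
theorem of_class [FiniteDimensional ℝ E] (𝒞 : (ι → E → ℝ) → Prop)
    (hdiff : ∀ f, 𝒞 f → ∀ i, Differentiable ℝ (f i))
    (hder : ∀ f, 𝒞 f → ∀ v, 𝒞 fun i => _root_.dirDeriv v (f i))
    (hb : ∀ f, 𝒞 f → ∃ C : ℝ, ∀ i x, |f i x| ≤ C * w i) (hf : 𝒞 f) : UniformSymbol w f where
  smooth i := by
    have key : ∀ n : ℕ, ∀ f, 𝒞 f → ContDiff ℝ n (f i) := by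
      intro n
      induction n with
      | zero => exact fun f hf => contDiff_zero.2 (hdiff f hf i).continuous
      | succ n ih =>
        intro f hf
        rw [show ((n + 1 : ℕ) : WithTop ℕ∞) = (n : WithTop ℕ∞) + 1 from by push_cast; rfl,
          contDiff_succ_iff_fderiv]
        refine ⟨hdiff f hf i, by simp, ?_⟩
        rw [contDiff_clm_apply_iff]
        exact fun v => ih _ (hder f hf v)
    exact contDiff_infty.2 fun n => key n f hf
  bound l := by
    have key : ∀ l : List E, ∀ f, 𝒞 f → ∃ C : ℝ, ∀ i x, |iterDir l (f i) x| ≤ C * w i := by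
      intro l
      induction l using List.reverseRecOn with
      | nil => exact hb
      | append_singleton l v ih =>
        intro f hf
        simp only [iterDir_concat]
        exact ih _ (hder f hf v)
    exact key l f hf

theorem exists_norm_fderiv_le [FiniteDimensional ℝ E] (hf : UniformSymbol w f)
    (hw : ∀ i, 0 ≤ w i) : ∃ C : ℝ, 0 ≤ C ∧ ∀ i x, ‖fderiv ℝ (f i) x‖ ≤ C * w i := by
  let b := Module.finBasis ℝ E
  choose C hC using fun j => hf.bound [b j]
  obtain ⟨D, hD0, hD⟩ := b.exists_opNorm_le (F := ℝ)
  refine ⟨D * ∑ j, |C j|, by positivity, fun i x => ?_⟩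
  rw [mul_assoc]
  refine hD (by have := hw i; positivity) fun j => ?_
  calc ‖fderiv ℝ (f i) x (b j)‖ ≤ C j * w i := hC j i x
    _ ≤ |C j| * w i := by gcongr; exacts [hw i, le_abs_self _]
    _ ≤ (∑ j, |C j|) * w i := by
      gcongr
      · exact hw i
      · exact Finset.single_le_sum (f := fun j => |C j|) (fun _ _ => abs_nonneg _)
          (Finset.mem_univ j)

theorem restrict {κ : Type*} (hf : UniformSymbol w f) (e : κ → ι) :
    UniformSymbol (fun k => w (e k)) (fun k => f (e k)) where
  smooth k := hf.smooth _
  bound l := by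
    obtain ⟨C, hC⟩ := hf.bound l
    exact ⟨C, fun k x => hC _ x⟩

end UniformSymbol

end Uniform

/-! ### Symbols in rescaled variables -/

section Rescaling

variable {d : ℕ}

/-- The rescaling `(p, q) ↦ (c p, q)` of the actions. -/
noncomputable def scaleMap (d : ℕ) (c : ℝ) : Phase d →L[ℝ] Phase d :=
  (c • ContinuousLinearMap.id ℝ (ActionSpace d)).prodMap (ContinuousLinearMap.id ℝ (ActionSpace d))

@[simp] theorem scaleMap_apply (c : ℝ) (x : Phase d) : scaleMap d c x = (c • x.1, x.2) := rfl

theorem SamePoint.scaleMap {x y : Phase d} (h : SamePoint x y) (c : ℝ) :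
    SamePoint (scaleMap d c x) (scaleMap d c y) :=
  ⟨by simp [h.1], h.2⟩

theorem dP_eq_dirDeriv (i : Fin d) (f : Phase d → ℝ) :
    dP i f = dirDeriv (EuclideanSpace.single i 1, 0) f := rfl

theorem dQ_eq_dirDeriv (i : Fin d) (f : Phase d → ℝ) :
    dQ i f = dirDeriv (0, EuclideanSpace.single i 1) f := rfl

theorem dirDeriv_eq_sum (v : Phase d) (f : Phase d → ℝ) (x : Phase d) :
    dirDeriv v f x = ∑ i, v.1 i * dP i f x + ∑ i, v.2 i * dQ i f x := by
  have h : v = ∑ i, v.1 i • ((EuclideanSpace.single i (1 : ℝ), 0) : Phase d) +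
      ∑ i, v.2 i • ((0, EuclideanSpace.single i (1 : ℝ)) : Phase d) := by
    refine Prod.ext ?_ ?_ <;>
    · ext j
      simp [Prod.fst_sum, Prod.snd_sum, Finset.sum_apply, Pi.single_apply, WithLp.ofLp_sum]
  conv_lhs => rw [dirDeriv, h]
  rw [map_add, map_sum, map_sum]
  simp only [map_smul, smul_eq_mul]
  rfl

theorem partialPQ_eq_iterDir (α β : List (Fin d)) (f : Phase d → ℝ) :
    partialPQ α β f = iterDir (α.map (fun i => (EuclideanSpace.single i 1, 0)) ++
      β.map (fun i => (0, EuclideanSpace.single i 1))) f := by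
  simp only [partialPQ, iterDir, List.foldr_append, List.foldr_map]
  rfl

theorem iterDir_comm_dirDeriv {E : Type*} [NormedAddCommGroup E] [NormedSpace ℝ E] {f : E → ℝ}
    (hf : ContDiff ℝ ∞ f) (l : List E) (v : E) :
    iterDir l (dirDeriv v f) = dirDeriv v (iterDir l f) := by
  induction l with
  | nil => rfl
  | cons u l ih => rw [iterDir_cons, ih, iterDir_cons, dirDeriv_comm (hf.iterDir l)]

theorem dirDeriv_periodic {f : Phase d → ℝ} (hf : ∀ x y, SamePoint x y → f x = f y)
    (v : Phase d) {x y : Phase d} (h : SamePoint x y) : dirDeriv v f x = dirDeriv v f y := by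
  have hy : y = x + (0, y.2 - x.2) := by
    refine Prod.ext ?_ ?_ <;> simp [h.1]
  have hc : (fun z => f (z + (0, y.2 - x.2))) = f := by
    funext z
    obtain ⟨n, hn⟩ := h.2
    refine (hf _ _ ⟨by simp, n, fun i => ?_⟩).symm
    simp [hn i]
  rw [dirDeriv, dirDeriv, hy, ← fderiv_comp_add_right, hc]

namespace IsSmoothOnPhase

variable {f g : Phase d → ℝ}

theorem add (hf : IsSmoothOnPhase f) (hg : IsSmoothOnPhase g) :
    IsSmoothOnPhase fun x => f x + g x :=
  ⟨hf.1.add hg.1, fun x y h => congrArg₂ (· + ·) (hf.2 x y h) (hg.2 x y h)⟩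

theorem const_mul (hf : IsSmoothOnPhase f) (c : ℝ) : IsSmoothOnPhase fun x => c * f x :=
  ⟨contDiff_const.mul hf.1, fun x y h => congrArg (c * ·) (hf.2 x y h)⟩

theorem dirDeriv (hf : IsSmoothOnPhase f) (v : Phase d) : IsSmoothOnPhase (dirDeriv v f) :=
  ⟨ContDiff.dirDeriv hf.1 v, fun _ _ h => dirDeriv_periodic hf.2 v h⟩

end IsSmoothOnPhase

/-- The bound of `SymbolBound` without division. -/
theorem symbolBound_iff {δ ε₀ m : ℝ} {α β : List (Fin d)} {f : ℝ → Phase d → ℝ} :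
    SymbolBound δ ε₀ m α β f ↔ ∃ C : ℝ, ∀ ε : ℝ, 0 < ε → ε < ε₀ → ∀ x : Phase d,
      (ε ^ δ) ^ α.length * |partialPQ α β (f ε) x| ≤ C * ε ^ m := by
  refine exists_congr fun C => forall_congr' fun ε => forall_congr' fun hε => forall_congr' fun _ =>
    forall_congr' fun x => ?_
  have h1 : 0 < ε ^ m := Real.rpow_pos_of_pos hε m
  have h2 : ε ^ ((α.length : ℝ) * δ) = (ε ^ δ) ^ α.length := by
    rw [mul_comm, Real.rpow_mul hε.le, Real.rpow_natCast]
  have h3 : 0 < (ε ^ δ) ^ α.length := pow_pos (Real.rpow_pos_of_pos hε δ) _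
  rw [h2, abs_mul, abs_div, abs_of_pos h1, abs_of_pos h3, div_mul_eq_mul_div, div_le_iff₀ h1,
    mul_comm]

namespace IsSymbol

variable {δ ε₀ m : ℝ} {f g : ℝ → Phase d → ℝ}

theorem add (hf : IsSymbol δ ε₀ m f) (hg : IsSymbol δ ε₀ m g) :
    IsSymbol δ ε₀ m fun ε x => f ε x + g ε x := by
  refine ⟨fun ε h0 h1 => (hf.1 ε h0 h1).add (hg.1 ε h0 h1), fun α β => ?_⟩
  obtain ⟨C, hC⟩ := symbolBound_iff.1 (hf.2 α β)
  obtain ⟨D, hD⟩ := symbolBound_iff.1 (hg.2 α β)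
  refine symbolBound_iff.2 ⟨C + D, fun ε h0 h1 x => ?_⟩
  have := hC ε h0 h1 x
  have := hD ε h0 h1 x
  rw [partialPQ_eq_iterDir] at *
  rw [iterDir_add (hf.1 ε h0 h1).1 (hg.1 ε h0 h1).1]
  have h3 : 0 < (ε ^ δ) ^ α.length := pow_pos (Real.rpow_pos_of_pos h0 δ) _
  calc _ ≤ (ε ^ δ) ^ α.length * (|_| + |_|) := by gcongr; exact abs_add_le _ _
    _ ≤ _ := by rw [mul_add, add_mul]; gcongr

theorem const_mul (hf : IsSymbol δ ε₀ m f) (c : ℝ) :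
    IsSymbol δ ε₀ m fun ε x => c * f ε x := by
  refine ⟨fun ε h0 h1 => (hf.1 ε h0 h1).const_mul c, fun α β => ?_⟩
  obtain ⟨C, hC⟩ := symbolBound_iff.1 (hf.2 α β)
  refine symbolBound_iff.2 ⟨|c| * C, fun ε h0 h1 x => ?_⟩
  have := hC ε h0 h1 x
  rw [partialPQ_eq_iterDir] at *
  rw [iterDir_const_mul (hf.1 ε h0 h1).1, abs_mul, mul_left_comm, mul_assoc]
  gcongr

theorem zero : IsSymbol δ ε₀ m fun _ (_ : Phase d) => 0 := by
  refine ⟨fun ε h0 h1 => ⟨contDiff_const, fun _ _ _ => rfl⟩, fun α β => ?_⟩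
  exact symbolBound_iff.2 ⟨0, fun ε h0 h1 x => by simp [partialPQ_eq_iterDir, iterDir_zero]⟩

theorem sum {κ : Type*} (s : Finset κ) {f : κ → ℝ → Phase d → ℝ}
    (hf : ∀ k ∈ s, IsSymbol δ ε₀ m (f k)) : IsSymbol δ ε₀ m fun ε x => ∑ k ∈ s, f k ε x := by
  classical
  induction s using Finset.induction_on with
  | empty => simpa using zero
  | insert a s ha ih =>
    simp only [Finset.sum_insert ha]
    exact (hf a (Finset.mem_insert_self a s)).add
      (ih fun k hk => hf k (Finset.mem_insert_of_mem hk))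

theorem dQ (hf : IsSymbol δ ε₀ m f) (i : Fin d) : IsSymbol δ ε₀ m fun ε => dQ i (f ε) := by
  refine ⟨fun ε h0 h1 => (hf.1 ε h0 h1).dirDeriv _, fun α β => ?_⟩
  obtain ⟨C, hC⟩ := symbolBound_iff.1 (hf.2 α (β ++ [i]))
  refine symbolBound_iff.2 ⟨C, fun ε h0 h1 x => ?_⟩
  have := hC ε h0 h1 x
  rw [partialPQ_eq_iterDir] at *
  rwa [List.map_append, List.map_singleton, ← List.append_assoc, iterDir_concat] at this

/-- A derivative in the actions costs ε^(-δ), which the prefactor repays. This product is what the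
chain rule produces in the rescaled variables. -/
theorem rpow_mul_dP (hf : IsSymbol δ ε₀ m f) (i : Fin d) :
    IsSymbol δ ε₀ m fun ε x => ε ^ δ * dP i (f ε) x := by
  refine ⟨fun ε h0 h1 => ((hf.1 ε h0 h1).dirDeriv _).const_mul _, fun α β => ?_⟩
  obtain ⟨C, hC⟩ := symbolBound_iff.1 (hf.2 (i :: α) β)
  refine symbolBound_iff.2 ⟨C, fun ε h0 h1 x => ?_⟩
  have := hC ε h0 h1 x
  have hs := (hf.1 ε h0 h1).1
  rw [partialPQ_eq_iterDir] at *
  rw [dP_eq_dirDeriv, iterDir_const_mul (hs.dirDeriv _), iterDir_comm_dirDeriv hs, abs_mul,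
    abs_of_pos (Real.rpow_pos_of_pos h0 δ), ← mul_assoc]
  simpa [pow_succ] using this

/-- In the rescaled variables, all derivatives of a symbol of order `m` are `O(ε^m)`. -/
theorem uniformSymbol (hf : IsSymbol δ ε₀ m f) {ε₁ : ℝ} (h₁ : ε₁ ≤ ε₀) :
    UniformSymbol (fun ε : Set.Ioo (0 : ℝ) ε₁ => (ε : ℝ) ^ m)
      (fun ε x => f ε (scaleMap d ((ε : ℝ) ^ δ) x)) := by
  -- Rescaled symbols of order m form a class closed under directional derivatives, so only the
  -- undifferentiated bound has to be checked.
  refine UniformSymbol.of_class (fun F => ∃ f : ℝ → Phase d → ℝ, IsSymbol δ ε₀ m f ∧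
    F = fun (ε : Set.Ioo (0 : ℝ) ε₁) x => f ε (scaleMap d ((ε : ℝ) ^ δ) x)) ?_ ?_ ?_ ⟨f, hf, rfl⟩
  · rintro _ ⟨f, hf, rfl⟩ ε
    exact ((hf.1 ε ε.2.1 (ε.2.2.trans_le h₁)).1.comp
      (scaleMap d _).contDiff).differentiable_top
  · rintro _ ⟨f, hf, rfl⟩ v
    refine ⟨fun ε x => ∑ i, v.1 i * (ε ^ δ * dP i (f ε) x) + ∑ i, v.2 i * _root_.dQ i (f ε) x,
      ?_, ?_⟩
    · exact (sum _ fun i _ => (hf.rpow_mul_dP i).const_mul _).add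
        (sum _ fun i _ => (hf.dQ i).const_mul _)
    · funext ε x
      rw [dirDeriv_comp_clm _ (hf.1 ε ε.2.1 (ε.2.2.trans_le h₁)).1.differentiable_top]
      beta_reduce
      rw [dirDeriv_eq_sum]
      simp only [scaleMap_apply, PiLp.smul_apply, smul_eq_mul]
      congr 1
      exact Finset.sum_congr rfl fun i _ => by ring
  · rintro _ ⟨f, hf, rfl⟩
    obtain ⟨C, hC⟩ := symbolBound_iff.1 (hf.2 [] [])
    refine ⟨C, fun ε x => ?_⟩
    simpa [partialPQ] using hC ε ε.2.1 (ε.2.2.trans_le h₁) (scaleMap d ((ε : ℝ) ^ δ) x)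

end IsSymbol

theorem partialPQ_comp_scaleMap {c : ℝ} (hc : c ≠ 0) {f : Phase d → ℝ} (hf : ContDiff ℝ ∞ f)
    (α β : List (Fin d)) (x : Phase d) :
    c ^ α.length * partialPQ α β (fun x => f (scaleMap d c⁻¹ x)) x =
      partialPQ α β f (scaleMap d c⁻¹ x) := by
  induction α generalizing x with
  | nil =>
    rw [partialPQ_eq_iterDir, partialPQ_eq_iterDir, iterDir_comp_clm _ hf]
    simp [Function.comp_def]
  | cons i α ih =>
    have hs : ContDiff ℝ ∞ (partialPQ α β f) := by
      rw [partialPQ_eq_iterDir]; exact hf.iterDir _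
    have hs' : ContDiff ℝ ∞ (partialPQ α β fun x => f (scaleMap d c⁻¹ x)) := by
      rw [partialPQ_eq_iterDir]; exact (hf.comp (scaleMap d c⁻¹).contDiff).iterDir _
    have hfun : (fun x => c ^ α.length * partialPQ α β (fun x => f (scaleMap d c⁻¹ x)) x) =
        fun x => partialPQ α β f (scaleMap d c⁻¹ x) := funext ih
    have h2 := congrFun (congrArg (dirDeriv (EuclideanSpace.single i 1, 0)) hfun) x
    rw [dirDeriv_const_mul hs'.differentiable_top,
      dirDeriv_comp_clm _ hs.differentiable_top] at h2
    have h3 : scaleMap d c⁻¹ (EuclideanSpace.single i 1, 0) =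
        c⁻¹ • ((EuclideanSpace.single i 1, 0) : Phase d) := by simp
    simp only [h3, dirDeriv, map_smul, smul_eq_mul] at h2
    show c ^ (α.length + 1) * dP i _ x = dP i _ _
    rw [pow_succ', mul_assoc]
    exact (congrArg (c * ·) h2).trans (mul_inv_cancel_left₀ hc _)

open Classical in
/-- The family equal to `F ε`, in the rescaled variables, for `ε < ε₁` and to `g ε` otherwise. -/
noncomputable def unscale (δ ε₁ : ℝ) (F : Set.Ioo (0 : ℝ) ε₁ → Phase d → ℝ)
    (g : ℝ → Phase d → ℝ) (ε : ℝ) (x : Phase d) : ℝ :=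
  if h : ε ∈ Set.Ioo (0 : ℝ) ε₁ then F ⟨ε, h⟩ (scaleMap d (ε ^ δ)⁻¹ x) else g ε x

theorem unscale_of_mem {δ ε₁ ε : ℝ} (F : Set.Ioo (0 : ℝ) ε₁ → Phase d → ℝ)
    (g : ℝ → Phase d → ℝ) (h : ε ∈ Set.Ioo (0 : ℝ) ε₁) :
    unscale δ ε₁ F g ε = fun x => F ⟨ε, h⟩ (scaleMap d (ε ^ δ)⁻¹ x) := by
  funext x; simp [unscale, h]

theorem unscale_of_notMem {δ ε₁ ε : ℝ} (F : Set.Ioo (0 : ℝ) ε₁ → Phase d → ℝ)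
    (g : ℝ → Phase d → ℝ) (h : ε ∉ Set.Ioo (0 : ℝ) ε₁) : unscale δ ε₁ F g ε = g ε := by
  funext x; simp only [unscale, h, dite_false]

theorem isSmoothOnPhase_unscale {δ ε₀ ε₁ : ℝ} {F : Set.Ioo (0 : ℝ) ε₁ → Phase d → ℝ}
    (hF : ∀ ε, IsSmoothOnPhase (F ε)) {g : ℝ → Phase d → ℝ}
    (hg : ∀ ε, 0 < ε → ε < ε₀ → IsSmoothOnPhase (g ε)) {ε : ℝ} (h0 : 0 < ε) (h1 : ε < ε₀) :
    IsSmoothOnPhase (unscale δ ε₁ F g ε) := by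
  by_cases h : ε ∈ Set.Ioo (0 : ℝ) ε₁
  · rw [unscale_of_mem F g h]
    exact ⟨(hF _).1.comp (scaleMap d _).contDiff, fun x y hxy => (hF _).2 _ _ (hxy.scaleMap _)⟩
  · rw [unscale_of_notMem F g h]
    exact hg ε h0 h1

/-- Bounds at `ε < ε₁` in the rescaled variables and a symbol bound for the other part give a
symbol bound for the spliced family. -/
theorem symbolBound_unscale {δ ε₀ ε₁ m m' : ℝ} (hε₁ : 0 < ε₁)
    {F : Set.Ioo (0 : ℝ) ε₁ → Phase d → ℝ}
    (hF : ∀ ε, ContDiff ℝ ∞ (F ε)) {g : ℝ → Phase d → ℝ} {α β : List (Fin d)}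
    (hb : ∃ C : ℝ, ∀ (ε : Set.Ioo (0 : ℝ) ε₁) x, |partialPQ α β (F ε) x| ≤ C * (ε : ℝ) ^ m)
    (hg : SymbolBound δ ε₀ m' α β g) : SymbolBound δ ε₀ m α β (unscale δ ε₁ F g) := by
  obtain ⟨C, hC⟩ := hb
  obtain ⟨D, hD⟩ := symbolBound_iff.1 hg
  -- Away from ε = 0 all powers of ε are comparable, so for ε ≥ ε₁ a bound of any order m' serves as
  -- a bound of order m.
  have hcont : ContinuousOn (fun ε : ℝ => ε ^ m' / ε ^ m) (Set.Icc ε₁ (max ε₀ ε₁)) := by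
    refine ContinuousOn.div ?_ ?_ ?_
    · exact fun ε hε => (Real.continuousAt_rpow_const _ _
        (Or.inl (hε₁.trans_le hε.1).ne')).continuousWithinAt
    · exact fun ε hε => (Real.continuousAt_rpow_const _ _
        (Or.inl (hε₁.trans_le hε.1).ne')).continuousWithinAt
    · exact fun ε hε => (Real.rpow_pos_of_pos (hε₁.trans_le hε.1) _).ne'
  obtain ⟨B, hB⟩ := isCompact_Icc.exists_bound_of_continuousOn hcont
  refine symbolBound_iff.2 ⟨max C (|D| * B), fun ε h0 h1 x => ?_⟩
  have hpm : 0 < ε ^ m := Real.rpow_pos_of_pos h0 m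
  by_cases h : ε ∈ Set.Ioo (0 : ℝ) ε₁
  · rw [unscale_of_mem F g h]
    have h3 : 0 < ε ^ δ := Real.rpow_pos_of_pos h0 δ
    rw [← abs_of_pos (pow_pos h3 α.length), ← abs_mul,
      partialPQ_comp_scaleMap h3.ne' (hF _)]
    refine (hC ⟨ε, h⟩ _).trans ?_
    gcongr
    exact le_max_left _ _
  · rw [unscale_of_notMem F g h]
    have hle : ε₁ ≤ ε := not_lt.1 fun h' => h ⟨h0, h'⟩
    have h4 := hB ε ⟨hle, h1.le.trans (le_max_left _ _)⟩
    rw [Real.norm_of_nonneg (by positivity), div_le_iff₀ hpm] at h4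
    calc _ ≤ D * ε ^ m' := hD ε h0 h1 x
      _ ≤ |D| * ε ^ m' := by gcongr; exact le_abs_self _
      _ ≤ |D| * (B * ε ^ m) := by gcongr
      _ = |D| * B * ε ^ m := by ring
      _ ≤ _ := by gcongr; exact le_max_right _ _

theorem UniformSymbol.isSymbol_unscale {δ ε₀ ε₁ m : ℝ} (hε₁ : 0 < ε₁)
    {F : Set.Ioo (0 : ℝ) ε₁ → Phase d → ℝ}
    (hF : UniformSymbol (fun ε : Set.Ioo (0 : ℝ) ε₁ => (ε : ℝ) ^ m) F)
    (hper : ∀ ε x y, SamePoint x y → F ε x = F ε y) :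
    IsSymbol δ ε₀ m (unscale δ ε₁ F fun _ _ => 0) := by
  refine ⟨fun ε h0 h1 => isSmoothOnPhase_unscale (fun ε => ⟨hF.smooth ε, hper ε⟩)
    (fun _ _ _ => ⟨contDiff_const, fun _ _ _ => rfl⟩) h0 h1, fun α β => ?_⟩
  refine symbolBound_unscale hε₁ hF.smooth ?_ (IsSymbol.zero.2 α β : SymbolBound δ ε₀ m α β _)
  obtain ⟨C, hC⟩ := hF.bound (α.map (fun i => (EuclideanSpace.single i 1, 0)) ++
      β.map (fun i => (0, EuclideanSpace.single i 1)))
  exact ⟨C, fun ε x => by rw [partialPQ_eq_iterDir]; exact hC ε x⟩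

end Rescaling

/-! ### Flows of smooth vector fields with small Lipschitz constant -/

section Superposition

open scoped unitInterval

variable {K : Type*} [TopologicalSpace K] [CompactSpace K]
  {E F : Type} [NormedAddCommGroup E] [NormedSpace ℝ E] [NormedAddCommGroup F] [NormedSpace ℝ F]

/-- Pointwise application of a continuous family of continuous linear maps. -/
noncomputable def pointwiseApply (K : Type*) [TopologicalSpace K] [CompactSpace K] (E F : Type)
    [NormedAddCommGroup E] [NormedSpace ℝ E] [NormedAddCommGroup F] [NormedSpace ℝ F] :
    C(K, E →L[ℝ] F) →L[ℝ] C(K, E) →L[ℝ] C(K, F) :=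
  LinearMap.mkContinuous₂
    (LinearMap.mk₂ ℝ (fun (A : C(K, E →L[ℝ] F)) (h : C(K, E)) => (⟨fun s => A s (h s), A.continuous.clm_apply h.continuous⟩ :
        C(K, F)))
      (fun _ _ _ => by ext; simp) (fun _ _ _ => by ext; simp) (fun _ _ _ => by ext; simp)
      (fun _ _ _ => by ext; simp)) 1 (fun A h => by
      rw [one_mul, ContinuousMap.norm_le _ (by positivity)]
      exact fun s => (A s).le_of_opNorm_le_of_le (A.norm_coe_le_norm s) (h.norm_coe_le_norm s))

@[simp] theorem pointwiseApply_apply (A : C(K, E →L[ℝ] F)) (h : C(K, E)) (s : K) :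
    pointwiseApply K E F A h s = A s (h s) := rfl

/-- Compactness of the parameter space makes f' ∘ u depend continuously on u in the sup norm, so the
mean value inequality applies at every parameter with one common constant. -/
theorem hasFDerivAt_superposition (f : C(E, F)) (f' : C(E, E →L[ℝ] F))
    (hf : ∀ x, HasFDerivAt f (f' x) x) (u : C(K, E)) :
    HasFDerivAt (fun u : C(K, E) => f.comp u) (pointwiseApply K E F (f'.comp u)) u := by
  rw [hasFDerivAt_iff_isLittleO_nhds_zero, Asymptotics.isLittleO_iff]
  intro c hc
  have hcont := (ContinuousMap.continuous_postcomp (X := K) f').continuousAt (x := u)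
  obtain ⟨r, hr, hball⟩ := (Metric.continuousAt_iff (α := C(K, E)) (β := C(K, E →L[ℝ] F))).1
    hcont c hc
  filter_upwards [Metric.ball_mem_nhds (0 : C(K, E)) hr] with h hh
  rw [mem_ball_zero_iff] at hh
  rw [ContinuousMap.norm_le _ (by positivity)]
  intro s
  have hseg : ∀ z ∈ segment ℝ (u s) (u s + h s), ‖f' z - f' (u s)‖ ≤ c := by
    intro z hz
    rw [segment_eq_image'] at hz
    obtain ⟨θ, hθ, rfl⟩ := hz
    have h1 : dist (u + θ • h) u < r := by
      rw [dist_eq_norm, add_sub_cancel_left, norm_smul, Real.norm_of_nonneg hθ.1]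
      exact (mul_le_of_le_one_left (norm_nonneg _) hθ.2).trans_lt hh
    have h2 := (ContinuousMap.dist_apply_le_dist s).trans (hball h1).le
    rw [dist_eq_norm] at h2
    simpa using h2
  have := (convex_segment (u s) (u s + h s)).norm_image_sub_le_of_norm_hasFDerivWithin_le'
    (f := f) (f' := f') (φ := f' (u s)) (C := c) (fun z _ => (hf z).hasFDerivWithinAt) hseg
    (left_mem_segment ℝ _ _) (right_mem_segment ℝ _ _)
  rw [add_sub_cancel_left] at this
  refine this.trans ?_
  gcongr
  exact h.norm_coe_le_norm s

/-- The derivative is a fixed continuous linear map composed with superposition by the derivative of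
f, so the order of smoothness rises by induction, with the target space varying. -/
theorem contDiff_superposition (f : C(E, F)) (hf : ContDiff ℝ ∞ f) :
    ContDiff ℝ ∞ (fun u : C(K, E) => f.comp u) := by
  rw [contDiff_infty]
  intro n
  induction n generalizing F with
  | zero => exact contDiff_zero.2 (ContinuousMap.continuous_postcomp f)
  | succ n ih =>
    rw [show ((n + 1 : ℕ) : WithTop ℕ∞) = (n : WithTop ℕ∞) + 1 from by push_cast; rfl,
      contDiff_succ_iff_hasFDerivAt]
    have hf' : ContDiff ℝ ∞ (fderiv ℝ f) := hf.fderiv_right (m := ∞) (by simp)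
    refine ⟨fun u => pointwiseApply K E F
      ((⟨fderiv ℝ f, hf'.continuous⟩ : C(E, E →L[ℝ] F)).comp u), ?_, fun u => ?_⟩
    · exact (pointwiseApply K E F).contDiff.comp (ih ⟨fderiv ℝ f, hf'.continuous⟩ hf')
    · exact hasFDerivAt_superposition f ⟨fderiv ℝ f, hf'.continuous⟩
        (fun x => (hf.differentiable_top x).hasFDerivAt) u

end Superposition

section Flow

open scoped unitInterval

variable {E : Type} [NormedAddCommGroup E]

/-- The extension of a curve on `[0, 1]` to the real line by constants. -/
noncomputable def extendCurve (u : C(I, E)) : ℝ → E := Set.IccExtend zero_le_one u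

theorem continuous_extendCurve (u : C(I, E)) : Continuous (extendCurve u) :=
  u.continuous.Icc_extend'

theorem extendCurve_coe (u : C(I, E)) (t : I) : extendCurve u t = u t :=
  Set.IccExtend_val _ _ _

theorem norm_extendCurve_le (u : C(I, E)) (s : ℝ) : ‖extendCurve u s‖ ≤ ‖u‖ :=
  u.norm_coe_le_norm _

variable [NormedSpace ℝ E] [CompleteSpace E]

/-- The primitive `t ↦ ∫₀ᵗ u` of a curve on `[0, 1]`. -/
noncomputable def primitive (E : Type) [NormedAddCommGroup E] [NormedSpace ℝ E] [CompleteSpace E] :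
    C(I, E) →L[ℝ] C(I, E) :=
  LinearMap.mkContinuous
    { toFun := fun u => ⟨fun t => ∫ s in (0 : ℝ)..t, extendCurve u s,
        (intervalIntegral.continuous_primitive
          (fun _ _ => (continuous_extendCurve u).intervalIntegrable _ _) 0).comp
            continuous_subtype_val⟩
      map_add' := fun u v => by
        ext t
        exact intervalIntegral.integral_add ((continuous_extendCurve u).intervalIntegrable _ _)
          ((continuous_extendCurve v).intervalIntegrable _ _)
      map_smul' := fun c u => by
        ext t
        exact intervalIntegral.integral_smul c _ } 1 (fun u => by
    rw [one_mul, ContinuousMap.norm_le _ (norm_nonneg _)]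
    intro t
    have := intervalIntegral.norm_integral_le_of_norm_le_const (a := 0) (b := (t : ℝ))
      (f := extendCurve u) (C := ‖u‖) (fun s _ => norm_extendCurve_le u s)
    refine this.trans ?_
    rw [sub_zero, abs_of_nonneg t.2.1]
    exact mul_le_of_le_one_right (norm_nonneg _) t.2.2)

theorem primitive_apply (u : C(I, E)) (t : I) :
    primitive E u t = ∫ s in (0 : ℝ)..t, extendCurve u s := rfl

theorem norm_primitive_le (u : C(I, E)) : ‖primitive E u‖ ≤ ‖u‖ := by
  simpa using (primitive E).le_of_opNorm_le (LinearMap.mkContinuous_norm_le _ zero_le_one _) u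

theorem hasDerivWithinAt_of_eq_const_add_primitive {u v : C(I, E)} {x : E}
    (h : u = ContinuousMap.const I x + primitive E v) {t : ℝ} (ht : t ∈ Set.Icc (0 : ℝ) 1) :
    HasDerivWithinAt (extendCurve u) (extendCurve v t) (Set.Icc 0 1) t := by
  have h1 : HasDerivAt (fun t => x + ∫ s in (0 : ℝ)..t, extendCurve v s) (extendCurve v t) t :=
    ((continuous_extendCurve v).integral_hasStrictDerivAt 0 t).hasDerivAt.const_add x
  refine h1.hasDerivWithinAt.congr_of_mem (fun s hs => ?_) ht
  exact (extendCurve_coe u ⟨s, hs⟩).trans (congrArg (fun w : C(I, E) => w ⟨s, hs⟩) h)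

/-- Constant curves. -/
noncomputable def constCurve (E : Type) [NormedAddCommGroup E] [NormedSpace ℝ E] :
    E →L[ℝ] C(I, E) :=
  LinearMap.mkContinuous
    { toFun := fun x => ContinuousMap.const I x
      map_add' := fun _ _ => rfl
      map_smul' := fun _ _ => rfl } 1 (fun x => by
    rw [one_mul]
    exact (ContinuousMap.norm_le _ (norm_nonneg x)).2 fun _ => le_rfl)

/-- The time-`t` maps, `0 ≤ t ≤ 1`, of a smooth vector field `X` with Lipschitz constant at most
`1 / 2`, as one smooth map into the space of curves. -/
theorem exists_smooth_flow (X : C(E, E)) (hX : ContDiff ℝ ∞ X) (hL : LipschitzWith 2⁻¹ X) :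
    ∃ Φ : E → C(I, E), ContDiff ℝ ∞ Φ ∧
      (∀ x, Φ x = ContinuousMap.const I x + primitive E (X.comp (Φ x))) ∧
      (∀ u x, u = ContinuousMap.const I x + primitive E (X.comp u) → u = Φ x) ∧
      ∀ x y, ‖Φ x - Φ y‖ ≤ 2 * ‖x - y‖ := by
  set N : C(I, E) → C(I, E) := fun u => primitive E (X.comp u) with hN
  have hNs : ContDiff ℝ ∞ N := (primitive E).contDiff.comp (contDiff_superposition X hX)
  have hNl : LipschitzWith 2⁻¹ N := by
    refine LipschitzWith.of_dist_le_mul fun u v => ?_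
    rw [dist_eq_norm, dist_eq_norm, hN]
    beta_reduce
    rw [← map_sub]
    refine (norm_primitive_le _).trans ?_
    rw [ContinuousMap.norm_le _ (by positivity)]
    intro s
    have h1 := hL.dist_le_mul (u s) (v s)
    rw [dist_eq_norm, dist_eq_norm] at h1
    refine h1.trans ?_
    gcongr
    exact (u - v).norm_coe_le_norm s
  -- The integral equation with initial point x reads Ψ u = const x. As N is a contraction, Ψ is a
  -- homeomorphism, and the flow is Ψ⁻¹ applied to constant curves; its smoothness in x comes from
  -- the smoothness of Ψ⁻¹.
  set Ψ : C(I, E) → C(I, E) := fun u => u - N u with hΨ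
  have hΨs : ContDiff ℝ ∞ Ψ := contDiff_id.sub hNs
  have happ : ApproximatesLinearOn Ψ
      ((ContinuousLinearEquiv.refl ℝ C(I, E) : C(I, E) ≃L[ℝ] C(I, E)) :
        C(I, E) →L[ℝ] C(I, E)) Set.univ 2⁻¹ := by
    intro u _ v _
    have h1 := hNl.dist_le_mul v u
    rw [dist_eq_norm, dist_eq_norm, norm_sub_rev v u] at h1
    have h2 : Ψ u - Ψ v - (u - v) = N v - N u := by
      show u - N u - (v - N v) - (u - v) = _
      abel
    show ‖Ψ u - Ψ v - (u - v)‖ ≤ _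
    rw [h2]
    exact h1
  have hc : Subsingleton C(I, E) ∨ (2⁻¹ : NNReal) <
      ‖((ContinuousLinearEquiv.refl ℝ C(I, E)).symm : C(I, E) →L[ℝ] C(I, E))‖₊⁻¹ := by
    rcases subsingleton_or_nontrivial C(I, E) with h | h
    · exact Or.inl h
    · right
      have : ‖((ContinuousLinearEquiv.refl ℝ C(I, E)).symm : C(I, E) →L[ℝ] C(I, E))‖₊ = 1 :=
        NNReal.eq ContinuousLinearMap.norm_id
      rw [this, inv_one]
      exact inv_lt_one_of_one_lt₀ (by norm_num)
  set e := happ.toHomeomorph Ψ hc with he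
  have hecoe : ∀ u, e u = u - N u := fun u => rfl
  -- The derivative is the identity minus an operator of norm at most 1/2, invertible by the Neumann
  -- series.
  have hderiv : ∀ u, ∃ A : C(I, E) ≃L[ℝ] C(I, E), HasFDerivAt e (A : C(I, E) →L[ℝ] C(I, E)) u := by
    intro u
    have h1 : HasFDerivAt N (fderiv ℝ N u) u := (hNs.differentiable_top u).hasFDerivAt
    have h2 : ‖fderiv ℝ N u‖ < 1 :=
      (norm_fderiv_le_of_lipschitz ℝ hNl).trans_lt (by norm_num)
    refine ⟨ContinuousLinearEquiv.unitsEquiv ℝ _ (Units.oneSub (fderiv ℝ N u) h2), ?_⟩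
    exact (hasFDerivAt_id u).sub h1
  choose A hA using hderiv
  have hes : ContDiff ℝ ∞ e.symm := e.contDiff_symm hA hΨs
  have hconst : ContDiff ℝ ∞ (fun x : E => ContinuousMap.const I x) :=
    (constCurve E).contDiff
  have hsol : ∀ x, e.symm (ContinuousMap.const I x) =
      ContinuousMap.const I x + N (e.symm (ContinuousMap.const I x)) := by
    intro x
    have := e.apply_symm_apply (ContinuousMap.const I x)
    rw [hecoe] at this
    exact sub_eq_iff_eq_add.1 this
  refine ⟨fun x => e.symm (ContinuousMap.const I x), hes.comp hconst, hsol, ?_, ?_⟩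
  · intro u x hu
    rw [← e.symm_apply_apply u, hecoe]
    congr 1
    exact sub_eq_iff_eq_add.2 hu
  · intro x y
    set u := e.symm (ContinuousMap.const I x)
    set v := e.symm (ContinuousMap.const I y)
    have h1 : u - v = ContinuousMap.const I (x - y) + (N u - N v) := by
      have h0 : u - v = (ContinuousMap.const I x + N u) - (ContinuousMap.const I y + N v) :=
        congrArg₂ (· - ·) (hsol x) (hsol y)
      rw [h0]
      ext t
      simp only [ContinuousMap.sub_apply, ContinuousMap.add_apply, ContinuousMap.const_apply]
      abel
    have h2 := hNl.dist_le_mul u v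
    rw [dist_eq_norm, dist_eq_norm] at h2
    -- Absorbing the last term gives the Lipschitz constant 2.
    have h3 : ‖u - v‖ ≤ ‖x - y‖ + 2⁻¹ * ‖u - v‖ := by
      conv_lhs => rw [h1]
      refine (norm_add_le _ _).trans (add_le_add ?_ (by simpa using h2))
      rw [ContinuousMap.norm_le _ (norm_nonneg _)]
      exact fun _ => le_rfl
    linarith

end Flow

section ReverseFlow

open scoped unitInterval

variable {E : Type} [NormedAddCommGroup E] [NormedSpace ℝ E] [CompleteSpace E]

/-- A solution curve run backwards solves the reversed equation. -/
theorem reverse_eq_const_add_primitive {u v : C(I, E)} {x : E}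
    (h : u = ContinuousMap.const I x + primitive E v) :
    u.comp ⟨unitInterval.symm, unitInterval.continuous_symm⟩ =
      ContinuousMap.const I (u 1) +
        primitive E (-(v.comp ⟨unitInterval.symm, unitInterval.continuous_symm⟩)) := by
  ext t
  have hcont := continuous_extendCurve v
  have hint : ∀ a b, IntervalIntegrable (extendCurve v) volume a b :=
    fun a b => hcont.intervalIntegrable a b
  have h1 : ∀ t : I, u t = x + ∫ s in (0 : ℝ)..t, extendCurve v s := fun t =>
    congrArg (fun w : C(I, E) => w t) h
  have h2 : ∀ s, extendCurve (-(v.comp ⟨unitInterval.symm, unitInterval.continuous_symm⟩)) s =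
      -extendCurve v (1 - s) := by
    intro s
    simp only [extendCurve, Set.IccExtend, Function.comp_apply, ContinuousMap.neg_apply,
      ContinuousMap.comp_apply, ContinuousMap.coe_mk]
    congr 2
    apply Subtype.ext
    simp only [unitInterval.coe_symm_eq, Set.coe_projIcc]
    rcases le_total s 0 with hs | hs
    · rw [min_eq_right (hs.trans zero_le_one), max_eq_left hs, min_eq_left (by linarith),
        max_eq_right zero_le_one, sub_zero]
    · rcases le_total s 1 with hs' | hs'
      · rw [min_eq_right hs', max_eq_right hs, min_eq_right (by linarith),
          max_eq_right (by linarith)]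
      · rw [min_eq_left hs', max_eq_right zero_le_one, min_eq_right (by linarith),
          max_eq_left (by linarith), sub_self]
  have h3 : u (unitInterval.symm t) = u 1 - ∫ s in (0 : ℝ)..t, extendCurve v (1 - s) := by
    rw [h1 1, h1, intervalIntegral.integral_comp_sub_left (fun s => extendCurve v s) 1,
      unitInterval.coe_symm_eq, sub_zero, Set.Icc.coe_one,
      ← intervalIntegral.integral_add_adjacent_intervals (hint 0 (1 - t)) (hint (1 - t) 1)]
    abel
  simp only [ContinuousMap.comp_apply, ContinuousMap.coe_mk, ContinuousMap.add_apply,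
    ContinuousMap.const_apply, primitive_apply, h2, intervalIntegral.integral_neg]
  rw [h3, sub_eq_add_neg]

end ReverseFlow

/-! ### Hamiltonian flows and the symplectic form. -/

section Hamiltonian

open scoped unitInterval

variable {d : ℕ}

theorem contDiff_hamField {G : Phase d → ℝ} (hG : ContDiff ℝ ∞ G) :
    ContDiff ℝ ∞ (hamField G) := by
  have h1 : ∀ i, ContDiff ℝ ∞ (dQ i G) := fun i => hG.dirDeriv _
  have h2 : ∀ i, ContDiff ℝ ∞ (dP i G) := fun i => hG.dirDeriv _
  refine ContDiff.prodMk ?_ ?_ <;>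
  · rw [contDiff_euclidean]
    intro i
    first | exact (h1 i).neg | exact h2 i

theorem sympForm_swap (u v : Phase d) : sympForm u v = -sympForm v u := by
  simp only [sympForm, ← Finset.sum_neg_distrib]
  exact Finset.sum_congr rfl fun i _ => by ring

theorem fderiv_apply_eq_neg_sympForm (G : Phase d → ℝ) (x v : Phase d) :
    fderiv ℝ G x v = -sympForm (hamField G x) v := by
  have := dirDeriv_eq_sum v G x
  rw [dirDeriv] at this
  rw [this, sympForm, ← Finset.sum_add_distrib, ← Finset.sum_neg_distrib]
  refine Finset.sum_congr rfl fun i _ => ?_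
  simp only [hamField]
  ring

theorem hasDerivWithinAt_sympForm {u v : ℝ → Phase d} {u' v' : Phase d} {s : Set ℝ} {t : ℝ}
    (hu : HasDerivWithinAt u u' s t) (hv : HasDerivWithinAt v v' s t) :
    HasDerivWithinAt (fun t => sympForm (u t) (v t))
      (sympForm u' (v t) + sympForm (u t) v') s t := by
  have h1 : ∀ {w : ℝ → Phase d} {w' : Phase d}, HasDerivWithinAt w w' s t → ∀ i,
      HasDerivWithinAt (fun t => (w t).1 i) (w'.1 i) s t := fun hw i =>
    ((EuclideanSpace.proj i).comp (ContinuousLinearMap.fst ℝ (ActionSpace d)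
      (ActionSpace d))).hasFDerivAt.comp_hasDerivWithinAt t hw
  have h2 : ∀ {w : ℝ → Phase d} {w' : Phase d}, HasDerivWithinAt w w' s t → ∀ i,
      HasDerivWithinAt (fun t => (w t).2 i) (w'.2 i) s t := fun hw i =>
    ((EuclideanSpace.proj i).comp (ContinuousLinearMap.snd ℝ (ActionSpace d)
      (ActionSpace d))).hasFDerivAt.comp_hasDerivWithinAt t hw
  have h3 : HasDerivWithinAt (fun t => ∑ i, ((u t).1 i * (v t).2 i - (u t).2 i * (v t).1 i))
      (∑ i, ((u'.1 i * (v t).2 i + (u t).1 i * v'.2 i) -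
        (u'.2 i * (v t).1 i + (u t).2 i * v'.1 i))) s t :=
    HasDerivWithinAt.fun_sum fun i _ =>
      ((h1 hu i).mul (h2 hv i)).sub ((h2 hu i).mul (h1 hv i))
  refine HasDerivWithinAt.congr_deriv (f := fun t => sympForm (u t) (v t)) h3 (Eq.symm ?_)
  show (∑ i, (u'.1 i * (v t).2 i - u'.2 i * (v t).1 i)) +
    (∑ i, ((u t).1 i * v'.2 i - (u t).2 i * v'.1 i)) = _
  rw [← Finset.sum_add_distrib]
  exact Finset.sum_congr rfl fun i _ => by ring

/-- Differentiate the identity dG(v) = -ω(X_G, v) along the line x + tu. -/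
theorem sympForm_fderiv_hamField {G : Phase d → ℝ} (hG : ContDiff ℝ ∞ G) (x u v : Phase d) :
    sympForm (fderiv ℝ (hamField G) x u) v = -fderiv ℝ (fderiv ℝ G) x u v := by
  have hX := ((contDiff_hamField hG).differentiable_top x).hasFDerivAt
  have hline : HasDerivAt (fun t : ℝ => x + t • u) u 0 := by
    simpa using ((hasDerivAt_id (0 : ℝ)).smul_const u).const_add x
  have h1 : HasDerivWithinAt (fun t : ℝ => hamField G (x + t • u)) (fderiv ℝ (hamField G) x u)
      Set.univ 0 := by
    have hX' : HasFDerivAt (hamField G) (fderiv ℝ (hamField G) x) (x + (0 : ℝ) • u) := by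
      simpa using hX
    exact (hX'.comp_hasDerivAt (0 : ℝ) hline).hasDerivWithinAt
  have h2 := hasDerivWithinAt_sympForm h1 (hasDerivWithinAt_const (0 : ℝ) Set.univ v)
  have hG' : ContDiff ℝ ∞ (fderiv ℝ G) := hG.fderiv_right (m := ∞) (by simp)
  have h3 : HasDerivAt (fun t : ℝ => -fderiv ℝ G (x + t • u) v)
      (-fderiv ℝ (fderiv ℝ G) x u v) 0 := by
    have h4 : HasDerivAt (fun t : ℝ => fderiv ℝ G (x + t • u)) (fderiv ℝ (fderiv ℝ G) x u) 0 := by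
      have hG'' : HasFDerivAt (fderiv ℝ G) (fderiv ℝ (fderiv ℝ G) x) (x + (0 : ℝ) • u) := by
        simpa using (hG'.differentiable_top x).hasFDerivAt
      exact hG''.comp_hasDerivAt (0 : ℝ) hline
    simpa using (h4.clm_apply (hasDerivAt_const (0 : ℝ) v)).fun_neg
  have h5 : (fun t : ℝ => -fderiv ℝ G (x + t • u) v) =
      fun t => sympForm (hamField G (x + t • u)) v := by
    funext t
    rw [fderiv_apply_eq_neg_sympForm, neg_neg]
  rw [h5] at h3
  rw [hasDerivWithinAt_univ] at h2
  have h6 := h2.unique h3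
  simpa [sympForm] using h6

/-- Symmetry of the Hessian of G. This is the infinitesimal form of the invariance of the symplectic
form under the flow. -/
theorem sympForm_fderiv_hamField_add {G : Phase d → ℝ} (hG : ContDiff ℝ ∞ G) (x u v : Phase d) :
    sympForm (fderiv ℝ (hamField G) x u) v + sympForm u (fderiv ℝ (hamField G) x v) = 0 := by
  have h := hG.contDiffAt.isSymmSndFDerivAt (x := x) (by
    rw [minSmoothness_of_isRCLikeNormedField]; exact WithTop.coe_le_coe.2 le_top) u v
  rw [sympForm_swap u, sympForm_fderiv_hamField hG, sympForm_fderiv_hamField hG, h]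
  ring

theorem hamField_neg (G : Phase d → ℝ) : hamField (fun x => -G x) = fun x => -hamField G x := by
  funext x
  have : fderiv ℝ (fun x => -G x) x = -fderiv ℝ G x := fderiv_fun_neg
  refine Prod.ext ?_ ?_ <;>
  · ext i
    simp [hamField, dQ, dP, this]

theorem hamField_periodic {G : Phase d → ℝ} (hG : IsSmoothOnPhase G) {x y : Phase d}
    (h : SamePoint x y) : hamField G x = hamField G y := by
  simp only [hamField, dP_eq_dirDeriv, dQ_eq_dirDeriv, dirDeriv_periodic hG.2 _ h]

/-- The flow, for times in `[0, 1]`, of a Hamiltonian vector field with Lipschitz constant at most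
`1 / 2`: its time-one map is a canonical transformation. -/
theorem exists_hamiltonian_flow {G : Phase d → ℝ} (hG : IsSmoothOnPhase G)
    (hL : LipschitzWith 2⁻¹ (hamField G)) : ∃ Φ : ℝ → Phase d → Phase d,
      (∀ x, Φ 0 x = x) ∧
      (∀ x, ∀ t ∈ Set.Icc (0 : ℝ) 1,
        HasDerivWithinAt (fun s => Φ s x) (hamField G (Φ t x)) (Set.Icc 0 1) t) ∧
      (∀ t x y, ‖Φ t x - Φ t y‖ ≤ 2 * ‖x - y‖) ∧ IsCanonical (Φ 1) := by
  -- Needed for both G and -G: the time-one map of -G is the inverse.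
  have main : ∀ {G : Phase d → ℝ} (hG : IsSmoothOnPhase G) (hL : LipschitzWith 2⁻¹ (hamField G)),
      ∃ Φ : Phase d → C(I, Phase d), ContDiff ℝ ∞ Φ ∧
        (∀ x, Φ x = ContinuousMap.const I x + primitive (Phase d)
          ((⟨hamField G, hL.continuous⟩ : C(Phase d, Phase d)).comp (Φ x))) ∧
        (∀ u x, u = ContinuousMap.const I x + primitive (Phase d)
          ((⟨hamField G, hL.continuous⟩ : C(Phase d, Phase d)).comp u) → u = Φ x) ∧
        (∀ x y, ‖Φ x - Φ y‖ ≤ 2 * ‖x - y‖) ∧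
        (∀ x y, SamePoint x y → SamePoint (Φ x 1) (Φ y 1)) := by
    intro G hG hL
    obtain ⟨Φ, h1, h2, h3, h4⟩ := exists_smooth_flow ⟨hamField G, hL.continuous⟩
      (contDiff_hamField hG.1) hL
    refine ⟨Φ, h1, h2, h3, h4, fun x y hxy => ?_⟩
    obtain ⟨hp, n, hn⟩ := hxy
    -- The vector field is periodic, so a solution shifted by a lattice vector is again a solution;
    -- uniqueness identifies it.
    have h5 : Φ x + ContinuousMap.const I (y - x) = Φ y := by
      refine h3 _ _ ?_
      have h6 : (⟨hamField G, hL.continuous⟩ : C(Phase d, Phase d)).comp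
          (Φ x + ContinuousMap.const I (y - x)) =
          (⟨hamField G, hL.continuous⟩ : C(Phase d, Phase d)).comp (Φ x) := by
        ext1 s
        refine (hamField_periodic hG ⟨?_, n, fun i => ?_⟩).symm
        · simp [hp]
        · simp [hn i]
      rw [h6]
      conv_lhs => rw [h2 x]
      ext1 s
      simp only [ContinuousMap.add_apply, ContinuousMap.const_apply]
      abel
    rw [← h5]
    exact ⟨by simp [hp], n, fun i => by simp [hn i]⟩
  obtain ⟨Φ, hs, hsol, huniq, hlip, hper⟩ := main hG hL
  have hG' : IsSmoothOnPhase fun x => -G x := by simpa using hG.const_mul (-1)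
  have hL' : LipschitzWith 2⁻¹ (hamField fun x => -G x) := by
    rw [hamField_neg]; exact hL.neg
  obtain ⟨Φ', hs', hsol', huniq', -, hper'⟩ := main hG' hL'
  -- The orbit of x run backwards solves the equation of -G started at its endpoint.
  have hinv : ∀ x, Φ' (Φ x 1) 1 = x := by
    intro x
    have h1 := reverse_eq_const_add_primitive (hsol x)
    have h2 := huniq' ((Φ x).comp ⟨unitInterval.symm, unitInterval.continuous_symm⟩)
      (Φ x 1) (h1.trans (by
        congr 2
        ext1 s
        simp [hamField_neg]))
    have h3 : (Φ x) 0 = x := by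
      rw [hsol x]
      simp [primitive_apply]
    rw [← h2]
    simpa using h3
  have hinv' : ∀ x, Φ (Φ' x 1) 1 = x := by
    intro x
    have h1 := reverse_eq_const_add_primitive (hsol' x)
    have h2 := huniq ((Φ' x).comp ⟨unitInterval.symm, unitInterval.continuous_symm⟩)
      (Φ' x 1) (h1.trans (by
        congr 2
        ext1 s
        simp [hamField_neg]))
    have h3 : (Φ' x) 0 = x := by
      rw [hsol' x]
      simp [primitive_apply]
    rw [← h2]
    simpa using h3
  have hev : ∀ {Φ : Phase d → C(I, Phase d)}, ContDiff ℝ ∞ Φ → ContDiff ℝ ∞ fun x => Φ x 1 :=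
    fun h => (ContinuousMap.evalCLM ℝ (1 : I) : C(I, Phase d) →L[ℝ] Phase d).contDiff.comp h
  refine ⟨fun t x => extendCurve (Φ x) t, fun x => ?_, fun x t ht => ?_, fun t x y => ?_, ?_⟩
  · have := extendCurve_coe (Φ x) 0
    rw [Set.Icc.coe_zero] at this
    beta_reduce
    rw [this, hsol x]
    simp [primitive_apply]
  · exact hasDerivWithinAt_of_eq_const_add_primitive (hsol x) ht
  · exact ((Φ x - Φ y).norm_coe_le_norm _).trans (hlip x y)
  · have hone : ∀ x, extendCurve (Φ x) 1 = Φ x 1 := fun x => extendCurve_coe (Φ x) 1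
    simp only [hone]
    refine ⟨hev hs, hper, ⟨fun x => Φ' x 1, hev hs', hper', hinv, hinv'⟩, fun x u v => ?_⟩
    have hX := contDiff_hamField hG.1
    set X : C(Phase d, Phase d) := ⟨hamField G, hL.continuous⟩ with hXdef
    set X' : C(Phase d, Phase d →L[ℝ] Phase d) :=
      ⟨fderiv ℝ (hamField G), (hX.fderiv_right (m := ∞) (by simp)).continuous⟩ with hX'def
    have hΦ : HasFDerivAt Φ (fderiv ℝ Φ x) x := (hs.differentiable_top x).hasFDerivAt
    -- The variational equation in integral form, obtained by differentiating the integral equation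
    -- of the flow in x.
    have hvar : ∀ w, fderiv ℝ Φ x w = ContinuousMap.const I w +
        primitive (Phase d) (pointwiseApply I _ _ (X'.comp (Φ x)) (fderiv ℝ Φ x w)) := by
      intro w
      have h1 : HasFDerivAt (fun y => constCurve (Phase d) y + primitive (Phase d) (X.comp (Φ y)))
          (constCurve (Phase d) + (primitive (Phase d)).comp
            ((pointwiseApply I _ _ (X'.comp (Φ x))).comp (fderiv ℝ Φ x))) x :=
        (constCurve (Phase d)).hasFDerivAt.add ((primitive (Phase d)).hasFDerivAt.comp x
          ((hasFDerivAt_superposition X X'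
            (fun z => (hX.differentiable_top z).hasFDerivAt) (Φ x)).comp x hΦ))
      have h2 : (fun y => constCurve (Phase d) y + primitive (Phase d) (X.comp (Φ y))) = Φ :=
        funext fun y => (hsol y).symm
      rw [h2] at h1
      exact congrArg (fun A => A w) (hΦ.unique h1)
    have hT : ∀ w, fderiv ℝ (fun x => Φ x 1) x w = extendCurve (fderiv ℝ Φ x w) 1 := by
      intro w
      have h1 : HasFDerivAt (fun x => Φ x 1)
          ((ContinuousMap.evalCLM ℝ (1 : I)).comp (fderiv ℝ Φ x)) x :=
        (ContinuousMap.evalCLM ℝ (1 : I) : C(I, Phase d) →L[ℝ] Phase d).hasFDerivAt.comp x hΦ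
      rw [h1.fderiv]
      exact (extendCurve_coe (fderiv ℝ Φ x w) 1).symm
    have h0 : ∀ w, extendCurve (fderiv ℝ Φ x w) 0 = w := by
      intro w
      have h1 := extendCurve_coe (fderiv ℝ Φ x w) 0
      rw [Set.Icc.coe_zero] at h1
      rw [h1, hvar w]
      simp [primitive_apply]
    -- The symplectic product of two solutions of the variational equation is constant in time.
    have hder : ∀ t ∈ Set.Icc (0 : ℝ) 1, HasDerivWithinAt (fun t => sympForm
        (extendCurve (fderiv ℝ Φ x u) t) (extendCurve (fderiv ℝ Φ x v) t)) 0 (Set.Icc 0 1) t := by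
      intro t ht
      have h1 := hasDerivWithinAt_sympForm
        (hasDerivWithinAt_of_eq_const_add_primitive (hvar u) ht)
        (hasDerivWithinAt_of_eq_const_add_primitive (hvar v) ht)
      convert h1 using 1
      exact (sympForm_fderiv_hamField_add hG.1 _ _ _).symm
    have := (convex_Icc (0 : ℝ) 1).norm_image_sub_le_of_norm_hasDerivWithin_le (C := 0) hder
      (by simp) (Set.left_mem_Icc.2 zero_le_one) (Set.right_mem_Icc.2 zero_le_one)
    rw [zero_mul, h0, h0] at this
    rw [hT, hT]
    exact sub_eq_zero.1 (norm_le_zero_iff.1 this)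

end Hamiltonian

/-! ### Means over the torus -/

section TorusMean

open scoped Pointwise

variable {d : ℕ}

/-- The fundamental box `[0, 2π]^d`. -/
def torusBox (d : ℕ) : Set (ActionSpace d) := {q | ∀ i, q i ∈ Set.Icc 0 (2 * Real.pi)}

/-- The mean of a function over the fundamental box. -/
noncomputable def torusMean {F : Type*} [NormedAddCommGroup F] [NormedSpace ℝ F]
    (g : ActionSpace d → F) : F := ((2 * Real.pi) ^ d)⁻¹ • ∫ q in torusBox d, g q

/-- The lattice vector `2πn`. -/
noncomputable def latticeVec (n : Fin d → ℤ) : ActionSpace d :=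
  WithLp.toLp 2 fun i => 2 * Real.pi * n i

theorem torusBox_eq_image :
    torusBox d = WithLp.toLp 2 '' Set.pi Set.univ fun _ => Set.Icc 0 (2 * Real.pi) := by
  ext q
  constructor
  · intro h
    exact ⟨q.ofLp, fun i _ => h i, rfl⟩
  · rintro ⟨x, hx, rfl⟩ i
    exact hx i trivial

theorem torusBox_preimage :
    WithLp.toLp 2 ⁻¹' torusBox d = Set.pi Set.univ fun _ => Set.Icc 0 (2 * Real.pi) := by
  ext x
  exact ⟨fun h i _ => h i, fun h i => h i trivial⟩

theorem isCompact_torusBox : IsCompact (torusBox d) := by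
  rw [torusBox_eq_image]
  exact (isCompact_univ_pi fun _ => isCompact_Icc).image (PiLp.continuous_toLp 2 _)

theorem setIntegral_torusBox {F : Type*} [NormedAddCommGroup F] [NormedSpace ℝ F]
    (g : ActionSpace d → F) : ∫ q in torusBox d, g q =
      ∫ x in Set.pi Set.univ fun _ : Fin d => Set.Icc 0 (2 * Real.pi), g (WithLp.toLp 2 x) := by
  rw [← torusBox_preimage]
  exact ((PiLp.volume_preserving_toLp (Fin d)).setIntegral_preimage_emb
    (MeasurableEquiv.toLp 2 (Fin d → ℝ)).measurableEmbedding g _).symm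

theorem measureReal_torusBox : volume.real (torusBox d) = (2 * Real.pi) ^ d := by
  have h := setIntegral_torusBox (d := d) (fun _ => (1 : ℝ))
  rw [setIntegral_const, setIntegral_const, smul_eq_mul, smul_eq_mul, mul_one, mul_one] at h
  rw [h, measureReal_def, Set.pi_univ_Icc, Real.volume_Icc_pi_toReal (fun _ => by positivity)]
  simp

theorem norm_torusMean_le {F : Type*} [NormedAddCommGroup F] [NormedSpace ℝ F]
    {g : ActionSpace d → F} {C : ℝ} (h : ∀ q, ‖g q‖ ≤ C) : ‖torusMean g‖ ≤ C := by
  have hpos : (0 : ℝ) < (2 * Real.pi) ^ d := by positivity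
  have h1 := norm_setIntegral_le_of_norm_le_const (μ := volume) (f := g) (s := torusBox d)
    isCompact_torusBox.measure_lt_top (fun q _ => h q)
  rw [measureReal_torusBox] at h1
  rw [torusMean, norm_smul, norm_inv, Real.norm_of_nonneg hpos.le]
  rw [inv_mul_le_iff₀ hpos]
  linarith

/-- Passing to `UnitAddTorus` (period 1 in place of 2π) gives access to multidimensional Fourier
series there. -/
theorem exists_lift_torus {g : ActionSpace d → ℂ} (hg : Continuous g)
    (hper : ∀ q n, g (q + latticeVec n) = g q) :
    ∃ G : C(UnitAddTorus (Fin d), ℂ), ∀ x : Fin d → ℝ,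
      G (fun i => (x i : UnitAddCircle)) = g (WithLp.toLp 2 fun i => 2 * Real.pi * x i) := by
  let G₀ : UnitAddTorus (Fin d) → ℂ := fun y =>
    g (WithLp.toLp 2 fun i => 2 * Real.pi * (AddCircle.equivIco 1 0 (y i)).1)
  have h1 : ∀ x : Fin d → ℝ,
      G₀ (fun i => (x i : UnitAddCircle)) = g (WithLp.toLp 2 fun i => 2 * Real.pi * x i) := by
    intro x
    rw [← hper _ fun i => -⌊x i⌋]
    show g _ = g _
    congr 1
    ext i
    simp only [AddCircle.coe_equivIco_mk_apply, latticeVec, PiLp.add_apply, div_one, mul_one,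
      Int.fract]
    push_cast
    ring
  have hq : IsOpenQuotientMap (Pi.map fun (_ : Fin d) (t : ℝ) => (t : UnitAddCircle)) :=
    IsOpenQuotientMap.piMap fun _ => QuotientAddGroup.isOpenQuotientMap_mk
  refine ⟨⟨G₀, ?_⟩, h1⟩
  rw [← hq.continuous_comp_iff]
  have h2 : G₀ ∘ (Pi.map fun (_ : Fin d) (t : ℝ) => (t : UnitAddCircle)) =
      fun x => g (WithLp.toLp 2 fun i => 2 * Real.pi * x i) := funext h1
  rw [h2]
  exact hg.comp ((PiLp.continuous_toLp 2 _).comp (by fun_prop))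

theorem torusMean_eq_setIntegral_unit {F : Type*} [NormedAddCommGroup F] [NormedSpace ℝ F]
    (g : ActionSpace d → F) :
    torusMean g = ∫ x in {x : Fin d → ℝ | ∀ i, x i ∈ Set.Ioc ((0 : Fin d → ℝ) i) ((0 : Fin d → ℝ) i + 1)},
      g (WithLp.toLp 2 fun i => 2 * Real.pi * x i) := by
  have hpi : (0 : ℝ) < 2 * Real.pi := by positivity
  have h1 := Measure.setIntegral_comp_smul_of_pos (volume : Measure (Fin d → ℝ))
    (fun x => g (WithLp.toLp 2 x))
    {x : Fin d → ℝ | ∀ i, x i ∈ Set.Ioc ((0 : Fin d → ℝ) i) ((0 : Fin d → ℝ) i + 1)} hpi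
  have h2 : (fun x : Fin d → ℝ => g (WithLp.toLp 2 fun i => 2 * Real.pi * x i)) =
    fun x => g (WithLp.toLp 2 ((2 * Real.pi) • x)) := rfl
  rw [h2, h1, torusMean, setIntegral_torusBox, Module.finrank_fin_fun]
  congr 1
  refine setIntegral_congr_set ?_
  have h3 : (2 * Real.pi) • {x : Fin d → ℝ | ∀ i, x i ∈ Set.Ioc ((0 : Fin d → ℝ) i)
      ((0 : Fin d → ℝ) i + 1)} = Set.pi Set.univ fun _ => Set.Ioc 0 (2 * Real.pi) := by
    ext x
    rw [Set.mem_smul_set_iff_inv_smul_mem₀ hpi.ne']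
    simp only [Set.mem_ofPred_eq, Pi.smul_apply, smul_eq_mul, Pi.zero_apply, zero_add, Set.mem_Ioc,
      Set.mem_univ_pi]
    refine forall_congr' fun i => ?_
    rw [inv_mul_le_iff₀ hpi, mul_one, mul_pos_iff_of_pos_left (inv_pos.2 hpi)]
  rw [h3, Set.pi_univ_Icc]
  exact Measure.univ_pi_Ioc_ae_eq_Icc.symm

/-- The zeroth Fourier coefficient on the torus can be computed over a unit box with any corner.
Comparing the boxes at 0 and at a/(2π) gives the invariance under translation. -/
theorem torusMean_comp_add {g : ActionSpace d → ℂ} (hg : Continuous g)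
    (hper : ∀ q n, g (q + latticeVec n) = g q) (a : ActionSpace d) :
    torusMean (fun q => g (q + a)) = torusMean g := by
  obtain ⟨G, hG⟩ := exists_lift_torus hg hper
  have hpi : (0 : ℝ) < 2 * Real.pi := by positivity
  let b : Fin d → ℝ := fun i => a i / (2 * Real.pi)
  have h1 := UnitAddTorus.mFourierCoeff_eq_integral G 0 0
  have h2 := UnitAddTorus.mFourierCoeff_eq_integral G 0 b
  simp only [neg_zero, UnitAddTorus.mFourier_zero, ContinuousMap.one_apply, one_smul, hG] at h1 h2
  rw [torusMean_eq_setIntegral_unit, torusMean_eq_setIntegral_unit, ← h1, h2]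
  have h3 := (measurePreserving_add_right (volume : Measure (Fin d → ℝ)) b).setIntegral_preimage_emb
    (MeasurableEquiv.addRight b).measurableEmbedding
    (fun x => g (WithLp.toLp 2 fun i => 2 * Real.pi * x i))
    {x : Fin d → ℝ | ∀ i, x i ∈ Set.Ioc (b i) (b i + 1)}
  rw [← h3]
  have h4 : (fun x : Fin d → ℝ => x + b) ⁻¹' {x : Fin d → ℝ | ∀ i, x i ∈ Set.Ioc (b i) (b i + 1)} =
      {x : Fin d → ℝ | ∀ i, x i ∈ Set.Ioc ((0 : Fin d → ℝ) i) ((0 : Fin d → ℝ) i + 1)} := by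
    ext x
    simp only [Set.mem_preimage, Set.mem_ofPred_eq, Pi.add_apply, Set.mem_Ioc, Pi.zero_apply]
    refine forall_congr' fun i => ?_
    constructor <;> rintro ⟨h, h'⟩ <;> constructor <;> linarith
  rw [h4]
  congr 1
  funext x
  congr 1
  ext i
  simp only [PiLp.add_apply, Pi.add_apply, b]
  field_simp

end TorusMean

/-! ### Characters, Fourier coefficients, and means against cosines and sines. -/

section Modes

open scoped Pointwise

variable {d : ℕ}

theorem dotZ_add (p q : ActionSpace d) (k : Fin d → ℤ) : dotZ (p + q) k = dotZ p k + dotZ q k := by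
  simp [dotZ, add_mul, Finset.sum_add_distrib]

theorem dotZ_smul (c : ℝ) (p : ActionSpace d) (k : Fin d → ℤ) : dotZ (c • p) k = c * dotZ p k := by
  simp [dotZ, Finset.mul_sum, mul_assoc]

theorem dotZ_neg_right (p : ActionSpace d) (k : Fin d → ℤ) : dotZ p (-k) = -dotZ p k := by
  simp [dotZ]

theorem dotZ_add_right (p : ActionSpace d) (k l : Fin d → ℤ) :
    dotZ p (k + l) = dotZ p k + dotZ p l := by
  simp [dotZ, mul_add, Finset.sum_add_distrib]

theorem dotZ_latticeVec (n k : Fin d → ℤ) :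
    dotZ (latticeVec n) k = (∑ i, n i * k i : ℤ) * (2 * Real.pi) := by
  simp only [dotZ, latticeVec]
  push_cast
  rw [Finset.sum_mul]
  exact Finset.sum_congr rfl fun i _ => by ring

theorem continuous_dotZ (k : Fin d → ℤ) : Continuous fun q : ActionSpace d => dotZ q k := by
  unfold dotZ
  fun_prop

theorem hasDerivAt_dotZ (q u : ActionSpace d) (k : Fin d → ℤ) (t : ℝ) :
    HasDerivAt (fun t : ℝ => dotZ (q + t • u) k) (dotZ u k) t := by
  simp only [dotZ_add, dotZ_smul]
  simpa using ((hasDerivAt_id t).mul_const (dotZ u k)).const_add (dotZ q k)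

/-- The character `q ↦ e^{i k·q}`. -/
noncomputable def torusChar (k : Fin d → ℤ) (q : ActionSpace d) : ℂ :=
  Complex.exp (Complex.I * (dotZ q k : ℂ))

theorem torusChar_eq (k : Fin d → ℤ) (q : ActionSpace d) :
    torusChar k q = Real.cos (dotZ q k) + Real.sin (dotZ q k) * Complex.I := by
  rw [torusChar, mul_comm, Complex.exp_mul_I, Complex.ofReal_cos, Complex.ofReal_sin]

theorem torusChar_neg (k : Fin d → ℤ) (q : ActionSpace d) :
    torusChar (-k) q = Real.cos (dotZ q k) - Real.sin (dotZ q k) * Complex.I := by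
  rw [torusChar_eq, dotZ_neg_right, Real.cos_neg, Real.sin_neg]
  push_cast
  ring

theorem torusChar_add_right (k : Fin d → ℤ) (p q : ActionSpace d) :
    torusChar k (p + q) = torusChar k p * torusChar k q := by
  rw [torusChar, dotZ_add, Complex.ofReal_add, mul_add, Complex.exp_add]
  rfl

theorem torusChar_add_left (k l : Fin d → ℤ) (q : ActionSpace d) :
    torusChar (k + l) q = torusChar k q * torusChar l q := by
  rw [torusChar, dotZ_add_right, Complex.ofReal_add, mul_add, Complex.exp_add]
  rfl

theorem torusChar_zero (q : ActionSpace d) : torusChar 0 q = 1 := by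
  simp [torusChar, dotZ]

theorem torusChar_latticeVec (k n : Fin d → ℤ) : torusChar k (latticeVec n) = 1 := by
  rw [torusChar_eq, dotZ_latticeVec, Real.cos_int_mul_two_pi]
  have h := Real.sin_int_mul_pi ((∑ i, n i * k i : ℤ) * 2)
  rw [show ((∑ i, n i * k i : ℤ) : ℝ) * (2 * Real.pi) =
    (((∑ i, n i * k i : ℤ) * 2 : ℤ) : ℝ) * Real.pi from by push_cast; ring, h]
  simp

theorem continuous_torusChar (k : Fin d → ℤ) : Continuous (torusChar k) := by
  have := continuous_dotZ k
  unfold torusChar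
  fun_prop

theorem torusMean_const {F : Type*} [NormedAddCommGroup F] [NormedSpace ℝ F] [CompleteSpace F]
    (c : F) : torusMean (fun _ : ActionSpace d => c) = c := by
  rw [torusMean, setIntegral_const, measureReal_torusBox, smul_smul, inv_mul_cancel₀, one_smul]
  positivity

theorem torusMean_torusChar (k : Fin d → ℤ) :
    torusMean (torusChar k) = if k = 0 then (1 : ℂ) else 0 := by
  split_ifs with h
  · subst h
    simp only [funext (torusChar_zero (d := d))]
    exact torusMean_const 1
  · obtain ⟨i, hi⟩ := Function.ne_iff.1 h
    have hi' : (k i : ℝ) ≠ 0 := by exact_mod_cast hi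
    -- Translation by this vector multiplies the character by -1, so its mean equals its own
    -- negative.
    let a : ActionSpace d := EuclideanSpace.single i (Real.pi / k i)
    have ha : torusChar k a = -1 := by
      have : dotZ a k = Real.pi := by
        simp [dotZ, a, hi']
      rw [torusChar_eq, this]
      simp
    have h1 := torusMean_comp_add (continuous_torusChar k)
      (fun q n => by rw [torusChar_add_right, torusChar_latticeVec, mul_one]) a
    simp only [torusChar_add_right, ha] at h1
    rw [show (fun q : ActionSpace d => torusChar k q * -1) = fun q => (-1 : ℝ) • torusChar k q from
      funext fun q => by simp] at h1
    rw [torusMean, integral_smul, smul_comm, ← torusMean, neg_smul, one_smul] at h1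
    exact self_eq_neg.1 h1.symm

theorem torusMean_ofReal (g : ActionSpace d → ℝ) :
    torusMean (fun q => (g q : ℂ)) = ((torusMean g : ℝ) : ℂ) := by
  rw [torusMean, torusMean,
    show ∫ q in torusBox d, (g q : ℂ) = ((∫ q in torusBox d, g q : ℝ) : ℂ) from integral_ofReal]
  simp

theorem torusMean_comp_add_real {g : ActionSpace d → ℝ} (hg : Continuous g)
    (hper : ∀ q n, g (q + latticeVec n) = g q) (a : ActionSpace d) :
    torusMean (fun q => g (q + a)) = torusMean g := by
  have := torusMean_comp_add (g := fun q => (g q : ℂ)) (Complex.continuous_ofReal.comp hg)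
    (fun q n => by rw [hper]) a
  rw [torusMean_ofReal g, torusMean_ofReal fun q => g (q + a)] at this
  exact_mod_cast this

theorem integrableOn_torusBox {F : Type*} [NormedAddCommGroup F] [NormedSpace ℝ F]
    {g : ActionSpace d → F} (hg : Continuous g) : IntegrableOn g (torusBox d) :=
  hg.continuousOn.integrableOn_compact isCompact_torusBox

theorem torusMean_add {F : Type*} [NormedAddCommGroup F] [NormedSpace ℝ F]
    {g h : ActionSpace d → F} (hg : Continuous g) (hh : Continuous h) :
    torusMean (fun q => g q + h q) = torusMean g + torusMean h := by
  rw [torusMean, integral_add (integrableOn_torusBox hg) (integrableOn_torusBox hh), smul_add]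
  rfl

theorem torusMean_const_mul {𝕜 : Type*} [RCLike 𝕜] (c : 𝕜) (g : ActionSpace d → 𝕜) :
    torusMean (fun q => c * g q) = c * torusMean g := by
  rw [torusMean, integral_const_mul, torusMean, mul_smul_comm]

theorem torusMean_linear {𝕜 : Type*} [RCLike 𝕜] (a b : 𝕜) {g h : ActionSpace d → 𝕜}
    (hg : Continuous g) (hh : Continuous h) :
    torusMean (fun q => a * g q + b * h q) = a * torusMean g + b * torusMean h := by
  rw [← torusMean_const_mul, ← torusMean_const_mul]
  exact torusMean_add (continuous_const.mul hg) (continuous_const.mul hh)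

theorem fourierCoef_eq_torusMean (f : Phase d → ℝ) (k : Fin d → ℤ) (p : ActionSpace d) :
    fourierCoef f k p = torusMean fun q => (f (p, q) : ℂ) * torusChar (-k) q := by
  rw [fourierCoef, torusMean, Complex.real_smul]
  congr 1
  · push_cast
    rw [inv_pow]
  · refine integral_congr_ae (Filter.Eventually.of_forall fun q => ?_)
    simp only [torusChar, dotZ_neg_right]
    push_cast
    ring_nf

/-- The Fourier coefficients of a trigonometric polynomial. -/
theorem fourierCoef_of_eq_sum {Z : Phase d → ℝ} {p : ActionSpace d} {s : Finset (Fin d → ℤ)}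
    {a : (Fin d → ℤ) → ℂ} (h : ∀ q, (Z (p, q) : ℂ) = ∑ k ∈ s, a k * torusChar k q)
    (l : Fin d → ℤ) : fourierCoef Z l p = if l ∈ s then a l else 0 := by
  classical
  rw [fourierCoef_eq_torusMean]
  have h1 : (fun q => (Z (p, q) : ℂ) * torusChar (-l) q) =
      fun q => ∑ k ∈ s, a k * torusChar (k - l) q := by
    funext q
    rw [h, Finset.sum_mul]
    refine Finset.sum_congr rfl fun k _ => ?_
    rw [sub_eq_add_neg, torusChar_add_left, mul_assoc]
  rw [h1]
  have h2 : torusMean (fun q => ∑ k ∈ s, a k * torusChar (k - l) q) =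
      ∑ k ∈ s, a k * torusMean (torusChar (k - l)) := by
    rw [torusMean, integral_finsetSum, Finset.smul_sum]
    · refine Finset.sum_congr rfl fun k _ => ?_
      rw [← torusMean_const_mul]
      rfl
    · exact fun k _ => integrableOn_torusBox (continuous_const.mul (continuous_torusChar _))
  rw [h2]
  simp only [torusMean_torusChar, sub_eq_zero, mul_ite, mul_one, mul_zero]
  rw [Finset.sum_ite_eq']

theorem samePoint_add_latticeVec (p q : ActionSpace d) (n : Fin d → ℤ) :
    SamePoint ((p, q) : Phase d) (p, q + latticeVec n) :=
  ⟨rfl, n, fun i => by simp [latticeVec]⟩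

/-- The mean of `f` over translations in the angles, with weight `κ`. -/
noncomputable def kernelMean (κ : ActionSpace d → ℝ) (f : Phase d → ℝ) (x : Phase d) : ℝ :=
  torusMean fun θ => κ θ * f (x + (0, θ))

/-- The part of `f` with Fourier modes `±k`. -/
noncomputable def cosMean (k : Fin d → ℤ) (f : Phase d → ℝ) : Phase d → ℝ :=
  kernelMean (fun θ => Real.cos (dotZ θ k)) f

/-- The conjugate of `cosMean`. -/
noncomputable def sinMean (k : Fin d → ℤ) (f : Phase d → ℝ) : Phase d → ℝ :=
  kernelMean (fun θ => Real.sin (dotZ θ k)) f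

theorem continuous_cos_dotZ (k : Fin d → ℤ) :
    Continuous fun θ : ActionSpace d => Real.cos (dotZ θ k) :=
  Real.continuous_cos.comp (continuous_dotZ k)

theorem continuous_sin_dotZ (k : Fin d → ℤ) :
    Continuous fun θ : ActionSpace d => Real.sin (dotZ θ k) :=
  Real.continuous_sin.comp (continuous_dotZ k)

/-- Differentiation under the integral: the derivative of the integrand is bounded on the compact
product of a ball and the box. -/
theorem hasFDerivAt_kernelMean {κ : ActionSpace d → ℝ} (hκ : Continuous κ)
    {f : Phase d → ℝ} (hf : ContDiff ℝ ∞ f) (x : Phase d) :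
    HasFDerivAt (kernelMean κ f) (torusMean fun θ => κ θ • fderiv ℝ f (x + (0, θ))) x := by
  have hf' : Continuous (fderiv ℝ f) := (hf.fderiv_right (m := ∞) (by simp)).continuous
  have hadd : ∀ x : Phase d, Continuous fun θ : ActionSpace d => x + ((0, θ) : Phase d) :=
    fun x => by fun_prop
  have hK : IsCompact (Metric.closedBall x 1 ×ˢ torusBox d) :=
    (isCompact_closedBall x 1).prod isCompact_torusBox
  have hcont : Continuous fun y : Phase d × ActionSpace d =>
      κ y.2 • fderiv ℝ f (y.1 + (0, y.2)) := by
    refine (hκ.comp continuous_snd).smul (hf'.comp ?_)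
    fun_prop
  obtain ⟨C, hC⟩ := hK.exists_bound_of_continuousOn hcont.continuousOn
  refine HasFDerivAt.const_smul (c := ((2 * Real.pi) ^ d)⁻¹) ?_
  refine hasFDerivAt_integral_of_dominated_of_fderiv_le (bound := fun _ => C)
    (F' := fun y θ => κ θ • fderiv ℝ f (y + (0, θ))) (Metric.ball_mem_nhds x one_pos)
    ?_ ?_ ?_ ?_ ?_ ?_
  · exact Filter.Eventually.of_forall fun y =>
      (hκ.mul (hf.continuous.comp (hadd y))).aestronglyMeasurable
  · exact integrableOn_torusBox (hκ.mul (hf.continuous.comp (hadd x)))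
  · exact (hκ.smul (hf'.comp (hadd x))).aestronglyMeasurable
  · rw [ae_restrict_iff' isCompact_torusBox.measurableSet]
    exact Filter.Eventually.of_forall fun θ hθ y hy =>
      hC (y, θ) ⟨Metric.ball_subset_closedBall hy, hθ⟩
  · exact integrableOn_torusBox continuous_const
  · refine Filter.Eventually.of_forall fun θ y _ => ?_
    have h1 : HasFDerivAt f (fderiv ℝ f (y + (0, θ))) (y + (0, θ)) :=
      (hf.differentiable_top _).hasFDerivAt
    exact ((hasFDerivAt_comp_add_right _).2 h1).const_smul (κ θ)

theorem dirDeriv_kernelMean {κ : ActionSpace d → ℝ} (hκ : Continuous κ)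
    {f : Phase d → ℝ} (hf : ContDiff ℝ ∞ f) (v : Phase d) :
    dirDeriv v (kernelMean κ f) = kernelMean κ (dirDeriv v f) := by
  funext x
  have hf' : Continuous (fderiv ℝ f) := (hf.fderiv_right (m := ∞) (by simp)).continuous
  have hc : Continuous fun θ : ActionSpace d => κ θ • fderiv ℝ f (x + ((0, θ) : Phase d)) :=
    hκ.smul (hf'.comp (by fun_prop))
  rw [dirDeriv, (hasFDerivAt_kernelMean hκ hf x).fderiv, kernelMean, torusMean, torusMean,
    _root_.smul_apply, ContinuousLinearMap.integral_apply (integrableOn_torusBox hc)]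
  rfl

/-- Translating the integration variable by q and expanding cos(θ·k - q·k) separates the dependence
on the angles from that on the actions. -/
theorem cosMean_eq {f : Phase d → ℝ} (hf : IsSmoothOnPhase f) (k : Fin d → ℤ)
    (p q : ActionSpace d) : cosMean k f (p, q) =
      Real.cos (dotZ q k) * cosMean k f (p, 0) + Real.sin (dotZ q k) * sinMean k f (p, 0) := by
  have hfc : Continuous fun θ => f (p, θ) := hf.1.continuous.comp (by fun_prop)
  have hc := continuous_cos_dotZ k
  have hs := continuous_sin_dotZ k
  have hper : ∀ q n, f (p, q + latticeVec n) = f (p, q) := fun q n =>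
    (hf.2 _ _ (samePoint_add_latticeVec p q n)).symm
  have h1 := torusMean_comp_add_real
    (g := fun θ => Real.cos (dotZ θ k - dotZ q k) * f (p, θ))
    ((Real.continuous_cos.comp ((continuous_dotZ k).sub continuous_const)).mul hfc)
    (fun θ n => by
      rw [hper, dotZ_add, dotZ_latticeVec, add_sub_right_comm, Real.cos_add_int_mul_two_pi]) q
  have h2 : cosMean k f (p, q) =
      torusMean fun θ => Real.cos (dotZ (θ + q) k - dotZ q k) * f (p, θ + q) := by
    refine congrArg torusMean (funext fun θ => ?_)
    rw [dotZ_add, add_sub_cancel_right]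
    simp [add_comm]
  have h3 : (fun θ => Real.cos (dotZ θ k - dotZ q k) * f (p, θ)) =
      fun θ => Real.cos (dotZ q k) * (Real.cos (dotZ θ k) * f (p, θ)) +
        Real.sin (dotZ q k) * (Real.sin (dotZ θ k) * f (p, θ)) := by
    funext θ
    rw [Real.cos_sub]
    ring
  rw [h2, h1, h3]
  refine (torusMean_linear _ _ (hc.mul hfc) (hs.mul hfc)).trans ?_
  simp [Pi.mul_def, cosMean, sinMean, kernelMean]

theorem sinMean_eq {f : Phase d → ℝ} (hf : IsSmoothOnPhase f) (k : Fin d → ℤ)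
    (p q : ActionSpace d) : sinMean k f (p, q) =
      Real.cos (dotZ q k) * sinMean k f (p, 0) - Real.sin (dotZ q k) * cosMean k f (p, 0) := by
  have hfc : Continuous fun θ => f (p, θ) := hf.1.continuous.comp (by fun_prop)
  have hc := continuous_cos_dotZ k
  have hs := continuous_sin_dotZ k
  have hper : ∀ q n, f (p, q + latticeVec n) = f (p, q) := fun q n =>
    (hf.2 _ _ (samePoint_add_latticeVec p q n)).symm
  have h1 := torusMean_comp_add_real
    (g := fun θ => Real.sin (dotZ θ k - dotZ q k) * f (p, θ))
    ((Real.continuous_sin.comp ((continuous_dotZ k).sub continuous_const)).mul hfc)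
    (fun θ n => by
      rw [hper, dotZ_add, dotZ_latticeVec, add_sub_right_comm, Real.sin_add_int_mul_two_pi]) q
  have h2 : sinMean k f (p, q) =
      torusMean fun θ => Real.sin (dotZ (θ + q) k - dotZ q k) * f (p, θ + q) := by
    refine congrArg torusMean (funext fun θ => ?_)
    rw [dotZ_add, add_sub_cancel_right]
    simp [add_comm]
  have h3 : (fun θ => Real.sin (dotZ θ k - dotZ q k) * f (p, θ)) =
      fun θ => Real.cos (dotZ q k) * (Real.sin (dotZ θ k) * f (p, θ)) +
        -Real.sin (dotZ q k) * (Real.cos (dotZ θ k) * f (p, θ)) := by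
    funext θ
    rw [Real.sin_sub]
    ring
  rw [h2, h1, h3]
  refine (torusMean_linear _ _ (hs.mul hfc) (hc.mul hfc)).trans ?_
  simp [Pi.mul_def, cosMean, sinMean, kernelMean, sub_eq_add_neg]

theorem dirDeriv_eq_of_hasDerivAt {f : Phase d → ℝ} {x : Phase d} (hf : DifferentiableAt ℝ f x)
    {u : ActionSpace d} {c : ℝ} (h : HasDerivAt (fun t : ℝ => f (x.1, x.2 + t • u)) c 0) :
    dirDeriv (0, u) f x = c := by
  have h1 : HasDerivAt (fun t : ℝ => x + t • ((0, u) : Phase d)) (0, u) 0 := by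
    simpa using ((hasDerivAt_id (0 : ℝ)).smul_const ((0, u) : Phase d)).const_add x
  have h2 : HasFDerivAt f (fderiv ℝ f x) (x + (0 : ℝ) • ((0, u) : Phase d)) := by
    simpa using hf.hasFDerivAt
  have h3 := h2.comp_hasDerivAt (0 : ℝ) h1
  refine h3.unique (h.congr_of_eventuallyEq (Filter.Eventually.of_forall fun t => ?_))
  show f _ = f _
  congr 1
  ext <;> simp

theorem dirDeriv_cosMean {f : Phase d → ℝ} (hf : IsSmoothOnPhase f) (k : Fin d → ℤ)
    (u : ActionSpace d) :
    dirDeriv (0, u) (cosMean k f) = fun x => dotZ u k * sinMean k f x := by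
  funext x
  have hd : DifferentiableAt ℝ (cosMean k f) x :=
    (hasFDerivAt_kernelMean (continuous_cos_dotZ k) hf.1 x).differentiableAt
  refine dirDeriv_eq_of_hasDerivAt hd ?_
  have h1 := hasDerivAt_dotZ x.2 u k 0
  have h2 := (h1.cos.mul_const (cosMean k f (x.1, 0))).add
    (h1.sin.mul_const (sinMean k f (x.1, 0)))
  rw [funext fun t : ℝ => cosMean_eq hf k x.1 (x.2 + t • u)]
  refine HasDerivAt.congr_deriv h2 ?_
  rw [show sinMean k f x = _ from sinMean_eq hf k x.1 x.2, zero_smul, add_zero]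
  ring

theorem dirDeriv_sinMean {f : Phase d → ℝ} (hf : IsSmoothOnPhase f) (k : Fin d → ℤ)
    (u : ActionSpace d) :
    dirDeriv (0, u) (sinMean k f) = fun x => -(dotZ u k * cosMean k f x) := by
  funext x
  have hd : DifferentiableAt ℝ (sinMean k f) x :=
    (hasFDerivAt_kernelMean (continuous_sin_dotZ k) hf.1 x).differentiableAt
  refine dirDeriv_eq_of_hasDerivAt hd ?_
  have h1 := hasDerivAt_dotZ x.2 u k 0
  have h2 := (h1.cos.mul_const (sinMean k f (x.1, 0))).sub
    (h1.sin.mul_const (cosMean k f (x.1, 0)))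
  rw [funext fun t : ℝ => sinMean_eq hf k x.1 (x.2 + t • u)]
  refine HasDerivAt.congr_deriv h2 ?_
  rw [show cosMean k f x = _ from cosMean_eq hf k x.1 x.2, zero_smul, add_zero]
  ring

theorem norm_kernelMean_le {κ : ActionSpace d → ℝ} (hκ : ∀ θ, |κ θ| ≤ 1) {f : Phase d → ℝ} {C : ℝ}
    (hf : ∀ x, |f x| ≤ C) (x : Phase d) : |kernelMean κ f x| ≤ C := by
  refine norm_torusMean_le (g := fun θ => κ θ * f (x + (0, θ))) fun θ => ?_
  rw [norm_mul]
  exact (mul_le_of_le_one_left (norm_nonneg _) (hκ θ)).trans (hf _)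

theorem kernelMean_periodic {κ : ActionSpace d → ℝ} {f : Phase d → ℝ}
    (hf : ∀ x y, SamePoint x y → f x = f y) {x y : Phase d} (h : SamePoint x y) :
    kernelMean κ f x = kernelMean κ f y := by
  refine congrArg torusMean (funext fun θ => congrArg (κ θ * ·) ?_)
  obtain ⟨h1, n, hn⟩ := h
  exact hf _ _ ⟨by simp [h1], n, fun i => by simp [hn i]; ring⟩

theorem torusChar_neg_mul_eq (k : Fin d → ℤ) {f : Phase d → ℝ} (hf : ContDiff ℝ ∞ f)
    (x : Phase d) : torusMean (fun θ => torusChar (-k) θ * (f (x + (0, θ)) : ℂ)) =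
      cosMean k f x - sinMean k f x * Complex.I := by
  have hfc : Continuous fun θ => f (x + ((0, θ) : Phase d)) := hf.continuous.comp (by fun_prop)
  have h1 : (fun θ => torusChar (-k) θ * (f (x + (0, θ)) : ℂ)) =
      fun θ => 1 * ((Real.cos (dotZ θ k) * f (x + (0, θ)) : ℝ) : ℂ) +
        -Complex.I * ((Real.sin (dotZ θ k) * f (x + (0, θ)) : ℝ) : ℂ) := by
    funext θ
    rw [torusChar_neg]
    push_cast
    ring
  have hc : Continuous fun θ => ((Real.cos (dotZ θ k) * f (x + (0, θ)) : ℝ) : ℂ) :=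
    Complex.continuous_ofReal.comp ((continuous_cos_dotZ k).mul hfc)
  have hs : Continuous fun θ => ((Real.sin (dotZ θ k) * f (x + (0, θ)) : ℝ) : ℂ) :=
    Complex.continuous_ofReal.comp ((continuous_sin_dotZ k).mul hfc)
  rw [h1, torusMean_linear _ _ hc hs, torusMean_ofReal, torusMean_ofReal, cosMean, sinMean,
    kernelMean, kernelMean]
  ring

/-- The Fourier series of a smooth function with summable coefficients, evaluated by translating
the point to the origin. -/
theorem hasSum_cosMean {f : Phase d → ℝ} (hf : IsSmoothOnPhase f) (x : Phase d)
    {b : (Fin d → ℤ) → ℝ} (hb : Summable b) (hc : ∀ k, |cosMean k f x| ≤ b k)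
    (hs : ∀ k, |sinMean k f x| ≤ b k) : HasSum (fun k => cosMean k f x) (f x) := by
  have hfc : Continuous fun θ => (f (x + ((0, θ) : Phase d)) : ℂ) :=
    Complex.continuous_ofReal.comp (hf.1.continuous.comp (by fun_prop))
  obtain ⟨G, hG⟩ := exists_lift_torus hfc (fun q n => by
    refine congrArg _ (hf.2 (x + (0, q)) _ ⟨by simp, n, fun i => ?_⟩).symm
    simp [latticeVec, add_assoc])
  have hcoef : ∀ k, UnitAddTorus.mFourierCoeff G k = cosMean k f x - sinMean k f x * Complex.I := by
    intro k
    rw [← torusChar_neg_mul_eq k hf.1, torusMean_eq_setIntegral_unit,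
      UnitAddTorus.mFourierCoeff_eq_integral G k 0]
    refine integral_congr_ae (Filter.Eventually.of_forall fun y => ?_)
    beta_reduce
    rw [hG, smul_eq_mul]
    congr 1
    simp only [UnitAddTorus.mFourier, ContinuousMap.coe_mk, fourier_coe_apply, torusChar, dotZ]
    rw [← Complex.exp_sum]
    congr 1
    push_cast
    rw [Finset.mul_sum]
    refine Finset.sum_congr rfl fun i _ => ?_
    simp only [Pi.neg_apply]
    push_cast
    ring
  have hsum : Summable (UnitAddTorus.mFourierCoeff G) := by
    refine Summable.of_norm_bounded (hb.add hb) fun k => ?_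
    rw [hcoef]
    refine (norm_sub_le _ _).trans (add_le_add ?_ ?_)
    · simpa using hc k
    · simpa using hs k
  have h1 := UnitAddTorus.hasSum_mFourier_series_apply_of_summable hsum
    (fun i => ((0 : Fin d → ℝ) i : UnitAddCircle))
  rw [hG] at h1
  -- At the origin every character is 1, and the real part discards the sine means, leaving the
  -- series of cosine means.
  have h2 := Complex.hasSum_re h1
  convert h2 using 1
  · funext k
    rw [hcoef]
    have : UnitAddTorus.mFourier k (fun i : Fin d => ((0 : Fin d → ℝ) i : UnitAddCircle)) = 1 := by
      simp [UnitAddTorus.mFourier]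
    rw [this]
    simp
  · rw [Complex.ofReal_re]
    congr 1
    ext <;> simp

end Modes

/-! ### Rapid decay of Fourier modes, and the tail beyond a cutoff. -/

section Decay

open scoped Pointwise

variable {d : ℕ} {ι : Type*}

/-- The weight `1 + |k|²` of a Fourier mode. -/
noncomputable def modeWeight (k : Fin d → ℤ) : ℝ := 1 + ∑ i, (k i : ℝ) ^ 2

theorem one_le_modeWeight (k : Fin d → ℤ) : 1 ≤ modeWeight k :=
  le_add_of_nonneg_right (Finset.sum_nonneg fun _ _ => sq_nonneg _)

theorem modeWeight_pos (k : Fin d → ℤ) : 0 < modeWeight k := one_pos.trans_le (one_le_modeWeight k)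

theorem sq_le_modeWeight (k : Fin d → ℤ) (i : Fin d) : 1 + (k i : ℝ) ^ 2 ≤ modeWeight k := by
  have := Finset.single_le_sum (f := fun i => (k i : ℝ) ^ 2) (fun _ _ => sq_nonneg _)
    (Finset.mem_univ i)
  unfold modeWeight
  linarith

theorem abs_dotZ_le (u : ActionSpace d) (k : Fin d → ℤ) :
    |dotZ u k| ≤ (∑ i, |u i|) * modeWeight k := by
  rw [dotZ, Finset.sum_mul]
  refine (Finset.abs_sum_le_sum_abs _ _).trans (Finset.sum_le_sum fun i _ => ?_)
  rw [abs_mul]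
  gcongr
  refine le_trans ?_ (sq_le_modeWeight k i)
  nlinarith [sq_nonneg (|(k i : ℝ)| - 1), sq_abs (k i : ℝ)]

theorem summable_modeWeight : Summable fun k : Fin d → ℤ => (modeWeight k)⁻¹ ^ d := by
  have h1 : Summable fun j : ℤ => (1 + (j : ℝ) ^ 2)⁻¹ := by
    -- At j = 0 division gives 1 / j² = 0, so a point mass is added there to dominate the value 1.
    have h2 : Summable fun j : ℤ => 1 / (j : ℝ) ^ 2 + if j = 0 then (1 : ℝ) else 0 :=
      (Real.summable_one_div_int_pow.2 (by norm_num)).add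
        (summable_of_ne_finset_zero (s := {0}) fun j hj => by simpa using hj)
    refine Summable.of_nonneg_of_le (fun j => by positivity) (fun j => ?_) h2
    by_cases hj : j = 0
    · simp [hj]
    · have : (0 : ℝ) < (j : ℝ) ^ 2 := by positivity
      rw [if_neg hj, add_zero, one_div]
      exact inv_anti₀ this (by linarith)
  refine summable_of_sum_le (c := (∑' j : ℤ, (1 + (j : ℝ) ^ 2)⁻¹) ^ d)
    (fun k => pow_nonneg (inv_nonneg.2 (modeWeight_pos k).le) _) fun s => ?_
  classical
  -- A finite set of modes lies in the product of its coordinate projections, where the sum of the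
  -- products factors into one-dimensional sums.
  let t : Fin d → Finset ℤ := fun i => s.image fun k => k i
  calc ∑ k ∈ s, (modeWeight k)⁻¹ ^ d
      ≤ ∑ k ∈ s, ∏ i, (1 + (k i : ℝ) ^ 2)⁻¹ := by
        refine Finset.sum_le_sum fun k _ => ?_
        calc (modeWeight k)⁻¹ ^ d = ∏ _i : Fin d, (modeWeight k)⁻¹ := by simp
          _ ≤ _ := Finset.prod_le_prod (fun _ _ => inv_nonneg.2 (modeWeight_pos k).le)
            fun i _ => inv_anti₀ (by positivity) (sq_le_modeWeight k i)
    _ ≤ ∑ k ∈ Fintype.piFinset t, ∏ i, (1 + (k i : ℝ) ^ 2)⁻¹ := by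
        refine Finset.sum_le_sum_of_subset_of_nonneg (fun k hk => ?_)
          fun k _ _ => Finset.prod_nonneg fun i _ => by positivity
        exact Fintype.mem_piFinset.2 fun i => Finset.mem_image_of_mem _ hk
    _ = ∏ i, ∑ j ∈ t i, (1 + (j : ℝ) ^ 2)⁻¹ :=
        (Finset.prod_univ_sum t fun _ j => (1 + (j : ℝ) ^ 2)⁻¹).symm
    _ ≤ ∏ _i : Fin d, ∑' j : ℤ, (1 + (j : ℝ) ^ 2)⁻¹ := by
        refine Finset.prod_le_prod (fun i _ => Finset.sum_nonneg fun j _ => by positivity)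
          fun i _ => h1.sum_le_tsum _ fun j _ => by positivity
    _ = _ := by simp

/-- A uniform family of functions on the phase space `ℝ^d × 𝕋^d`. -/
structure PeriodicSymbol (w : ι → ℝ) (f : ι → Phase d → ℝ) : Prop
    extends UniformSymbol w f where
  periodic : ∀ i x y, SamePoint x y → f i x = f i y

namespace PeriodicSymbol

variable {w w' : ι → ℝ} {f g : ι → Phase d → ℝ}

theorem isSmooth (hf : PeriodicSymbol w f) (i : ι) : IsSmoothOnPhase (f i) :=
  ⟨hf.smooth i, hf.periodic i⟩

theorem dirDeriv (hf : PeriodicSymbol w f) (v : Phase d) :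
    PeriodicSymbol w fun i => dirDeriv v (f i) :=
  ⟨hf.toUniformSymbol.dirDeriv v, fun i _ _ h => dirDeriv_periodic (hf.periodic i) v h⟩

theorem add (hf : PeriodicSymbol w f) (hg : PeriodicSymbol w g) :
    PeriodicSymbol w fun i x => f i x + g i x :=
  ⟨hf.toUniformSymbol.add hg.toUniformSymbol, fun i x y h =>
    congrArg₂ (· + ·) (hf.periodic i x y h) (hg.periodic i x y h)⟩

theorem sub (hf : PeriodicSymbol w f) (hg : PeriodicSymbol w g) :
    PeriodicSymbol w fun i x => f i x - g i x :=
  ⟨hf.toUniformSymbol.sub hg.toUniformSymbol, fun i x y h =>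
    congrArg₂ (· - ·) (hf.periodic i x y h) (hg.periodic i x y h)⟩

theorem mul (hf : PeriodicSymbol w f) (hg : PeriodicSymbol w' g) :
    PeriodicSymbol (fun i => w i * w' i) fun i x => f i x * g i x :=
  ⟨hf.toUniformSymbol.mul hg.toUniformSymbol, fun i x y h =>
    congrArg₂ (· * ·) (hf.periodic i x y h) (hg.periodic i x y h)⟩

theorem const_mul (hf : PeriodicSymbol w f) (c : ι → ℝ) :
    PeriodicSymbol (fun i => |c i| * w i) fun i x => c i * f i x :=
  ⟨hf.toUniformSymbol.const_mul c, fun i x y h => congrArg (c i * ·) (hf.periodic i x y h)⟩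

theorem scalar_mul (hf : PeriodicSymbol w f) (hw : ∀ i, 0 ≤ w i) (c : ℝ) :
    PeriodicSymbol w fun i x => c * f i x :=
  ⟨hf.toUniformSymbol.scalar_mul hw c, fun i x y h => congrArg (c * ·) (hf.periodic i x y h)⟩

theorem zero : PeriodicSymbol w fun _ (_ : Phase d) => 0 :=
  ⟨UniformSymbol.zero, fun _ _ _ _ => rfl⟩

theorem sum {κ : Type*} (s : Finset κ) {f : κ → ι → Phase d → ℝ}
    (hf : ∀ k ∈ s, PeriodicSymbol w (f k)) : PeriodicSymbol w fun i x => ∑ k ∈ s, f k i x :=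
  ⟨UniformSymbol.sum s fun k hk => (hf k hk).toUniformSymbol, fun i x y h =>
    Finset.sum_congr rfl fun k hk => (hf k hk).periodic i x y h⟩

theorem mono (hf : PeriodicSymbol w f) (hw : ∀ i, 0 ≤ w i) (D : ℝ) (h : ∀ i, w i ≤ D * w' i) :
    PeriodicSymbol w' f :=
  ⟨hf.toUniformSymbol.mono hw D h, hf.periodic⟩

/-- Two derivatives in the angle q_j multiply the k-th mean by -k_j². Summing over j together with
the mean itself, each induction step gains one factor of the inverse weight. -/
theorem exists_mean_decay (hf : PeriodicSymbol w f) (M : ℕ) :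
    ∃ C : ℝ, ∀ i k x, |cosMean k (f i) x| ≤ C * (w i * (modeWeight k)⁻¹ ^ M) ∧
      |sinMean k (f i) x| ≤ C * (w i * (modeWeight k)⁻¹ ^ M) := by
  induction M generalizing f with
  | zero =>
    obtain ⟨C, hC⟩ := hf.bound []
    refine ⟨C, fun i k x => ?_⟩
    rw [pow_zero, mul_one]
    exact ⟨norm_kernelMean_le (fun θ => Real.abs_cos_le_one _) (hC i) x,
      norm_kernelMean_le (fun θ => Real.abs_sin_le_one _) (hC i) x⟩
  | succ M ih =>
    obtain ⟨C, hC⟩ := ih hf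
    let e : Fin d → Phase d := fun j => (0, EuclideanSpace.single j 1)
    choose D hD using fun j => ih ((hf.dirDeriv (e j)).dirDeriv (e j))
    refine ⟨C + ∑ j, D j, fun i k x => ?_⟩
    have hdot : ∀ j, dotZ (EuclideanSpace.single j (1 : ℝ)) k = k j := by
      intro j
      simp [dotZ]
    have hpos := modeWeight_pos k
    have hcos : ∀ j, cosMean k (_root_.dirDeriv (e j) (_root_.dirDeriv (e j) (f i))) x =
        -((k j : ℝ) ^ 2 * cosMean k (f i) x) := by
      intro j
      have h1 := (hf.isSmooth i).dirDeriv (e j)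
      rw [cosMean, ← dirDeriv_kernelMean (continuous_cos_dotZ k) h1.1, ← cosMean,
        dirDeriv_cosMean h1, hdot, sinMean,
        ← dirDeriv_kernelMean (continuous_sin_dotZ k) (hf.smooth i), ← sinMean,
        dirDeriv_sinMean (hf.isSmooth i), hdot]
      ring
    have hsin : ∀ j, sinMean k (_root_.dirDeriv (e j) (_root_.dirDeriv (e j) (f i))) x =
        -((k j : ℝ) ^ 2 * sinMean k (f i) x) := by
      intro j
      have h1 := (hf.isSmooth i).dirDeriv (e j)
      rw [sinMean, ← dirDeriv_kernelMean (continuous_sin_dotZ k) h1.1, ← sinMean,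
        dirDeriv_sinMean h1, hdot, cosMean,
        ← dirDeriv_kernelMean (continuous_cos_dotZ k) (hf.smooth i), ← cosMean,
        dirDeriv_cosMean (hf.isSmooth i), hdot]
      ring
    have key : ∀ a : ℝ, |a| ≤ C * (w i * (modeWeight k)⁻¹ ^ M) →
        (∀ j, |-((k j : ℝ) ^ 2 * a)| ≤ D j * (w i * (modeWeight k)⁻¹ ^ M)) →
        |a| ≤ (C + ∑ j, D j) * (w i * (modeWeight k)⁻¹ ^ (M + 1)) := by
      intro a h0 h1
      have h2 : modeWeight k * |a| ≤ (C + ∑ j, D j) * (w i * (modeWeight k)⁻¹ ^ M) := by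
        rw [modeWeight, add_mul, one_mul, add_mul, Finset.sum_mul, Finset.sum_mul]
        refine add_le_add h0 (Finset.sum_le_sum fun j _ => ?_)
        have := h1 j
        rwa [abs_neg, abs_mul, abs_of_nonneg (sq_nonneg (k j : ℝ))] at this
      rw [pow_succ, ← mul_assoc, ← mul_assoc, ← div_eq_mul_inv, le_div_iff₀ hpos]
      linarith
    refine ⟨key _ (hC i k x).1 fun j => ?_, key _ (hC i k x).2 fun j => ?_⟩
    · rw [← hcos j]
      exact (hD j i k x).1
    · rw [← hsin j]
      exact (hD j i k x).2

/-- Means commute with directional derivatives, so such families are closed under differentiation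
and the decay of the means themselves suffices. The mode is part of the index, which makes the
constants uniform in k. -/
theorem cosMean_rapid (hf : PeriodicSymbol w f) (M : ℕ) :
    UniformSymbol (fun p : ι × (Fin d → ℤ) => w p.1 * (modeWeight p.2)⁻¹ ^ M)
      fun p => cosMean p.2 (f p.1) := by
  refine UniformSymbol.of_class (fun F => ∃ f : ι → Phase d → ℝ, PeriodicSymbol w f ∧
    F = fun p : ι × (Fin d → ℤ) => cosMean p.2 (f p.1)) ?_ ?_ ?_ ⟨f, hf, rfl⟩
  · rintro _ ⟨f, hf, rfl⟩ p x
    exact (hasFDerivAt_kernelMean (continuous_cos_dotZ p.2) (hf.smooth _) x).differentiableAt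
  · rintro _ ⟨f, hf, rfl⟩ v
    exact ⟨_, hf.dirDeriv v, funext fun p =>
      dirDeriv_kernelMean (continuous_cos_dotZ p.2) (hf.smooth _) v⟩
  · rintro _ ⟨f, hf, rfl⟩
    obtain ⟨C, hC⟩ := hf.exists_mean_decay M
    exact ⟨C, fun p x => (hC p.1 p.2 x).1⟩

theorem sinMean_rapid (hf : PeriodicSymbol w f) (M : ℕ) :
    UniformSymbol (fun p : ι × (Fin d → ℤ) => w p.1 * (modeWeight p.2)⁻¹ ^ M)
      fun p => sinMean p.2 (f p.1) := by
  refine UniformSymbol.of_class (fun F => ∃ f : ι → Phase d → ℝ, PeriodicSymbol w f ∧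
    F = fun p : ι × (Fin d → ℤ) => sinMean p.2 (f p.1)) ?_ ?_ ?_ ⟨f, hf, rfl⟩
  · rintro _ ⟨f, hf, rfl⟩ p x
    exact (hasFDerivAt_kernelMean (continuous_sin_dotZ p.2) (hf.smooth _) x).differentiableAt
  · rintro _ ⟨f, hf, rfl⟩ v
    exact ⟨_, hf.dirDeriv v, funext fun p =>
      dirDeriv_kernelMean (continuous_sin_dotZ p.2) (hf.smooth _) v⟩
  · rintro _ ⟨f, hf, rfl⟩
    obtain ⟨C, hC⟩ := hf.exists_mean_decay M
    exact ⟨C, fun p x => (hC p.1 p.2 x).2⟩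

end PeriodicSymbol

theorem iterDir_real (l : List ℝ) {ψ : ℝ → ℝ} (hψ : ContDiff ℝ ∞ ψ) (s : ℝ) :
    iterDir l ψ s = l.prod * iterDir (List.replicate l.length 1) ψ s := by
  have h1 : ∀ (a : ℝ) (f : ℝ → ℝ) (s : ℝ), dirDeriv a f s = a * dirDeriv 1 f s := by
    intro a f s
    simp [dirDeriv]
  induction l generalizing s with
  | nil => simp
  | cons a l ih =>
    rw [iterDir_cons, funext ih, h1, dirDeriv_const_mul (hψ.iterDir _).differentiable_top,
      List.prod_cons, List.length_cons, List.replicate_succ, iterDir_cons]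
    ring

/-- The functional `(p, q) ↦ p · k`. -/
noncomputable def modeFunctional (k : Fin d → ℤ) : Phase d →L[ℝ] ℝ :=
  (∑ i, (k i : ℝ) • (EuclideanSpace.proj i : ActionSpace d →L[ℝ] ℝ)).comp
    (ContinuousLinearMap.fst ℝ (ActionSpace d) (ActionSpace d))

theorem modeFunctional_apply (k : Fin d → ℤ) (x : Phase d) : modeFunctional k x = dotZ x.1 k := by
  simp [modeFunctional, dotZ, mul_comm]

/-- A smooth function of one real variable with bounded derivatives. -/
def HasBoundedDerivs (ψ : ℝ → ℝ) : Prop := UniformSymbol (fun _ : Unit => 1) fun _ => ψ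

theorem exists_iterDir_comp_dotZ_le {ψ : ℝ → ℝ} (hψ : HasBoundedDerivs ψ) (l : List (Phase d)) :
    ∃ C : ℝ, 0 ≤ C ∧ ∀ (k : Fin d → ℤ) x,
      |iterDir l (fun x : Phase d => ψ (dotZ x.1 k)) x| ≤ C * modeWeight k ^ l.length := by
  obtain ⟨C, hC⟩ := hψ.bound (List.replicate l.length 1)
  have hC0 : 0 ≤ C := by simpa using (abs_nonneg _).trans (hC () 0)
  refine ⟨(l.map fun v => ∑ i, |v.1 i|).prod * C,
    mul_nonneg (List.prod_nonneg fun a ha => ?_) hC0, fun k x => ?_⟩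
  · obtain ⟨v, -, rfl⟩ := List.mem_map.1 ha
    exact Finset.sum_nonneg fun _ _ => abs_nonneg _
  simp only [← modeFunctional_apply]
  rw [iterDir_comp_clm _ (hψ.smooth ())]
  beta_reduce
  rw [iterDir_real _ (hψ.smooth ()), List.length_map, abs_mul]
  have h1 : |(l.map (modeFunctional k)).prod| ≤
      (l.map fun v => ∑ i, |v.1 i|).prod * modeWeight k ^ l.length := by
    clear hC
    induction l with
    | nil => simp
    | cons v l ih =>
      simp only [List.map_cons, List.prod_cons, List.length_cons, abs_mul, pow_succ]
      calc _ ≤ ((∑ i, |v.1 i|) * modeWeight k) *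
            ((l.map fun v => ∑ i, |v.1 i|).prod * modeWeight k ^ l.length) := by
            gcongr
            · have := modeWeight_pos k; positivity
            · rw [modeFunctional_apply]; exact abs_dotZ_le _ _
        _ = _ := by ring
  calc _ ≤ ((l.map fun v => ∑ i, |v.1 i|).prod * modeWeight k ^ l.length) * (C * 1) := by
        gcongr
        · exact (abs_nonneg _).trans h1
        · exact hC () _
    _ = _ := by ring

/-- Multiplication of the modes of a rapidly decaying family by bounded functions of `p · k`. -/
theorem uniformSymbol_sum_modes {w : ι → ℝ} (hw : ∀ i, 0 ≤ w i) {ψ : ℝ → ℝ}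
    (hψ : HasBoundedDerivs ψ) {A : ι × (Fin d → ℤ) → Phase d → ℝ}
    (hA : ∀ M : ℕ, UniformSymbol
      (fun p : ι × (Fin d → ℤ) => w p.1 * (modeWeight p.2)⁻¹ ^ M) A)
    (s : ι → Finset (Fin d → ℤ)) :
    UniformSymbol w fun i x => ∑ k ∈ s i, ψ (dotZ x.1 k) * A (i, k) x := by
  have hψk : ∀ k : Fin d → ℤ, ContDiff ℝ ∞ fun x : Phase d => ψ (dotZ x.1 k) := by
    intro k
    simp only [← modeFunctional_apply]
    exact (hψ.smooth ()).comp (modeFunctional k).contDiff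
  have hAk := (hA 0).smooth
  refine ⟨fun i => ContDiff.sum fun k _ => (hψk k).mul (hAk _), fun l => ?_⟩
  have key : ∃ C : ℝ, 0 ≤ C ∧ ∀ i k x,
      |iterDir l (fun x => ψ (dotZ x.1 k) * A (i, k) x) x| ≤
        C * (w i * (modeWeight k)⁻¹ ^ d) := by
    obtain ⟨s, hs⟩ := exists_leibniz (E := Phase d) l
    simp only [fun i k => hs _ _ (hψk k) (hAk (i, k))]
    clear hs
    induction s with
    | nil => exact ⟨0, le_rfl, fun i k x => by simp⟩
    | cons p s ih =>
      obtain ⟨C, hC0, hC⟩ := ih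
      obtain ⟨B, hB0, hB⟩ := exists_iterDir_comp_dotZ_le (d := d) hψ p.1
      -- The word length in the exponent pays for the powers of the weight produced by
      -- differentiating ψ(p·k); the further d powers make the sum over k converge.
      obtain ⟨D, hD⟩ := (hA (p.1.length + d)).bound p.2
      refine ⟨B * |D| + C, by positivity, fun i k x => ?_⟩
      simp only [List.map_cons, List.sum_cons]
      refine (abs_add_le _ _).trans ?_
      rw [add_mul]
      refine add_le_add ?_ (hC i k x)
      rw [abs_mul]
      have hpos := modeWeight_pos k
      have hwi := hw i
      calc _ ≤ (B * modeWeight k ^ p.1.length) *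
            (|D| * (w i * (modeWeight k)⁻¹ ^ (p.1.length + d))) := by
            refine mul_le_mul (hB k x) ((hD (i, k) x).trans ?_) (abs_nonneg _) (by positivity)
            exact mul_le_mul_of_nonneg_right (le_abs_self D) (by positivity)
        _ = B * |D| * (w i * (modeWeight k)⁻¹ ^ d) *
            (modeWeight k * (modeWeight k)⁻¹) ^ p.1.length := by rw [pow_add, mul_pow]; ring
        _ = _ := by rw [mul_inv_cancel₀ hpos.ne', one_pow, mul_one]
  obtain ⟨C, hC0, hC⟩ := key
  refine ⟨C * ∑' k : Fin d → ℤ, (modeWeight k)⁻¹ ^ d, fun i x => ?_⟩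
  rw [iterDir_sum _ fun k => (hψk k).mul (hAk _)]
  calc _ ≤ ∑ k ∈ s i, C * (w i * (modeWeight k)⁻¹ ^ d) :=
        (Finset.abs_sum_le_sum_abs _ _).trans (Finset.sum_le_sum fun k _ => hC i k x)
    _ = C * w i * ∑ k ∈ s i, (modeWeight k)⁻¹ ^ d := by
        rw [Finset.mul_sum]; exact Finset.sum_congr rfl fun k _ => by ring
    _ ≤ C * w i * ∑' k : Fin d → ℤ, (modeWeight k)⁻¹ ^ d := by
        have := hw i
        gcongr
        exact summable_modeWeight.sum_le_tsum _ fun k _ =>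
          pow_nonneg (inv_nonneg.2 (modeWeight_pos k).le) _
    _ = _ := by ring

theorem mem_modes {K : ℕ} {k : Fin d → ℤ} : k ∈ modes d K ↔ ∑ i, k i ^ 2 ≤ (K : ℤ) ^ 2 := by
  refine ⟨fun h => (Finset.mem_filter.1 h).2, fun h => Finset.mem_filter.2 ⟨?_, h⟩⟩
  refine Fintype.mem_piFinset.2 fun i => ?_
  have h1 : k i ^ 2 ≤ (K : ℤ) ^ 2 :=
    (Finset.single_le_sum (f := fun i => k i ^ 2) (fun _ _ => sq_nonneg _)
      (Finset.mem_univ i)).trans h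
  exact Finset.mem_Icc.2 (abs_le.1 (abs_le_of_sq_le_sq h1 (by positivity)))

theorem lt_modeWeight_of_notMem {K : ℕ} {k : Fin d → ℤ} (h : k ∉ modes d K) :
    (K : ℝ) < modeWeight k := by
  rw [mem_modes, not_le] at h
  have h1 : ((K : ℝ)) ^ 2 < ∑ i, (k i : ℝ) ^ 2 := by exact_mod_cast h
  unfold modeWeight
  nlinarith [sq_nonneg ((K : ℝ) - 1)]

/-- The part of a function with Fourier modes outside a ball is small to all orders. -/
theorem uniformSymbol_tail {w : ι → ℝ} (hw : ∀ i, 0 ≤ w i) {f : ι → Phase d → ℝ}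
    (hf : PeriodicSymbol w f) {K : ι → ℕ} (hK : ∀ i, 0 < K i) (M : ℕ) :
    UniformSymbol (fun i => w i * ((K i : ℝ))⁻¹ ^ M)
      fun i x => f i x - ∑ k ∈ modes d (K i), cosMean k (f i) x := by
  refine UniformSymbol.of_class (fun F => ∃ f : ι → Phase d → ℝ, PeriodicSymbol w f ∧
    F = fun i x => f i x - ∑ k ∈ modes d (K i), cosMean k (f i) x) ?_ ?_ ?_ ⟨f, hf, rfl⟩
  · rintro _ ⟨f, hf, rfl⟩ i
    exact (hf.smooth i).differentiable_top.sub (Differentiable.fun_sum fun k _ x =>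
      (hasFDerivAt_kernelMean (continuous_cos_dotZ k) (hf.smooth _) x).differentiableAt)
  · rintro _ ⟨f, hf, rfl⟩ v
    refine ⟨_, hf.dirDeriv v, funext fun i => funext fun x => ?_⟩
    have hd : ∀ k ∈ modes d (K i), DifferentiableAt ℝ (cosMean k (f i)) x := fun k _ =>
      (hasFDerivAt_kernelMean (continuous_cos_dotZ k) (hf.smooth _) x).differentiableAt
    rw [dirDeriv, fderiv_fun_sub ((hf.smooth i).differentiable_top x)
      (DifferentiableAt.fun_sum hd), fderiv_fun_sum hd, _root_.sub_apply, _root_.sum_apply]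
    congr 1
    exact Finset.sum_congr rfl fun k _ =>
      congrFun (dirDeriv_kernelMean (continuous_cos_dotZ k) (hf.smooth _) v) x
  · rintro _ ⟨f, hf, rfl⟩
    obtain ⟨C₀, hC₀⟩ := hf.exists_mean_decay d
    -- Of these powers, M become the gain K^(-M) on modes beyond the cutoff, and d are kept for
    -- summability.
    obtain ⟨C, hC⟩ := hf.exists_mean_decay (d + M)
    refine ⟨|C| * ∑' k : Fin d → ℤ, (modeWeight k)⁻¹ ^ d, fun i x => ?_⟩
    have hb : Summable fun k : Fin d → ℤ => C₀ * (w i * (modeWeight k)⁻¹ ^ d) :=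
      (summable_modeWeight.mul_left _).mul_left _
    have hsum := hasSum_cosMean (hf.isSmooth i) x hb (fun k => (hC₀ i k x).1)
      fun k => (hC₀ i k x).2
    have hlim : Filter.Tendsto (fun t : Finset (Fin d → ℤ) =>
        |∑ k ∈ t, cosMean k (f i) x - ∑ k ∈ modes d (K i), cosMean k (f i) x|) Filter.atTop
        (nhds |f i x - ∑ k ∈ modes d (K i), cosMean k (f i) x|) :=
      (Filter.Tendsto.sub_const hsum _).abs
    refine le_of_tendsto hlim ?_
    filter_upwards [Filter.eventually_ge_atTop (modes d (K i))] with t ht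
    classical
    rw [← Finset.sum_sdiff ht, add_sub_cancel_right]
    have hKi : (0 : ℝ) < K i := by exact_mod_cast hK i
    have hwi := hw i
    calc |∑ k ∈ t \ modes d (K i), cosMean k (f i) x|
        ≤ ∑ k ∈ t \ modes d (K i), |C| * (w i * ((K i : ℝ)⁻¹ ^ M * (modeWeight k)⁻¹ ^ d)) := by
          refine (Finset.abs_sum_le_sum_abs _ _).trans (Finset.sum_le_sum fun k hk => ?_)
          refine (hC i k x).1.trans ?_
          have h1 := (lt_modeWeight_of_notMem (Finset.mem_sdiff.1 hk).2).le
          have h2 : (modeWeight k)⁻¹ ≤ (K i : ℝ)⁻¹ := inv_anti₀ hKi h1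
          have h3 := modeWeight_pos k
          rw [pow_add, mul_comm ((modeWeight k)⁻¹ ^ d)]
          gcongr
          exact le_abs_self C
      _ = |C| * (w i * (K i : ℝ)⁻¹ ^ M) * ∑ k ∈ t \ modes d (K i), (modeWeight k)⁻¹ ^ d := by
          rw [Finset.mul_sum]; exact Finset.sum_congr rfl fun k _ => by ring
      _ ≤ |C| * (w i * (K i : ℝ)⁻¹ ^ M) * ∑' k : Fin d → ℤ, (modeWeight k)⁻¹ ^ d := by
          gcongr
          exact summable_modeWeight.sum_le_tsum _ fun k _ =>
            pow_nonneg (inv_nonneg.2 (modeWeight_pos k).le) _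
      _ = _ := by ring

end Decay

/-! ### The cutoff χ and the regularized inverse ψ. -/

section CutoffFunctions

theorem hasBoundedDerivs_of_eq_polynomial {f : ℝ → ℝ} (hf : ContDiff ℝ ∞ f) (p : Polynomial ℝ)
    (hp : ∀ s, 1 < |s| → f s = p.eval s⁻¹) : HasBoundedDerivs f := by
  refine UniformSymbol.of_class (fun F : Unit → ℝ → ℝ => ContDiff ℝ ∞ (F ()) ∧
    ∃ p : Polynomial ℝ, ∀ s, 1 < |s| → F () s = p.eval s⁻¹) ?_ ?_ ?_ ⟨hf, p, hp⟩
  · rintro F ⟨hF, -⟩ ⟨⟩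
    exact hF.differentiable_top
  · rintro F ⟨hF, p, hp⟩ v
    -- Outside [-1, 1], the derivative of p(1/s) is -s⁻² p'(1/s), again a polynomial in 1/s. Hence
    -- all derivatives are bounded: on [-1, 1] by compactness, outside because |1/s| ≤ 1.
    refine ⟨hF.dirDeriv v, Polynomial.C (-v) * Polynomial.X ^ 2 * Polynomial.derivative p,
      fun s hs => ?_⟩
    have hs0 : s ≠ 0 := by
      rintro rfl
      simp at hs
      linarith
    have h1 : F () =ᶠ[nhds s] fun s => p.eval s⁻¹ := by
      filter_upwards [(isOpen_lt continuous_const continuous_abs).mem_nhds hs] with t ht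
      exact hp t ht
    have h2 : HasDerivAt (fun s : ℝ => p.eval s⁻¹) _ s :=
      (p.hasDerivAt s⁻¹).comp s (hasDerivAt_inv hs0)
    have h3 := (h2.congr_of_eventuallyEq h1).hasFDerivAt.fderiv
    change fderiv ℝ (F ()) s v = _
    rw [h3]
    simp
    ring
  · rintro F ⟨hF, p, hp⟩
    obtain ⟨A, hA⟩ := (isCompact_Icc (a := (-1 : ℝ)) (b := 1)).exists_bound_of_continuousOn
      hF.continuous.continuousOn
    obtain ⟨B, hB⟩ := (isCompact_Icc (a := (-1 : ℝ)) (b := 1)).exists_bound_of_continuousOn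
      p.continuous.continuousOn
    refine ⟨max A B, fun i s => ?_⟩
    rw [mul_one]
    rcases le_or_gt |s| 1 with h | h
    · exact (hA s (abs_le.1 h)).trans (le_max_left _ _)
    · have h1 : |s⁻¹| ≤ 1 := by
        rw [abs_inv]
        exact inv_le_one_of_one_le₀ h.le
      have h2 : F i s = _ := hp s h
      rw [h2]
      exact (hB _ (abs_le.1 h1)).trans (le_max_right _ _)

/-- An even cutoff function, with the quotient by which it defines a regularized inverse. -/
theorem exists_cutoff : ∃ χ ψ : ℝ → ℝ, HasBoundedDerivs χ ∧ HasBoundedDerivs ψ ∧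
    (∀ s, χ (-s) = χ s) ∧ (∀ s, χ s ≠ 0 → |s| ≤ 1) ∧ ∀ s, ψ s * s = 1 - χ s := by
  let b : ContDiffBump (0 : ℝ) := ⟨1 / 2, 1, by norm_num, by norm_num⟩
  have hb0 : ∀ s, 1 < |s| → b s = 0 := fun s hs =>
    b.zero_of_le_dist (by rw [dist_zero_right]; exact hs.le)
  have hb1 : ∀ s, |s| < 1 / 2 → b s = 1 := fun s hs =>
    b.one_of_mem_closedBall (by rw [mem_closedBall_zero_iff]; exact hs.le)
  have hb : ContDiff ℝ ∞ b := b.contDiff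
  -- The bump equals 1 near 0, so the quotient vanishes identically there and the singularity is
  -- removed.
  have hψ : ContDiff ℝ ∞ fun s => (1 - b s) / s := by
    refine contDiff_iff_contDiffAt.2 fun s => ?_
    by_cases hs : s = 0
    · subst hs
      refine (contDiffAt_const (c := (0 : ℝ))).congr_of_eventuallyEq ?_
      have : Metric.ball (0 : ℝ) (1 / 2) ∈ nhds (0 : ℝ) := Metric.ball_mem_nhds _ (by norm_num)
      filter_upwards [this] with t ht
      rw [hb1 t (by simpa using ht), sub_self, zero_div]
    · exact (contDiffAt_const.sub hb.contDiffAt).div contDiffAt_id hs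
  refine ⟨b, fun s => (1 - b s) / s,
    hasBoundedDerivs_of_eq_polynomial hb 0 fun s hs => by simp [hb0 s hs],
    hasBoundedDerivs_of_eq_polynomial hψ Polynomial.X fun s hs => by simp [hb0 s hs],
    fun s => b.neg s, fun s hs => not_lt.1 fun h => hs (hb0 s h), fun s => ?_⟩
  by_cases hs : s = 0
  · subst hs
    rw [hb1 0 (by norm_num)]
    simp
  · exact div_mul_cancel₀ _ hs

end CutoffFunctions

/-! ### The homological equation. -/

section HomologicalEquation

variable {d : ℕ} {ι : Type*}

/-- A function with Fourier modes `|k| ≤ K`, the `k`-th one living on `|p · k| ≤ 1`. -/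
def IsResonant (K : ℕ) (Z : Phase d → ℝ) : Prop :=
  ∃ a : (Fin d → ℤ) → ActionSpace d → ℂ,
    (∀ p q, (Z (p, q) : ℂ) = ∑ k ∈ modes d K, a k p * torusChar k q) ∧
      ∀ k p, a k p ≠ 0 → |dotZ p k| ≤ 1

theorem neg_mem_modes {K : ℕ} {k : Fin d → ℤ} : -k ∈ modes d K ↔ k ∈ modes d K := by
  simp [mem_modes]

theorem sinMean_neg (k : Fin d → ℤ) (f : Phase d → ℝ) (x : Phase d) :
    sinMean (-k) f x = -sinMean k f x := by
  unfold sinMean kernelMean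
  simp only [dotZ_neg_right, Real.sin_neg, neg_mul]
  have := torusMean_const_mul (𝕜 := ℝ) (-1)
    (fun θ : ActionSpace d => Real.sin (dotZ θ k) * f (x + (0, θ)))
  simpa using this

/-- The cosine mean is the real part of the k-th Fourier mode. Evenness of the cutoff is what makes
the imaginary parts of k and -k cancel in the sum, so real and complex expansions agree. -/
theorem isResonant_sum_cosMean {χ : ℝ → ℝ} (heven : ∀ s, χ (-s) = χ s)
    (hsupp : ∀ s, χ s ≠ 0 → |s| ≤ 1) {f : Phase d → ℝ} (hf : IsSmoothOnPhase f) (K : ℕ) :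
    IsResonant K fun x => ∑ k ∈ modes d K, χ (dotZ x.1 k) * cosMean k f x := by
  refine ⟨fun k p => χ (dotZ p k) * (cosMean k f (p, 0) - sinMean k f (p, 0) * Complex.I),
    fun p q => ?_, fun k p h => hsupp _ ?_⟩
  · have h1 : ∀ k : Fin d → ℤ,
        (χ (dotZ p k) : ℂ) * (cosMean k f (p, 0) - sinMean k f (p, 0) * Complex.I) *
          torusChar k q = ((χ (dotZ p k) * cosMean k f (p, q) : ℝ) : ℂ) -
            ((χ (dotZ p k) * sinMean k f (p, q) : ℝ) : ℂ) * Complex.I := by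
      intro k
      rw [cosMean_eq hf k p q, sinMean_eq hf k p q, torusChar_eq]
      push_cast
      linear_combination (-(χ (dotZ p k) : ℂ) * sinMean k f (p, 0) * Complex.sin (dotZ q k)) *
        Complex.I_sq
    have h2 : ∑ k ∈ modes d K, χ (dotZ p k) * sinMean k f (p, q) = 0 := by
      have h3 : ∑ k ∈ modes d K, χ (dotZ p k) * sinMean k f (p, q) =
          ∑ k ∈ modes d K, -(χ (dotZ p k) * sinMean k f (p, q)) := by
        refine Finset.sum_nbij' (fun k => -k) (fun k => -k) (fun k hk => neg_mem_modes.2 hk)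
          (fun k hk => neg_mem_modes.2 hk) (fun k _ => neg_neg k) (fun k _ => neg_neg k)
          fun k _ => ?_
        rw [sinMean_neg, dotZ_neg_right, heven]
        ring
      rw [Finset.sum_neg_distrib] at h3
      linarith
    rw [Finset.sum_congr rfl fun k _ => h1 k, Finset.sum_sub_distrib, ← Finset.sum_mul,
      ← Complex.ofReal_sum, ← Complex.ofReal_sum, h2]
    simp
  · intro h0
    exact h (by simp [h0])

/-- The homological equation, up to resonant modes and a tail that is small to all orders. -/
theorem exists_homological {w : ι → ℝ} (hw : ∀ i, 0 ≤ w i) {F : ι → Phase d → ℝ}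
    (hF : PeriodicSymbol w F) {K : ι → ℕ} (hK : ∀ i, 0 < K i) (M : ℕ) :
    ∃ Z G : ι → Phase d → ℝ, PeriodicSymbol w Z ∧ PeriodicSymbol w G ∧
      (∀ i, IsResonant (K i) (Z i)) ∧
      PeriodicSymbol (fun i => w i * ((K i : ℝ))⁻¹ ^ M)
        fun i x => F i x - dirDeriv (0, x.1) (G i) x - Z i x := by
  obtain ⟨χ, ψ, hχ, hψ, heven, hsupp, hψχ⟩ := exists_cutoff
  have hcp : ∀ i k x y, SamePoint x y → cosMean k (F i) x = cosMean k (F i) y :=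
    fun i k x y h => kernelMean_periodic (hF.periodic i) h
  have hsp : ∀ i k x y, SamePoint x y → sinMean k (F i) x = sinMean k (F i) y :=
    fun i k x y h => kernelMean_periodic (hF.periodic i) h
  have hZ := uniformSymbol_sum_modes hw hχ hF.cosMean_rapid fun i => modes d (K i)
  have hG := uniformSymbol_sum_modes hw hψ hF.sinMean_rapid fun i => modes d (K i)
  have hT := uniformSymbol_tail hw hF hK M
  -- Along (0, p) the sine mean has derivative -(p·k) times the cosine mean. With ψ(s)s = 1 - χ(s),
  -- the second sum, sign included, therefore produces (1 - χ) times the cosine means, and only the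
  -- tail remains.
  refine ⟨fun i x => ∑ k ∈ modes d (K i), χ (dotZ x.1 k) * cosMean k (F i) x,
    fun i x => -∑ k ∈ modes d (K i), ψ (dotZ x.1 k) * sinMean k (F i) x, ⟨hZ, ?_⟩, ⟨hG.neg, ?_⟩,
    fun i => isResonant_sum_cosMean heven hsupp (hF.isSmooth i) _, ?_⟩
  · intro i x y h
    simp only [hcp i _ x y h, h.1]
  · intro i x y h
    simp only [hsp i _ x y h, h.1]
  · have hd : ∀ i x, dirDeriv (0, x.1)
        (fun x => -∑ k ∈ modes d (K i), ψ (dotZ x.1 k) * sinMean k (F i) x) x =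
          ∑ k ∈ modes d (K i), (1 - χ (dotZ x.1 k)) * cosMean k (F i) x := by
      intro i x
      have hsd : ∀ k, Differentiable ℝ (sinMean k (F i)) := fun k y =>
        (hasFDerivAt_kernelMean (continuous_sin_dotZ k) (hF.smooth i) y).differentiableAt
      refine dirDeriv_eq_of_hasDerivAt ((hG.neg.smooth i).differentiable_top x) ?_
      rw [← neg_neg (∑ k ∈ modes d (K i), (1 - χ (dotZ x.1 k)) * cosMean k (F i) x),
        ← Finset.sum_neg_distrib]
      refine HasDerivAt.neg (HasDerivAt.fun_sum fun k _ => ?_)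
      have h1 : HasDerivAt (fun t : ℝ => sinMean k (F i) (x.1, x.2 + t • x.1))
          (dirDeriv (0, x.1) (sinMean k (F i)) x) 0 := by
        have h2 : HasDerivAt (fun t : ℝ => ((x.1, x.2 + t • x.1) : Phase d)) (0, x.1) 0 := by
          have h3 : HasDerivAt (fun t : ℝ => x.2 + t • x.1) x.1 0 := by
            simpa using ((hasDerivAt_id (0 : ℝ)).smul_const x.1).const_add x.2
          exact (hasDerivAt_const _ _).prodMk h3
        have h4 : HasFDerivAt (sinMean k (F i)) (fderiv ℝ (sinMean k (F i)) x)
            ((x.1, x.2 + (0 : ℝ) • x.1) : Phase d) := by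
          simpa using (hsd k x).hasFDerivAt
        exact h4.comp_hasDerivAt 0 h2
      have h5 := h1.const_mul (ψ (dotZ x.1 k))
      rw [dirDeriv_sinMean (hF.isSmooth i)] at h5
      refine h5.congr_deriv ?_
      rw [← hψχ]
      ring
    have hEq : (fun i x => F i x - dirDeriv (0, x.1)
        (fun x => -∑ k ∈ modes d (K i), ψ (dotZ x.1 k) * sinMean k (F i) x) x -
          ∑ k ∈ modes d (K i), χ (dotZ x.1 k) * cosMean k (F i) x) =
        fun i x => F i x - ∑ k ∈ modes d (K i), cosMean k (F i) x := by
      funext i x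
      rw [hd, sub_sub, ← Finset.sum_add_distrib]
      congr 1
      exact Finset.sum_congr rfl fun k _ => by ring
    rw [hEq]
    exact ⟨hT, fun i x y h => by rw [hF.periodic i x y h]; simp only [hcp i _ x y h]⟩

end HomologicalEquation

/-! ### Poisson brackets and the construction of the generating function. -/

section NormalForm

variable {d : ℕ} {ι : Type*}

/-- The Poisson bracket: the derivative of `f` along the Hamiltonian vector field of `g`. -/
noncomputable def bracket (f g : Phase d → ℝ) (x : Phase d) : ℝ := fderiv ℝ f x (hamField g x)

/-- The `k`-fold Poisson bracket `{⋯{f, g}, ⋯, g}`. -/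
noncomputable def iterBracket (g : Phase d → ℝ) (k : ℕ) (f : Phase d → ℝ) : Phase d → ℝ :=
  (fun f => bracket f g)^[k] f

@[simp] theorem iterBracket_zero (g f : Phase d → ℝ) : iterBracket g 0 f = f := rfl

theorem iterBracket_succ (g : Phase d → ℝ) (k : ℕ) (f : Phase d → ℝ) :
    iterBracket g (k + 1) f = bracket (iterBracket g k f) g :=
  Function.iterate_succ_apply' _ _ _

theorem bracket_eq_sum (f g : Phase d → ℝ) (x : Phase d) :
    bracket f g x = ∑ i, (dQ i f x * dP i g x - dP i f x * dQ i g x) := by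
  have h := dirDeriv_eq_sum (hamField g x) f x
  rw [dirDeriv] at h
  rw [bracket, h, ← Finset.sum_add_distrib]
  refine Finset.sum_congr rfl fun i _ => ?_
  simp only [hamField]
  ring

theorem hamField_add {f g : Phase d → ℝ} (hf : Differentiable ℝ f) (hg : Differentiable ℝ g)
    (x : Phase d) : hamField (fun x => f x + g x) x = hamField f x + hamField g x := by
  have h1 : ∀ i, dQ i (fun x => f x + g x) x = dQ i f x + dQ i g x := fun i =>
    congrFun (dirDeriv_add hf hg _) x
  have h2 : ∀ i, dP i (fun x => f x + g x) x = dP i f x + dP i g x := fun i =>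
    congrFun (dirDeriv_add hf hg _) x
  refine Prod.ext (PiLp.ext fun i => ?_) (PiLp.ext fun i => ?_)
  · simp [hamField, h1, add_comm]
  · simp [hamField, h2]

theorem bracket_add_right {f g g' : Phase d → ℝ} (hg : Differentiable ℝ g)
    (hg' : Differentiable ℝ g') (x : Phase d) :
    bracket f (fun x => g x + g' x) x = bracket f g x + bracket f g' x := by
  rw [bracket, hamField_add hg hg', map_add]
  rfl

theorem bracket_sub_left {f f' : Phase d → ℝ} (hf : Differentiable ℝ f)
    (hf' : Differentiable ℝ f') (g : Phase d → ℝ) (x : Phase d) :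
    bracket (fun x => f x - f' x) g x = bracket f g x - bracket f' g x := by
  rw [bracket, fderiv_fun_sub (hf x) (hf' x)]
  rfl

namespace PeriodicSymbol

variable {w w' : ι → ℝ} {f g : ι → Phase d → ℝ}

theorem dP (hf : PeriodicSymbol w f) (j : Fin d) : PeriodicSymbol w fun i => dP j (f i) :=
  hf.dirDeriv _

theorem dQ (hf : PeriodicSymbol w f) (j : Fin d) : PeriodicSymbol w fun i => dQ j (f i) :=
  hf.dirDeriv _

theorem bracket (hf : PeriodicSymbol w f) (hg : PeriodicSymbol w' g) :
    PeriodicSymbol (fun i => w i * w' i) fun i => bracket (f i) (g i) := by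
  have h := PeriodicSymbol.sum Finset.univ fun j (_ : j ∈ Finset.univ) =>
    ((hf.dQ j).mul (hg.dP j)).sub ((hf.dP j).mul (hg.dQ j))
  have e : (fun i => _root_.bracket (f i) (g i)) = fun i x =>
      ∑ j, (_root_.dQ j (f i) x * _root_.dP j (g i) x -
        _root_.dP j (f i) x * _root_.dQ j (g i) x) :=
    funext fun i => funext fun x => bracket_eq_sum _ _ x
  rw [e]
  exact h

theorem iterBracket (hf : PeriodicSymbol w f) (hg : PeriodicSymbol w' g) (k : ℕ) :
    PeriodicSymbol (fun i => w i * w' i ^ k) fun i => iterBracket (g i) k (f i) := by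
  induction k with
  | zero => simpa using hf
  | succ k ih =>
    simp only [iterBracket_succ, pow_succ, ← mul_assoc]
    exact ih.bracket hg

end PeriodicSymbol

/-- Each bracket with a generator of size h gains a factor h. Thus a change of the generator at
order h^(j+1), and of the function at order e h^j, is invisible at order e h^j in every term
containing at least one bracket. -/
theorem iterBracket_sub_mem {e h : ι → ℝ} (he : ∀ i, 0 ≤ e i) (h0 : ∀ i, 0 ≤ h i)
    (h1 : ∀ i, h i ≤ 1) {j : ℕ} {f f' g g' : ι → Phase d → ℝ} (hf : PeriodicSymbol e f)
    (hff' : PeriodicSymbol (fun i => e i * h i ^ j) fun i x => f' i x - f i x)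
    (hg : PeriodicSymbol h g) (hg' : PeriodicSymbol (fun i => h i ^ (j + 1)) g') (k : ℕ) :
    PeriodicSymbol (fun i => e i * h i ^ (j + 1)) fun i x =>
      iterBracket (fun x => g i x + g' i x) (k + 1) (f' i) x - iterBracket (g i) (k + 1) (f i) x := by
  have hgg : PeriodicSymbol h fun i x => g i x + g' i x :=
    hg.add (hg'.mono (fun i => pow_nonneg (h0 i) _) 1 fun i => by
      rw [one_mul]; exact pow_le_of_le_one (h0 i) (h1 i) j.succ_ne_zero)
  have hf' : PeriodicSymbol e f' := by
    have := hf.add (hff'.mono (fun i => mul_nonneg (he i) (pow_nonneg (h0 i) _)) 1 fun i => by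
      rw [one_mul]; exact mul_le_of_le_one_right (he i) (pow_le_one₀ (h0 i) (h1 i)))
    simpa using this
  -- Bilinearity splits the difference: the change of the function bracketed with g + g' gains h,
  -- and the unchanged function bracketed with g' is already of size e h^(j+1).
  have key : ∀ k, PeriodicSymbol (fun i => e i * h i ^ j) (fun i x =>
      iterBracket (fun x => g i x + g' i x) k (f' i) x - iterBracket (g i) k (f i) x) →
      PeriodicSymbol (fun i => e i * h i ^ (j + 1)) fun i x =>
        iterBracket (fun x => g i x + g' i x) (k + 1) (f' i) x -
          iterBracket (g i) (k + 1) (f i) x := by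
    intro k ih
    have hL : PeriodicSymbol e fun i => iterBracket (g i) k (f i) :=
      (hf.iterBracket hg k).mono (fun i => mul_nonneg (he i) (pow_nonneg (h0 i) _)) 1 fun i => by
        rw [one_mul]; exact mul_le_of_le_one_right (he i) (pow_le_one₀ (h0 i) (h1 i))
    have hL' := hf'.iterBracket hgg k
    have a := (ih.bracket hgg).mono (w' := fun i => e i * h i ^ (j + 1))
      (fun i => mul_nonneg (mul_nonneg (he i) (pow_nonneg (h0 i) _)) (h0 i)) 1 fun i => by
        rw [pow_succ]; linarith
    refine cast ?_ (a.add (hL.bracket hg'))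
    congr 1
    funext i x
    rw [iterBracket_succ, iterBracket_succ,
      bracket_sub_left (hL'.smooth i).differentiable_top (hL.smooth i).differentiable_top,
      bracket_add_right (hg.smooth i).differentiable_top (hg'.smooth i).differentiable_top
        (f := iterBracket (g i) k (f i))]
    ring
  induction k with
  | zero => exact key 0 hff'
  | succ k ih =>
    refine key _ (ih.mono (fun i => mul_nonneg (he i) (pow_nonneg (h0 i) _)) 1 fun i => ?_)
    rw [one_mul]
    exact mul_le_mul_of_nonneg_left
      (pow_le_pow_of_le_one (h0 i) (h1 i) j.le_succ) (he i)

/-- The Taylor polynomial of `(H₀ + P) ∘ Φ¹ - H₀`, where `Φ` is the Hamiltonian flow of `g`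
and `Y = {H₀, g}`. -/
noncomputable def lieTaylor (n : ℕ) (g Y P : Phase d → ℝ) (x : Phase d) : ℝ :=
  ∑ k ∈ Finset.range n, (((k + 1).factorial : ℝ)⁻¹ * iterBracket g k Y x +
    (k.factorial : ℝ)⁻¹ * iterBracket g k P x)

/-- The generating function of a transformation to resonant normal form, in rescaled variables. -/
theorem exists_generator {e h lam : ι → ℝ} (hlam : ∀ i, 0 < lam i) (h0 : ∀ i, 0 ≤ h i)
    (h1 : ∀ i, h i ≤ 1) (he : ∀ i, e i = lam i * h i) {K : ι → ℕ} (hK : ∀ i, 0 < K i) {M : ℕ}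
    (hKM : ∀ i, ((K i : ℝ))⁻¹ ^ M ≤ h i) {P : ι → Phase d → ℝ} (hP : PeriodicSymbol e P) (n : ℕ) :
    ∀ j ≤ n, ∃ (g Y : ι → Phase d → ℝ) (Z : ℕ → ι → Phase d → ℝ), PeriodicSymbol h g ∧
      PeriodicSymbol e Y ∧ (∀ i x, Y i x = -(lam i * dirDeriv (0, x.1) (g i) x)) ∧
      (∀ m < j, PeriodicSymbol (fun i => e i * h i ^ m) (Z m) ∧ ∀ i, IsResonant (K i) (Z m i)) ∧
      PeriodicSymbol (fun i => e i * h i ^ j) fun i x =>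
        lieTaylor n (g i) (Y i) (P i) x - ∑ m ∈ Finset.range j, Z m i x := by
  have he0 : ∀ i, 0 ≤ e i := fun i => he i ▸ mul_nonneg (hlam i).le (h0 i)
  have hpos : ∀ j i, 0 ≤ e i * h i ^ j := fun j i => mul_nonneg (he0 i) (pow_nonneg (h0 i) j)
  have hdown : ∀ j i, e i * h i ^ j ≤ 1 * e i := fun j i => by
    rw [one_mul]; exact mul_le_of_le_one_right (he0 i) (pow_le_one₀ (h0 i) (h1 i))
  intro j
  induction j with
  | zero =>
    intro _
    have hg : PeriodicSymbol h fun (_ : ι) (_ : Phase d) => (0 : ℝ) := .zero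
    have hY : PeriodicSymbol e fun (_ : ι) (_ : Phase d) => (0 : ℝ) := .zero
    refine ⟨_, _, fun _ _ _ => 0, hg, hY, fun i x => ?_, fun m hm => absurd hm m.not_lt_zero, ?_⟩
    · rw [dirDeriv_zero]; simp
    · simp only [pow_zero, mul_one, Finset.range_zero, Finset.sum_empty, sub_zero, lieTaylor]
      refine PeriodicSymbol.sum _ fun k _ => PeriodicSymbol.add ?_ ?_
      · exact ((hY.iterBracket hg k).mono (hpos k) 1 (hdown k)).scalar_mul he0 _
      · exact ((hP.iterBracket hg k).mono (hpos k) 1 (hdown k)).scalar_mul he0 _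
  | succ j ih =>
    intro hj
    obtain ⟨g, Y, Z, hg, hY, hYg, hZ, hD⟩ := ih (Nat.le_of_succ_le hj)
    -- The current defect, of size e h^j, is split into a resonant part, a derivative along p, and a
    -- tail.
    obtain ⟨Zn, G, hZn, hG, hres, htail⟩ := exists_homological (hpos j) hD hK M
    -- Division by `lam` converts e h^j into h^(j+1), because e = `lam` · h.
    have hg' : PeriodicSymbol (fun i => h i ^ (j + 1)) fun i x => (lam i)⁻¹ * G i x := by
      refine (hG.const_mul fun i => (lam i)⁻¹).mono
        (fun i => mul_nonneg (abs_nonneg _) (hpos j i)) 1 fun i => le_of_eq ?_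
      rw [abs_of_pos (inv_pos.2 (hlam i)), he]
      have := (hlam i).ne'
      field_simp
      ring
    set g' : ι → Phase d → ℝ := fun i x => (lam i)⁻¹ * G i x with hg'_def
    set D : ι → Phase d → ℝ := fun i x =>
      lieTaylor n (g i) (Y i) (P i) x - ∑ m ∈ Finset.range j, Z m i x with hD_def
    have htail' : PeriodicSymbol (fun i => e i * h i ^ j) fun i x =>
        D i x - dirDeriv (0, x.1) (G i) x - Zn i x :=
      htail.mono (fun i => mul_nonneg (hpos j i) (by positivity)) 1 fun i => by
        rw [one_mul]
        exact mul_le_of_le_one_right (hpos j i) ((hKM i).trans (h1 i))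
    -- The direction (0, p) is unbounded, so the size of this derivative cannot be read off from G.
    -- It is bounded because the homological equation expresses it through bounded families.
    have hY' : PeriodicSymbol (fun i => e i * h i ^ j) fun i x =>
        -dirDeriv (0, x.1) (G i) x := by
      have := (hZn.add htail').sub hD
      refine cast ?_ this
      congr 1
      funext i x
      ring
    have hgg : PeriodicSymbol h fun i x => g i x + g' i x :=
      hg.add (hg'.mono (fun i => pow_nonneg (h0 i) _) 1 fun i => by
        rw [one_mul]; exact pow_le_of_le_one (h0 i) (h1 i) j.succ_ne_zero)
    have hYY : PeriodicSymbol e fun i x => Y i x + -dirDeriv (0, x.1) (G i) x :=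
      hY.add (hY'.mono (hpos j) 1 (hdown j))
    refine ⟨_, _, fun m => if m = j then Zn else Z m, hgg, hYY, fun i x => ?_, fun m hm => ?_, ?_⟩
    · have hd := congrFun (dirDeriv_add (hg.smooth i).differentiable_top
        (hg'.smooth i).differentiable_top (0, x.1)) x
      have hd' := congrFun (dirDeriv_const_mul (hG.smooth i).differentiable_top (lam i)⁻¹
        (0, x.1)) x
      rw [hd, hYg, hd']
      have := (hlam i).ne'
      field_simp
      ring
    · by_cases hmj : m = j
      · subst hmj
        simp only [if_true]
        exact ⟨hZn, hres⟩
      · simp only [if_neg hmj]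
        exact hZ m (by omega)
    -- The terms k = 0, without brackets, are split off: their change cancels the defect up to the
    -- tail, while all other terms change only at order e h^(j+1).
    · obtain ⟨n, rfl⟩ : ∃ m, n = m + 1 := ⟨n - 1, by omega⟩
      have hYd := fun k => (iterBracket_sub_mem he0 h0 h1 (f' := fun i x =>
        Y i x + -dirDeriv (0, x.1) (G i) x) hY (by simpa using hY') hg hg' k).scalar_mul
          (hpos (j + 1)) ((((k + 1) + 1).factorial : ℝ)⁻¹)
      have hPd := fun k => (iterBracket_sub_mem he0 h0 h1 (f' := P) (j := j) hP
        (by simpa using PeriodicSymbol.zero) hg hg' k).scalar_mul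
          (hpos (j + 1)) (((k + 1).factorial : ℝ)⁻¹)
      have htail'' : PeriodicSymbol (fun i => e i * h i ^ (j + 1)) fun i x =>
          D i x - dirDeriv (0, x.1) (G i) x - Zn i x :=
        htail.mono (fun i => mul_nonneg (hpos j i) (by positivity)) 1 fun i => by
          rw [one_mul, pow_succ, ← mul_assoc]
          exact mul_le_mul_of_nonneg_left (hKM i) (hpos j i)
      have hall := htail''.add (PeriodicSymbol.sum (Finset.range n) fun k _ => (hYd k).add (hPd k))
      refine cast ?_ hall
      congr 1
      funext i x
      beta_reduce
      rw [Finset.sum_range_succ, if_pos rfl]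
      have hsum : ∑ m ∈ Finset.range j, (if m = j then Zn else Z m) i x =
          ∑ m ∈ Finset.range j, Z m i x :=
        Finset.sum_congr rfl fun m hm => by rw [if_neg (Finset.mem_range.1 hm).ne]
      rw [hsum]
      simp only [hD_def, lieTaylor]
      rw [Finset.sum_range_succ', Finset.sum_range_succ' (n := n)]
      simp only [iterBracket_zero, mul_sub, Finset.sum_add_distrib, Finset.sum_sub_distrib]
      simp
      ring

end NormalForm

/-! ### Taylor's formula on [0, 1]. -/

section Taylor

/-- The derivative of the Taylor error of F 0 is the Taylor error of F 1, of one order less. The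
mean value inequality on an interval of length 1 carries the bound over without loss. -/
theorem abs_sub_taylor_le {n : ℕ} {B : ℝ} : ∀ {F : ℕ → ℝ → ℝ},
    (∀ k < n, ∀ t ∈ Set.Icc (0 : ℝ) 1, HasDerivWithinAt (F k) (F (k + 1) t) (Set.Icc 0 1) t) →
    (∀ t ∈ Set.Icc (0 : ℝ) 1, |F n t| ≤ B) → ∀ t ∈ Set.Icc (0 : ℝ) 1,
      |F 0 t - ∑ k ∈ Finset.range n, (k.factorial : ℝ)⁻¹ * F k 0 * t ^ k| ≤ B := by
  induction n with
  | zero => intro F _ hB t ht; simpa using hB t ht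
  | succ n ih =>
    intro F hF hB t ht
    have h1 := ih (F := fun k => F (k + 1)) (fun k hk => hF (k + 1) (by omega)) hB
    have hd : ∀ s ∈ Set.Icc (0 : ℝ) 1, HasDerivWithinAt
        (fun s => F 0 s - ∑ k ∈ Finset.range (n + 1), (k.factorial : ℝ)⁻¹ * F k 0 * s ^ k)
        (F 1 s - ∑ k ∈ Finset.range n, (k.factorial : ℝ)⁻¹ * F (k + 1) 0 * s ^ k)
        (Set.Icc 0 1) s := by
      intro s hs
      refine (hF 0 n.succ_pos s hs).sub ?_
      simp only [Finset.sum_range_succ']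
      rw [← add_zero (∑ k ∈ Finset.range n, (k.factorial : ℝ)⁻¹ * F (k + 1) 0 * s ^ k)]
      refine HasDerivWithinAt.add (HasDerivWithinAt.fun_sum fun k _ => ?_) ?_
      · refine HasDerivAt.hasDerivWithinAt ?_
        refine ((hasDerivAt_pow (k + 1) s).const_mul _).congr_deriv ?_
        have : ((k.factorial : ℕ) : ℝ) ≠ 0 := by positivity
        rw [Nat.factorial_succ]
        push_cast
        field_simp
      · simpa using hasDerivWithinAt_const s (Set.Icc (0 : ℝ) 1) (F 0 0)
    have h2 := (convex_Icc (0 : ℝ) 1).norm_image_sub_le_of_norm_hasDerivWithin_le hd h1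
      (Set.left_mem_Icc.2 zero_le_one) ht
    have h3 : F 0 0 - ∑ k ∈ Finset.range (n + 1), (k.factorial : ℝ)⁻¹ * F k 0 * 0 ^ k = 0 := by
      simp [Finset.sum_range_succ']
    rw [h3, sub_zero, sub_zero, Real.norm_eq_abs, Real.norm_eq_abs, abs_of_nonneg ht.1] at h2
    have hB0 : 0 ≤ B := (abs_nonneg _).trans (h1 0 (Set.left_mem_Icc.2 zero_le_one))
    exact h2.trans (mul_le_of_le_one_right hB0 ht.2)

end Taylor

/-! ### Lie series along a Hamiltonian flow. -/

section LieSeries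

variable {d : ℕ}

theorem contDiff_bracket {f g : Phase d → ℝ} (hf : ContDiff ℝ ∞ f) (hg : ContDiff ℝ ∞ g) :
    ContDiff ℝ ∞ (bracket f g) :=
  (hf.fderiv_right (m := ∞) (by simp)).clm_apply (contDiff_hamField hg)

theorem contDiff_iterBracket {f g : Phase d → ℝ} (hf : ContDiff ℝ ∞ f) (hg : ContDiff ℝ ∞ g)
    (k : ℕ) : ContDiff ℝ ∞ (iterBracket g k f) := by
  induction k with
  | zero => exact hf
  | succ k ih => rw [iterBracket_succ]; exact contDiff_bracket ih hg

theorem contDiff_freeHam : ContDiff ℝ ∞ fun x : Phase d => freeHam x.1 := by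
  unfold freeHam
  have h : ∀ j : Fin d, ContDiff ℝ ∞ fun x : Phase d => x.1 j := fun j =>
    ((EuclideanSpace.proj j : ActionSpace d →L[ℝ] ℝ).comp
      (ContinuousLinearMap.fst ℝ (ActionSpace d) (ActionSpace d))).contDiff
  exact ContDiff.sum fun j _ => ((h j).pow 2).div_const 2

theorem dirDeriv_freeHam (v x : Phase d) :
    dirDeriv v (fun x : Phase d => freeHam x.1) x = ∑ j, x.1 j * v.1 j := by
  have h : ∀ j : Fin d, HasFDerivAt (fun x : Phase d => x.1 j)
      ((EuclideanSpace.proj j : ActionSpace d →L[ℝ] ℝ).comp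
        (ContinuousLinearMap.fst ℝ (ActionSpace d) (ActionSpace d))) x := fun j =>
    ((EuclideanSpace.proj j : ActionSpace d →L[ℝ] ℝ).comp
        (ContinuousLinearMap.fst ℝ (ActionSpace d) (ActionSpace d))).hasFDerivAt
  have h1 : HasFDerivAt (fun x : Phase d => freeHam x.1) _ x :=
    HasFDerivAt.fun_sum fun j _ => ((h j).pow 2).mul_const ((2 : ℝ)⁻¹)
  rw [dirDeriv, h1.fderiv]
  simp only [_root_.sum_apply]
  refine Finset.sum_congr rfl fun j _ => ?_
  simp
  ring

theorem bracket_freeHam (lam : ℝ) (g : Phase d → ℝ) (x : Phase d) :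
    bracket (fun x => lam * freeHam x.1) g x = -(lam * dirDeriv (0, x.1) g x) := by
  have h1 : bracket (fun x => lam * freeHam x.1) g x =
      dirDeriv (hamField g x) (fun x => lam * freeHam x.1) x := rfl
  rw [h1, dirDeriv_const_mul contDiff_freeHam.differentiable_top]
  beta_reduce
  rw [dirDeriv_freeHam,
    dirDeriv_eq_sum]
  simp [hamField, Finset.mul_sum]

variable {g : Phase d → ℝ} {Φ : ℝ → Phase d → Phase d}

/-- Along the flow the derivative of each iterated bracket is the next one, so the sum is the Taylor
polynomial at time 0. The Lipschitz bound is the same estimate for the difference of two orbits,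
which avoids differentiating the flow in x. -/
theorem abs_comp_flow_sub_taylor_le (hg : ContDiff ℝ ∞ g) (hΦ0 : ∀ x, Φ 0 x = x)
    (hΦ : ∀ x, ∀ t ∈ Set.Icc (0 : ℝ) 1,
      HasDerivWithinAt (fun s => Φ s x) (hamField g (Φ t x)) (Set.Icc 0 1) t)
    (hlip : ∀ t x y, ‖Φ t x - Φ t y‖ ≤ 2 * ‖x - y‖) {f : Phase d → ℝ} (hf : ContDiff ℝ ∞ f)
    (n : ℕ) {A : ℝ} (hA0 : 0 ≤ A) (hA : ∀ x, |iterBracket g n f x| ≤ A)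
    (hA' : ∀ x, ‖fderiv ℝ (iterBracket g n f) x‖ ≤ A) :
    (∀ x, |f (Φ 1 x) - ∑ k ∈ Finset.range n, (k.factorial : ℝ)⁻¹ * iterBracket g k f x| ≤ A) ∧
      ∀ x y, |(f (Φ 1 x) - ∑ k ∈ Finset.range n, (k.factorial : ℝ)⁻¹ * iterBracket g k f x) -
        (f (Φ 1 y) - ∑ k ∈ Finset.range n, (k.factorial : ℝ)⁻¹ * iterBracket g k f y)| ≤
        2 * A * ‖x - y‖ := by
  have hd : ∀ x k, ∀ t ∈ Set.Icc (0 : ℝ) 1, HasDerivWithinAt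
      (fun s => iterBracket g k f (Φ s x)) (iterBracket g (k + 1) f (Φ t x)) (Set.Icc 0 1) t := by
    intro x k t ht
    rw [iterBracket_succ]
    exact ((contDiff_iterBracket hf hg k).differentiable_top (Φ t x)).hasFDerivAt.comp_hasDerivWithinAt
      t (hΦ x t ht)
  have h1 : (1 : ℝ) ∈ Set.Icc (0 : ℝ) 1 := Set.right_mem_Icc.2 zero_le_one
  refine ⟨fun x => ?_, fun x y => ?_⟩
  · have := abs_sub_taylor_le (n := n) (F := fun k s => iterBracket g k f (Φ s x))
      (fun k _ => hd x k) (fun t _ => hA _) 1 h1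
    simpa [hΦ0] using this
  · have := abs_sub_taylor_le (n := n) (B := 2 * A * ‖x - y‖)
      (F := fun k s => iterBracket g k f (Φ s x) - iterBracket g k f (Φ s y))
      (fun k _ t ht => (hd x k t ht).sub (hd y k t ht)) (fun t _ => ?_) 1 h1
    · refine le_trans (le_of_eq ?_) this
      congr 1
      simp only [hΦ0, iterBracket_zero, one_pow, mul_one, mul_sub, Finset.sum_sub_distrib]
      ring
    · have h2 := convex_univ.norm_image_sub_le_of_norm_fderiv_le (𝕜 := ℝ)
        (f := iterBracket g n f) (fun x _ => (contDiff_iterBracket hf hg n).differentiable_top x)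
        (fun x _ => hA' x) (Set.mem_univ (Φ t y)) (Set.mem_univ (Φ t x))
      rw [Real.norm_eq_abs] at h2
      nlinarith [hlip t x y]

/-- The error of the Lie series of `H₀ + P`, truncated at order `n`. -/
theorem abs_lieTaylor_error_le (hg : ContDiff ℝ ∞ g) (hΦ0 : ∀ x, Φ 0 x = x)
    (hΦ : ∀ x, ∀ t ∈ Set.Icc (0 : ℝ) 1,
      HasDerivWithinAt (fun s => Φ s x) (hamField g (Φ t x)) (Set.Icc 0 1) t)
    (hlip : ∀ t x y, ‖Φ t x - Φ t y‖ ≤ 2 * ‖x - y‖) {P Y : Phase d → ℝ} (hP : ContDiff ℝ ∞ P)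
    {lam : ℝ} (hY : ∀ x, Y x = -(lam * dirDeriv (0, x.1) g x))
    (n : ℕ) {A B : ℝ} (hA0 : 0 ≤ A) (hB0 : 0 ≤ B) (hA : ∀ x, |iterBracket g n Y x| ≤ A)
    (hA' : ∀ x, ‖fderiv ℝ (iterBracket g n Y) x‖ ≤ A) (hB : ∀ x, |iterBracket g n P x| ≤ B)
    (hB' : ∀ x, ‖fderiv ℝ (iterBracket g n P) x‖ ≤ B) {E : Phase d → ℝ}
    (hE : ∀ x, E x = lam * freeHam (Φ 1 x).1 + P (Φ 1 x) - lam * freeHam x.1 -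
      lieTaylor n g Y P x) :
    (∀ x, |E x| ≤ A + B) ∧ ∀ x y, |E x - E y| ≤ 2 * (A + B) * ‖x - y‖ := by
  have hH : ContDiff ℝ ∞ fun x : Phase d => lam * freeHam x.1 :=
    contDiff_const.mul contDiff_freeHam
  have hHY : bracket (fun x : Phase d => lam * freeHam x.1) g = Y :=
    funext fun x => by rw [bracket_freeHam, hY]
  -- The first bracket of the unbounded H₀ is the bounded Y. Hence H₀ is expanded to one order more
  -- than P, and both errors involve n-fold brackets of bounded functions.
  have hit : ∀ k, iterBracket g (k + 1) (fun x : Phase d => lam * freeHam x.1) =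
      iterBracket g k Y := fun k => by
    rw [← hHY]; exact Function.iterate_succ_apply _ _ _
  obtain ⟨h1, h2⟩ := abs_comp_flow_sub_taylor_le hg hΦ0 hΦ hlip hH (n + 1) hA0
    (by rw [hit]; exact hA) (by rw [hit]; exact hA')
  obtain ⟨h3, h4⟩ := abs_comp_flow_sub_taylor_le hg hΦ0 hΦ hlip hP n hB0 hB hB'
  have hEq : ∀ x, E x =
      (lam * freeHam (Φ 1 x).1 - ∑ k ∈ Finset.range (n + 1), (k.factorial : ℝ)⁻¹ *
        iterBracket g k (fun x : Phase d => lam * freeHam x.1) x) +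
      (P (Φ 1 x) - ∑ k ∈ Finset.range n, (k.factorial : ℝ)⁻¹ * iterBracket g k P x) := by
    intro x
    rw [hE, lieTaylor, Finset.sum_add_distrib, Finset.sum_range_succ']
    simp only [hit, iterBracket_zero]
    simp
    ring
  refine ⟨fun x => ?_, fun x y => ?_⟩
  · rw [hEq]
    exact (abs_add_le _ _).trans (add_le_add (h1 x) (h3 x))
  · rw [hEq x, hEq y, add_sub_add_comm]
    refine (abs_add_le _ _).trans ((add_le_add (h2 x y) (h4 x y)).trans_eq ?_)
    ring

end LieSeries

/-! ### Bounds for Hamiltonian vector fields. -/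

section HamFieldBounds

variable {d : ℕ}

theorem norm_le_sum_abs (x : ActionSpace d) : ‖x‖ ≤ ∑ i, |x i| := by
  conv_lhs => rw [← (EuclideanSpace.basisFun (Fin d) ℝ).sum_repr x]
  refine (norm_sum_le _ _).trans (Finset.sum_le_sum fun i _ => ?_)
  simp [norm_smul]

theorem norm_phase_le {x : Phase d} {B : ℝ} (h1 : ∀ i, |x.1 i| ≤ B)
    (h2 : ∀ i, |x.2 i| ≤ B) : ‖x‖ ≤ d * B := by
  refine norm_prod_le_iff.2 ⟨?_, ?_⟩
  · exact (norm_le_sum_abs _).trans ((Finset.sum_le_sum fun i _ => h1 i).trans (by simp))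
  · exact (norm_le_sum_abs _).trans ((Finset.sum_le_sum fun i _ => h2 i).trans (by simp))

theorem norm_hamField_le {H : Phase d → ℝ} {x : Phase d} {B : ℝ}
    (h1 : ∀ i, |dP i H x| ≤ B) (h2 : ∀ i, |dQ i H x| ≤ B) : ‖hamField H x‖ ≤ d * B :=
  norm_phase_le (fun i => by simpa [hamField] using h2 i) fun i => by simpa [hamField] using h1 i

theorem PeriodicSymbol.exists_hamField_bounds {ι : Type*} {w : ι → ℝ} (hw : ∀ i, 0 ≤ w i)
    {g : ι → Phase d → ℝ} (hg : PeriodicSymbol w g) : ∃ C : ℝ, 0 ≤ C ∧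
      (∀ i x, ‖hamField (g i) x‖ ≤ C * w i) ∧
      ∀ i x y, ‖hamField (g i) x - hamField (g i) y‖ ≤ C * w i * ‖x - y‖ := by
  choose A hA using fun j => (hg.dP j).bound []
  choose B hB using fun j => (hg.dQ j).bound []
  choose A' hA0' hA' using fun j => (hg.dP j).exists_norm_fderiv_le hw
  choose B' hB0' hB' using fun j => (hg.dQ j).exists_norm_fderiv_le hw
  set C : ℝ := ∑ j, (|A j| + |B j| + A' j + B' j) with hC
  have hCj : ∀ j, |A j| + |B j| + A' j + B' j ≤ C := fun j =>
    Finset.single_le_sum (f := fun j => |A j| + |B j| + A' j + B' j)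
      (fun j _ => by have := hA0' j; have := hB0' j; positivity) (Finset.mem_univ j)
  have hC0 : 0 ≤ C := Finset.sum_nonneg fun j _ => by
    have := hA0' j; have := hB0' j; positivity
  have hmv : ∀ {f : Phase d → ℝ} {K : ℝ}, Differentiable ℝ f → (∀ x, ‖fderiv ℝ f x‖ ≤ K) →
      ∀ x y, |f x - f y| ≤ K * ‖x - y‖ := fun hf hK x y =>
    convex_univ.norm_image_sub_le_of_norm_fderiv_le (𝕜 := ℝ) (fun x _ => hf x) (fun x _ => hK x)
      (Set.mem_univ y) (Set.mem_univ x)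
  refine ⟨d * C, by positivity, fun i x => ?_, fun i x y => ?_⟩
  · have := hw i
    rw [mul_assoc]
    refine norm_hamField_le (fun j => (hA j i x).trans ?_)
      fun j => (hB j i x).trans ?_ <;>
    · have := hCj j; have := hA0' j; have := hB0' j
      gcongr
      linarith [le_abs_self (A j), le_abs_self (B j), abs_nonneg (A j), abs_nonneg (B j)]
  · have := hw i
    have hj : ∀ j, A' j * w i ≤ C * w i ∧ B' j * w i ≤ C * w i := fun j => by
      have := hCj j; have := hA0' j; have := hB0' j
      constructor <;> gcongr <;> linarith [abs_nonneg (A j), abs_nonneg (B j)]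
    have h1 := fun j => hmv (((hg.dP j).smooth i).differentiable_top)
      (fun x => (hA' j i x).trans (hj j).1) x y
    have h2 := fun j => hmv (((hg.dQ j).smooth i).differentiable_top)
      (fun x => (hB' j i x).trans (hj j).2) x y
    rw [mul_assoc (d : ℝ), mul_assoc (d : ℝ)]
    refine norm_phase_le (fun j => ?_) fun j => ?_
    · have : (hamField (g i) x - hamField (g i) y).1 j = -(_root_.dQ j (g i) x - _root_.dQ j (g i) y) := by
        simp [hamField]
        ring
      rw [this, abs_neg]
      exact h2 j
    · have : (hamField (g i) x - hamField (g i) y).2 j = _root_.dP j (g i) x - _root_.dP j (g i) y := by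
        simp [hamField]
      rw [this]
      exact h1 j

end HamFieldBounds

/-! ### Undoing the rescaling of the actions. -/

section Rescale

variable {d : ℕ}

theorem scaleMap_scaleMap_inv {c : ℝ} (hc : c ≠ 0) (x : Phase d) :
    scaleMap d c (scaleMap d c⁻¹ x) = x := by
  ext <;> simp [smul_smul, hc]

theorem scaleMap_inv_scaleMap {c : ℝ} (hc : c ≠ 0) (x : Phase d) :
    scaleMap d c⁻¹ (scaleMap d c x) = x := by
  ext <;> simp [smul_smul, hc]

theorem sympForm_scaleMap (c : ℝ) (u v : Phase d) :
    sympForm (scaleMap d c u) (scaleMap d c v) = c * sympForm u v := by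
  simp only [sympForm, scaleMap_apply, Finset.mul_sum]
  refine Finset.sum_congr rfl fun i _ => ?_
  simp
  ring

theorem isCanonical_id : IsCanonical (fun x : Phase d => x) where
  smooth := contDiff_id
  descends _ _ h := h
  inverse := ⟨fun x => x, contDiff_id, fun _ _ h => h, fun _ => rfl, fun _ => rfl⟩
  symplectic x u v := by simp

/-- Scaling the actions multiplies the symplectic form by c, and the inverse scaling by c⁻¹, so
conjugation preserves it. -/
theorem IsCanonical.conj_scaleMap {T : Phase d → Phase d} (hT : IsCanonical T) {c : ℝ}
    (hc : c ≠ 0) : IsCanonical fun x => scaleMap d c (T (scaleMap d c⁻¹ x)) := by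
  have hsm : ∀ {S : Phase d → Phase d}, ContDiff ℝ ∞ S →
      ContDiff ℝ ∞ fun x => scaleMap d c (S (scaleMap d c⁻¹ x)) := fun hS =>
    (scaleMap d c).contDiff.comp (hS.comp (scaleMap d c⁻¹).contDiff)
  have hdesc : ∀ {S : Phase d → Phase d}, (∀ x y, SamePoint x y → SamePoint (S x) (S y)) →
      ∀ x y, SamePoint x y →
        SamePoint (scaleMap d c (S (scaleMap d c⁻¹ x))) (scaleMap d c (S (scaleMap d c⁻¹ y))) :=
    fun hS x y h => (hS _ _ (h.scaleMap _)).scaleMap _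
  obtain ⟨S, hS, hSd, hl, hr⟩ := hT.inverse
  refine ⟨hsm hT.smooth, hdesc hT.descends,
    ⟨fun x => scaleMap d c (S (scaleMap d c⁻¹ x)), hsm hS, hdesc hSd, fun x => ?_, fun x => ?_⟩,
    fun x u v => ?_⟩
  · simp only [scaleMap_inv_scaleMap hc, hl _, scaleMap_scaleMap_inv hc]
  · simp only [scaleMap_inv_scaleMap hc, hr _, scaleMap_scaleMap_inv hc]
  · have hT' : Differentiable ℝ T := hT.smooth.differentiable_top
    have hd : HasFDerivAt (fun x => scaleMap d c (T (scaleMap d c⁻¹ x)))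
        ((scaleMap d c).comp ((fderiv ℝ T (scaleMap d c⁻¹ x)).comp (scaleMap d c⁻¹))) x :=
      (scaleMap d c).hasFDerivAt.comp x
        ((hT' _).hasFDerivAt.comp x (scaleMap d c⁻¹).hasFDerivAt)
    rw [hd.fderiv]
    simp only [ContinuousLinearMap.comp_apply]
    rw [sympForm_scaleMap, hT.symplectic, sympForm_scaleMap, ← mul_assoc, mul_inv_cancel₀ hc,
      one_mul]

/-- The coefficients of a trigonometric polynomial are its Fourier coefficients by orthogonality,
and |p·k| ≤ 1 in the rescaled actions means |p·k| ≤ ε^δ in the original ones. -/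
theorem IsResonant.isInNormalForm {δ β ε : ℝ} (hε : 0 < ε) {Z : Phase d → ℝ}
    (hZ : IsResonant (cutoffK β ε) Z) :
    IsInNormalForm δ β ε fun x => Z (scaleMap d (ε ^ δ)⁻¹ x) := by
  obtain ⟨a, ha, hsupp⟩ := hZ
  have hpos : 0 < ε ^ δ := Real.rpow_pos_of_pos hε δ
  have hf : ∀ k p, fourierCoef (fun x => Z (scaleMap d (ε ^ δ)⁻¹ x)) k p =
      if k ∈ modes d (cutoffK β ε) then a k ((ε ^ δ)⁻¹ • p) else 0 := fun k p =>
    fourierCoef_of_eq_sum (a := fun k => a k ((ε ^ δ)⁻¹ • p)) (fun q => ha _ q) k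
  refine ⟨fun p q => (ha _ q).trans (Finset.sum_congr rfl fun k hk => ?_), fun k _ p hk => ?_⟩
  · rw [hf, if_pos hk]
    rfl
  · rw [hf] at hk
    have h1 := hsupp k _ (ite_ne_right_iff.1 hk).2
    rw [dotZ_smul, abs_mul, abs_of_pos (inv_pos.2 hpos), inv_mul_le_iff₀ hpos, mul_one] at h1
    exact h1

theorem isInNormalForm_zero (δ β ε : ℝ) : IsInNormalForm δ β ε fun _ : Phase d => 0 := by
  have hf : ∀ k p, fourierCoef (fun _ : Phase d => 0) k p = 0 := fun k p => by simp [fourierCoef]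
  exact ⟨fun p q => by simp [hf], fun k _ p hk => absurd (hf k p) hk⟩

theorem one_div_rpow_lt_cutoffK (β ε : ℝ) : 1 / ε ^ β < cutoffK β ε := by
  unfold cutoffK
  push_cast
  exact Nat.lt_floor_add_one _

theorem freeHam_smul (c : ℝ) (p : ActionSpace d) : freeHam (c • p) = c ^ 2 * freeHam p := by
  simp only [freeHam, Finset.mul_sum]
  refine Finset.sum_congr rfl fun i _ => ?_
  simp
  ring

theorem PeriodicSymbol.restrict {ι κ : Type*} {w : ι → ℝ} {f : ι → Phase d → ℝ}
    (hf : PeriodicSymbol w f) (e : κ → ι) :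
    PeriodicSymbol (fun k => w (e k)) fun k => f (e k) :=
  ⟨hf.toUniformSymbol.restrict e, fun k => hf.periodic (e k)⟩

theorem UniformSymbol.exists_bound {ι : Type*} {w : ι → ℝ} (hw : ∀ i, 0 ≤ w i)
    {f : ι → Phase d → ℝ} (hf : UniformSymbol w f) :
    ∃ C : ℝ, 0 ≤ C ∧ (∀ i x, |f i x| ≤ C * w i) ∧ ∀ i x, ‖fderiv ℝ (f i) x‖ ≤ C * w i := by
  obtain ⟨A, hA⟩ := hf.bound []
  obtain ⟨B, hB0, hB⟩ := hf.exists_norm_fderiv_le hw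
  refine ⟨max A B, hB0.trans (le_max_right _ _), fun i x => (hA i x).trans ?_,
    fun i x => (hB i x).trans ?_⟩
  · exact mul_le_mul_of_nonneg_right (le_max_left _ _) (hw i)
  · exact mul_le_mul_of_nonneg_right (le_max_right _ _) (hw i)

theorem abs_sub_le_of_norm_fderiv_le {f : Phase d → ℝ} {K : ℝ} (hf : Differentiable ℝ f)
    (hK : ∀ x, ‖fderiv ℝ f x‖ ≤ K) (x y : Phase d) : |f x - f y| ≤ K * ‖x - y‖ :=
  convex_univ.norm_image_sub_le_of_norm_fderiv_le (𝕜 := ℝ) (fun x _ => hf x) (fun x _ => hK x)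
    (Set.mem_univ y) (Set.mem_univ x)

end Rescale

/-! ### The normal form in rescaled variables. -/

section Existence

variable {d : ℕ}

/-- The normal form in the rescaled variables: smooth canonical maps close to the identity. -/
theorem exists_scaled_normal_form {δ β ε₀ : ℝ} (hδ' : δ < 1 / 2) (hβ : 0 < β)
    (hε₀ : 0 < ε₀) {P : ℝ → Phase d → ℝ} (hP : IsSymbol δ ε₀ 1 P) (N : ℕ) :
    ∃ ε₁ : ℝ, 0 < ε₁ ∧ ε₁ ≤ ε₀ ∧ ∃ (Φ : Set.Ioo (0 : ℝ) ε₁ → Phase d → Phase d)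
      (Z : ℕ → Set.Ioo (0 : ℝ) ε₁ → Phase d → ℝ) (R : Set.Ioo (0 : ℝ) ε₁ → Phase d → ℝ) (C : ℝ),
      0 ≤ C ∧ (∀ ε, IsCanonical (Φ ε)) ∧ (∀ ε x, ‖Φ ε x - x‖ ≤ C * (ε : ℝ) ^ (1 - 2 * δ)) ∧
      (∀ m < N, PeriodicSymbol (fun ε : Set.Ioo (0 : ℝ) ε₁ =>
        (ε : ℝ) ^ (1 + (1 - 2 * δ) * m)) (Z m) ∧
        ∀ ε : Set.Ioo (0 : ℝ) ε₁, IsResonant (cutoffK β ε) (Z m ε)) ∧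
      (∀ ε, IsSmoothOnPhase (R ε)) ∧
      (∀ ε x, |R ε x| ≤ C * (ε : ℝ) ^ (1 + N * (1 - 2 * δ))) ∧
      (∀ ε x, ‖fderiv ℝ (R ε) x‖ ≤ C * (ε : ℝ) ^ (1 + N * (1 - 2 * δ))) ∧
      ∀ (ε : Set.Ioo (0 : ℝ) ε₁) x, fullHam P ε (scaleMap d ((ε : ℝ) ^ δ) (Φ ε x)) =
        ((ε : ℝ) ^ δ) ^ 2 * freeHam x.1 + ∑ m ∈ Finset.range N, Z m ε x + R ε x := by
  set a : ℝ := 1 - 2 * δ with ha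
  have ha0 : 0 < a := by linarith
  set ε₂ : ℝ := min 1 ε₀ with hε₂
  have hε₂0 : 0 < ε₂ := lt_min one_pos hε₀
  let ι := Set.Ioo (0 : ℝ) ε₂
  have hlt1 : ∀ i : ι, (i : ℝ) ≤ 1 := fun i => i.2.2.le.trans (min_le_left _ _)
  have hPu : PeriodicSymbol (fun ε : ι => (ε : ℝ) ^ (1 : ℝ))
      fun ε x => P ε (scaleMap d ((ε : ℝ) ^ δ) x) :=
    ⟨hP.uniformSymbol (min_le_right _ _), fun i x y h =>
      (hP.1 i i.2.1 (i.2.2.trans_le (min_le_right _ _))).2 _ _ (h.scaleMap _)⟩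
  set lam : ι → ℝ := fun ε => ((ε : ℝ) ^ δ) ^ 2 with hlam_def
  have hlam : ∀ i, 0 < lam i := fun i => pow_pos (Real.rpow_pos_of_pos i.2.1 δ) 2
  set h : ι → ℝ := fun ε => (ε : ℝ) ^ a with hh
  set e : ι → ℝ := fun ε => (ε : ℝ) ^ (1 : ℝ) with he_def
  have h0 : ∀ i, 0 ≤ h i := fun i => Real.rpow_nonneg i.2.1.le _
  have h1 : ∀ i, h i ≤ 1 := fun i => Real.rpow_le_one i.2.1.le (hlt1 i) ha0.le
  have he : ∀ i, e i = lam i * h i := fun i => by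
    simp only [e, lam, h]
    rw [← Real.rpow_natCast, ← Real.rpow_mul i.2.1.le, ← Real.rpow_add i.2.1]
    congr 1
    simp [ha]
    ring
  have he0 : ∀ i, 0 ≤ e i := fun i => Real.rpow_nonneg i.2.1.le _
  have hpow : ∀ (m : ℕ) i, e i * h i ^ m = (i : ℝ) ^ (1 + a * m) := fun m i => by
    simp only [e, h]
    rw [← Real.rpow_natCast, ← Real.rpow_mul i.2.1.le, ← Real.rpow_add i.2.1]
  -- With βM ≥ a, the tail factor K^(-M) ≤ ε^(βM) is at most h = ε^a.
  obtain ⟨M, hM⟩ := exists_nat_ge (a / β)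
  have hK : ∀ i : ι, 0 < cutoffK β i := fun i => Nat.succ_pos _
  have hKM : ∀ i : ι, ((cutoffK β i : ℕ) : ℝ)⁻¹ ^ M ≤ h i := fun i => by
    have hb : 0 < (i : ℝ) ^ β := Real.rpow_pos_of_pos i.2.1 β
    have h2 : ((cutoffK β i : ℕ) : ℝ)⁻¹ ≤ (i : ℝ) ^ β := by
      have := inv_anti₀ (by positivity) (one_div_rpow_lt_cutoffK β i).le
      rwa [one_div, inv_inv] at this
    refine (pow_le_pow_left₀ (by positivity) h2 M).trans ?_
    rw [← Real.rpow_natCast, ← Real.rpow_mul i.2.1.le]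
    refine Real.rpow_le_rpow_of_exponent_ge i.2.1 (hlt1 i) ?_
    rw [div_le_iff₀ hβ] at hM
    linarith
  obtain ⟨g, Y, Z, hg, hY, hYg, hZ, hD⟩ :=
    exists_generator hlam h0 h1 he hK hKM hPu N N le_rfl
  obtain ⟨B, hB0, hB, hBlip⟩ := hg.exists_hamField_bounds h0
  have hpos : ∀ j i, 0 ≤ e i * h i ^ j := fun j i => mul_nonneg (he0 i) (pow_nonneg (h0 i) j)
  obtain ⟨A₁, hA₁0, hA₁, hA₁'⟩ := (hY.iterBracket hg N).toUniformSymbol.exists_bound (hpos N)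
  obtain ⟨A₂, hA₂0, hA₂, hA₂'⟩ := (hPu.iterBracket hg N).toUniformSymbol.exists_bound (hpos N)
  obtain ⟨A₃, hA₃0, hA₃, hA₃'⟩ := hD.toUniformSymbol.exists_bound (hpos N)
  -- Chosen so that B ε^a ≤ 1/2 for ε ≤ t, the Lipschitz constant required for the flow.
  set t : ℝ := (2 * (B + 1))⁻¹ ^ a⁻¹ with ht
  have ht0 : 0 < t := Real.rpow_pos_of_pos (by positivity) _
  have hta : t ^ a = (2 * (B + 1))⁻¹ := by
    rw [ht, ← Real.rpow_mul (by positivity), inv_mul_cancel₀ ha0.ne', Real.rpow_one]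
  set ε₁ : ℝ := min ε₂ t with hε₁
  have hε₁0 : 0 < ε₁ := lt_min hε₂0 ht0
  let r : Set.Ioo (0 : ℝ) ε₁ → ι := fun ε => ⟨ε, ε.2.1, ε.2.2.trans_le (min_le_left _ _)⟩
  have hsmall : ∀ ε, B * h (r ε) ≤ 2⁻¹ := fun ε => by
    have h2 : h (r ε) ≤ t ^ a :=
      Real.rpow_le_rpow ε.2.1.le (ε.2.2.le.trans (min_le_right _ _)) ha0.le
    rw [hta] at h2
    calc B * h (r ε) ≤ (B + 1) * (2 * (B + 1))⁻¹ := by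
          gcongr
          · exact h0 _
          · linarith
      _ = 2⁻¹ := by field_simp
  have hflow : ∀ ε, LipschitzWith 2⁻¹ (hamField (g (r ε))) := fun ε => by
    refine LipschitzWith.of_dist_le_mul fun x y => ?_
    rw [dist_eq_norm, dist_eq_norm]
    refine (hBlip (r ε) x y).trans ?_
    have := hsmall ε
    push_cast
    gcongr
  choose Φ hΦ0 hΦ hΦlip hΦc using fun ε => exists_hamiltonian_flow (hg.isSmooth (r ε)) (hflow ε)
  -- Defining the remainder as the difference makes its smoothness and the conjugation identity
  -- immediate. It is estimated as the Lie series error `E` plus the final defect of the generator.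
  set R : Set.Ioo (0 : ℝ) ε₁ → Phase d → ℝ := fun ε x =>
    fullHam P ε (scaleMap d ((ε : ℝ) ^ δ) (Φ ε 1 x)) -
      (((ε : ℝ) ^ δ) ^ 2 * freeHam x.1 + ∑ m ∈ Finset.range N, Z m (r ε) x) with hR
  set E : Set.Ioo (0 : ℝ) ε₁ → Phase d → ℝ := fun ε x =>
    lam (r ε) * freeHam (Φ ε 1 x).1 + P ε (scaleMap d ((ε : ℝ) ^ δ) (Φ ε 1 x)) -
      lam (r ε) * freeHam x.1 -
      lieTaylor N (g (r ε)) (Y (r ε)) (fun x => P ε (scaleMap d ((ε : ℝ) ^ δ) x)) x with hE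
  have hRE : ∀ ε x, R ε x = E ε x + (lieTaylor N (g (r ε)) (Y (r ε))
      (fun x => P ε (scaleMap d ((ε : ℝ) ^ δ) x)) x - ∑ m ∈ Finset.range N, Z m (r ε) x) := by
    intro ε x
    simp only [R, E, fullHam, scaleMap_apply, freeHam_smul, lam, r]
    ring
  have hEb := fun ε => abs_lieTaylor_error_le (hg.smooth (r ε)) (hΦ0 ε) (hΦ ε) (hΦlip ε)
    (hPu.smooth (r ε)) (hYg (r ε)) N (mul_nonneg hA₁0 (hpos N (r ε)))
    (mul_nonneg hA₂0 (hpos N (r ε))) (hA₁ (r ε)) (hA₁' (r ε)) (hA₂ (r ε)) (hA₂' (r ε))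
    (E := E ε) fun x => rfl
  have hmN : ∀ ε, e (r ε) * h (r ε) ^ N = (ε : ℝ) ^ (1 + N * a) := fun ε => by
    rw [hpow, mul_comm a]
  set C : ℝ := 2 * (A₁ + A₂) + A₃ + B with hC
  have hRsm : ∀ ε, IsSmoothOnPhase (R ε) := by
    intro ε
    have hZs : ContDiff ℝ ∞ fun x => ∑ m ∈ Finset.range N, Z m (r ε) x :=
      ContDiff.sum fun m hm => (hZ m (Finset.mem_range.1 hm)).1.smooth (r ε)
    have hΦs := (hΦc ε).smooth
    have hPε := hP.1 ε ε.2.1 (ε.2.2.trans_le ((min_le_left _ _).trans (min_le_right _ _)))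
    refine ⟨?_, fun x y hxy => ?_⟩
    · have hfull : ContDiff ℝ ∞ (fullHam P ε) := contDiff_freeHam.add hPε.1
      exact (hfull.comp ((scaleMap d _).contDiff.comp hΦs)).sub
        ((contDiff_const.mul contDiff_freeHam).add hZs)
    · have h2 := ((hΦc ε).descends x y hxy).scaleMap ((ε : ℝ) ^ δ)
      have h3 : ∑ m ∈ Finset.range N, Z m (r ε) x = ∑ m ∈ Finset.range N, Z m (r ε) y :=
        Finset.sum_congr rfl fun m hm => (hZ m (Finset.mem_range.1 hm)).1.periodic _ x y hxy
      simp only [R, fullHam]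
      rw [hPε.2 _ _ h2, h2.1, h3, hxy.1]
  refine ⟨ε₁, hε₁0, (min_le_left _ _).trans (min_le_right _ _), fun ε => Φ ε 1,
    fun m ε => Z m (r ε), R, C, by positivity, hΦc, fun ε x => ?_, fun m hm => ?_, hRsm,
    fun ε x => ?_, fun ε x => ?_, fun ε x => ?_⟩
  · have h2 := (convex_Icc (0 : ℝ) 1).norm_image_sub_le_of_norm_hasDerivWithin_le (hΦ ε x)
      (fun s _ => hB (r ε) _) (Set.left_mem_Icc.2 zero_le_one) (Set.right_mem_Icc.2 zero_le_one)
    rw [hΦ0, sub_zero, norm_one, mul_one] at h2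
    refine h2.trans ?_
    have := h0 (r ε)
    exact mul_le_mul_of_nonneg_right (by rw [hC]; linarith) this
  · refine ⟨?_, fun ε => (hZ m hm).2 (r ε)⟩
    have := (hZ m hm).1.restrict r
    simp only [hpow] at this
    exact this
  · rw [hRE, ← hmN]
    have h2 := hpos N (r ε)
    calc _ ≤ A₁ * (e (r ε) * h (r ε) ^ N) + A₂ * (e (r ε) * h (r ε) ^ N) +
          A₃ * (e (r ε) * h (r ε) ^ N) :=
        (abs_add_le _ _).trans (add_le_add ((hEb ε).1 x) (hA₃ (r ε) x))
      _ = (A₁ + A₂ + A₃) * (e (r ε) * h (r ε) ^ N) := by ring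
      _ ≤ _ := by
        gcongr
        rw [hC]
        linarith
  · rw [← hmN]
    have h2 := hpos N (r ε)
    -- The derivative bound is read off from a Lipschitz constant.
    have h3 : LipschitzWith (Real.toNNReal (C * (e (r ε) * h (r ε) ^ N))) (R ε) := by
      refine LipschitzWith.of_dist_le_mul fun x y => ?_
      rw [Real.coe_toNNReal _ (by positivity), dist_eq_norm, dist_eq_norm, hRE, hRE,
        add_sub_add_comm]
      refine (norm_add_le _ _).trans ((add_le_add ((hEb ε).2 x y)
        (abs_sub_le_of_norm_fderiv_le (hD.smooth (r ε)).differentiable_top (hA₃' (r ε)) x y)).trans ?_)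
      rw [← add_mul]
      gcongr
      rw [hC]
      nlinarith
    have h4 := norm_fderiv_le_of_lipschitz ℝ h3 (x₀ := x)
    rwa [Real.coe_toNNReal _ (by positivity)] at h4
  · simp only [R]
    ring

end Existence

/-! ### The transformation in the original variables. -/

section Transformation

variable {d : ℕ}

/-- For ε < ε₁ the rescaled construction is conjugated back. For larger ε the identity works with
zero normal form and remainder P, since ε is then bounded away from 0 and the order of a bound is
immaterial. -/
theorem exists_normalizing_transformation {δ β ε₀ : ℝ} (hδ' : δ < 1 / 2) (hβ : 0 < β)
    (hε₀ : 0 < ε₀) {P : ℝ → Phase d → ℝ} (hP : IsSymbol δ ε₀ 1 P) (N : ℕ) :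
    ∃ T : ℝ → Phase d → Phase d, Normalizes δ β ε₀ N P T ∧ IsNearIdentity δ ε₀ T := by
  classical
  obtain ⟨ε₁, hε₁, hle, Φ, Z, R, C, hC0, hΦc, hΦ, hZ, hRs, hR, hR', hH⟩ :=
    exists_scaled_normal_form (β := β) hδ' hβ hε₀ hP N
  let T : ℝ → Phase d → Phase d := fun ε x =>
    if h : ε ∈ Set.Ioo (0 : ℝ) ε₁ then
      scaleMap d (ε ^ δ) (Φ ⟨ε, h⟩ (scaleMap d (ε ^ δ)⁻¹ x)) else x
  have hT : ∀ ε (h : ε ∈ Set.Ioo (0 : ℝ) ε₁), T ε = fun x =>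
      scaleMap d (ε ^ δ) (Φ ⟨ε, h⟩ (scaleMap d (ε ^ δ)⁻¹ x)) := fun ε h => by
    funext x; simp only [T, h, dite_true]
  have hT' : ∀ ε, ε ∉ Set.Ioo (0 : ℝ) ε₁ → T ε = fun x => x := fun ε h => by
    funext x; simp only [T, h, dite_false]
  refine ⟨T, ⟨fun ε h0 h1 => ?_, fun j => unscale δ ε₁ (Z (j - 1)) fun _ _ => 0,
    unscale δ ε₁ R P, fun j hj => ⟨?_, fun ε h0 h1 => ?_⟩,
    ⟨fun ε h0 h1 => isSmoothOnPhase_unscale hRs hP.1 h0 h1, fun α β hαβ => ?_⟩,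
    fun ε h0 h1 x => ?_⟩, ⟨C, fun ε h0 h1 x j => ?_⟩, fun m f hf => ?_⟩
  · by_cases h : ε ∈ Set.Ioo (0 : ℝ) ε₁
    · rw [hT ε h]
      exact (hΦc _).conj_scaleMap (Real.rpow_pos_of_pos h0 δ).ne'
    · rw [hT' ε h]
      exact isCanonical_id
  · obtain ⟨h1, h2⟩ := Finset.mem_Icc.1 hj
    have hz := (hZ (j - 1) (by omega)).1
    rw [Nat.cast_sub h1, Nat.cast_one] at hz
    exact hz.toUniformSymbol.isSymbol_unscale hε₁ hz.periodic
  · beta_reduce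
    by_cases h : ε ∈ Set.Ioo (0 : ℝ) ε₁
    · rw [unscale_of_mem _ _ h]
      obtain ⟨h1, h2⟩ := Finset.mem_Icc.1 hj
      exact ((hZ (j - 1) (by omega)).2 ⟨ε, h⟩).isInNormalForm h0
    · rw [unscale_of_notMem _ _ h]
      exact isInNormalForm_zero δ β ε
  · refine symbolBound_unscale hε₁ (fun ε => (hRs ε).1) ⟨C, fun ε x => ?_⟩ (hP.2 α β)
    have hsingle : ∀ i : Fin d, ‖((EuclideanSpace.single i 1, 0) : Phase d)‖ ≤ 1 := fun i => by
      simp [Prod.norm_def]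
    have hsingle' : ∀ i : Fin d, ‖((0, EuclideanSpace.single i 1) : Phase d)‖ ≤ 1 := fun i => by
      simp [Prod.norm_def]
    have hd : ∀ v : Phase d, ‖v‖ ≤ 1 →
        |fderiv ℝ (R ε) x v| ≤ C * (ε : ℝ) ^ (1 + N * (1 - 2 * δ)) := fun v hv => by
      refine ((fderiv ℝ (R ε) x).le_opNorm v).trans ?_
      exact (mul_le_of_le_one_right (norm_nonneg _) hv).trans (hR' ε x)
    match α, β, hαβ with
    | [], [], _ => exact hR ε x
    | [i], [], _ => exact hd _ (hsingle i)
    | [], [i], _ => exact hd _ (hsingle' i)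
    | _ :: _ :: _, _, h => simp at h; omega
    | _, _ :: _ :: _, h => simp at h; omega
    | _ :: _, _ :: _, h => simp at h; omega
  · by_cases h : ε ∈ Set.Ioo (0 : ℝ) ε₁
    · have hpos : 0 < ε ^ δ := Real.rpow_pos_of_pos h0 δ
      have h2 := hH ⟨ε, h⟩ (scaleMap d (ε ^ δ)⁻¹ x)
      rw [hT ε h]
      simp only [unscale_of_mem _ _ h]
      refine h2.trans ?_
      simp only [scaleMap_apply, freeHam_smul]
      have hsum : ∑ j ∈ Finset.Icc 1 N, Z (j - 1) ⟨ε, h⟩ ((ε ^ δ)⁻¹ • x.1, x.2) =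
          ∑ m ∈ Finset.range N, Z m ⟨ε, h⟩ ((ε ^ δ)⁻¹ • x.1, x.2) := by
        rw [Finset.range_eq_Ico, ← Finset.Ico_succ_right_eq_Icc]
        simp [Finset.sum_Ico_eq_sum_range]
      rw [hsum]
      field_simp
    · rw [hT' ε h]
      simp only [unscale_of_notMem _ _ h]
      simp [fullHam]
  · by_cases h : ε ∈ Set.Ioo (0 : ℝ) ε₁
    · have hpos : 0 < ε ^ δ := Real.rpow_pos_of_pos h0 δ
      set y := scaleMap d (ε ^ δ)⁻¹ x with hy
      have hx : x.1 = ε ^ δ • y.1 := by simp [hy, smul_smul, hpos.ne']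
      have h2 := hΦ ⟨ε, h⟩ y
      have h3 : |(Φ ⟨ε, h⟩ y).1 j - y.1 j| ≤ C * ε ^ (1 - 2 * δ) :=
        ((PiLp.norm_apply_le ((Φ ⟨ε, h⟩ y).1 - y.1) j).trans (norm_fst_le (Φ ⟨ε, h⟩ y - y))).trans h2
      rw [hT ε h, hx]
      -- Returning to the original actions contributes a factor ε^δ, so 1 - 2δ improves to 1 - δ.
      have h4 : (scaleMap d (ε ^ δ) (Φ ⟨ε, h⟩ y)).1 j - (ε ^ δ • y.1) j =
          ε ^ δ * ((Φ ⟨ε, h⟩ y).1 j - y.1 j) := by simp; ring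
      beta_reduce
      rw [← hy, h4, abs_mul, abs_of_pos hpos]
      refine (mul_le_mul_of_nonneg_left h3 hpos.le).trans_eq ?_
      rw [mul_left_comm, ← Real.rpow_add h0]
      congr 2
      ring
    · rw [hT' ε h]
      have := Real.rpow_pos_of_pos h0 (1 - δ)
      simp
      positivity
  -- In the rescaled variables the symbol has gradient O(ε^m) and points move by O(ε^(1-2δ)).
  · obtain ⟨B, hB0, hB⟩ := (hf.uniformSymbol hle).exists_norm_fderiv_le
      fun ε => Real.rpow_nonneg ε.2.1.le _
    have hfs := (hf.uniformSymbol hle).smooth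
    refine ⟨B * C, fun ε h0 h1 x => ?_⟩
    have hm := Real.rpow_pos_of_pos h0 (m + 1 - 2 * δ)
    by_cases h : ε ∈ Set.Ioo (0 : ℝ) ε₁
    · have hpos : 0 < ε ^ δ := Real.rpow_pos_of_pos h0 δ
      set y := scaleMap d (ε ^ δ)⁻¹ x with hy
      have hx : x = scaleMap d (ε ^ δ) y := (scaleMap_scaleMap_inv hpos.ne' x).symm
      have h2 := abs_sub_le_of_norm_fderiv_le (hfs ⟨ε, h⟩).differentiable_top (hB ⟨ε, h⟩)
        (Φ ⟨ε, h⟩ y) y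
      rw [hT ε h]
      beta_reduce
      rw [← hy, hx]
      refine h2.trans ?_
      have h5 := Real.rpow_nonneg h0.le m
      calc B * ε ^ m * ‖Φ ⟨ε, h⟩ y - y‖ ≤ B * ε ^ m * (C * ε ^ (1 - 2 * δ)) := by
            gcongr
            exact hΦ ⟨ε, h⟩ y
        _ = B * C * (ε ^ m * ε ^ (1 - 2 * δ)) := by ring
        _ = _ := by rw [← Real.rpow_add h0]; congr 2; ring
    · rw [hT' ε h]
      simp
      positivity

end Transformation

/-! ### Global existence of orbits. -/

section GlobalOrbits

/-- A `C^1` vector field of linear growth has global integral curves. -/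
theorem exists_global_integralCurve {E : Type*} [NormedAddCommGroup E] [NormedSpace ℝ E]
    [FiniteDimensional ℝ E] {X : E → E} (hX : ContDiff ℝ 1 X) {B : ℝ} (hB : 0 ≤ B)
    (hgrow : ∀ x, ‖X x‖ ≤ ‖x‖ + B) (x₀ : E) :
    ∃ γ : ℝ → E, γ 0 = x₀ ∧ ∀ t, HasDerivAt γ (X (γ t)) t := by
  have : CompleteSpace E := FiniteDimensional.complete ℝ E
  have hv : ContMDiff (modelWithCornersSelf ℝ E) (modelWithCornersSelf ℝ E).tangent 1
      (fun x => (⟨x, X x⟩ : TangentBundle (modelWithCornersSelf ℝ E) E)) :=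
    contMDiff_vectorSpace_iff_contDiff.2 hX
  have hloc : ∀ x : E, ∃ γ : ℝ → E, γ 0 = x ∧
      IsMIntegralCurveOn (I := modelWithCornersSelf ℝ E) γ X (Set.Ioo (-(1 / 2)) (1 / 2)) := by
    intro x
    -- On the ball of this radius the field is at most 2a, so the existence time a/(2a) = 1/2 is the
    -- same at every point and local solutions can be continued indefinitely.
    set a : ℝ := ‖x‖ + B + 1 with ha
    have ha0 : 0 ≤ a := by positivity
    have hb : ∀ y ∈ Metric.closedBall x (⟨a, ha0⟩ : NNReal),
        ‖X y‖ ≤ (⟨2 * a, by positivity⟩ : NNReal) := by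
      intro y hy
      have h1 : ‖y - x‖ ≤ a := mem_closedBall_iff_norm.1 hy
      have h2 : ‖y‖ ≤ ‖x‖ + ‖y - x‖ := by
        have := norm_add_le x (y - x)
        rwa [add_sub_cancel] at this
      refine (hgrow y).trans ?_
      change _ ≤ 2 * a
      linarith
    obtain ⟨L, hL⟩ := (isCompact_closedBall x a).exists_bound_of_continuousOn
      (hX.continuous_fderiv one_ne_zero).continuousOn
    have hlip : LipschitzOnWith (Real.toNNReal L) X
        (Metric.closedBall x (⟨a, ha0⟩ : NNReal)) := by
      refine (convex_closedBall x a).lipschitzOnWith_of_nnnorm_fderiv_le (𝕜 := ℝ)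
        (fun y _ => (hX.differentiable one_ne_zero) y) fun y hy => ?_
      rw [← NNReal.coe_le_coe, coe_nnnorm]
      exact (hL y hy).trans (Real.le_coe_toNNReal L)
    have hpl : IsPicardLindelof (fun _ => X) (tmin := -(1 / 2)) (tmax := 1 / 2)
        ⟨0, by norm_num, by norm_num⟩ x ⟨a, ha0⟩ 0 ⟨2 * a, by positivity⟩ (Real.toNNReal L) := by
      refine IsPicardLindelof.of_time_independent hb hlip ?_
      change 2 * a * max (1 / 2 - 0) (0 - -(1 / 2)) ≤ a - 0
      norm_num
      linarith
    obtain ⟨γ, hγ0, hγ⟩ := hpl.exists_eq_forall_mem_Icc_hasDerivWithinAt₀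
    refine ⟨γ, hγ0, fun t ht => ?_⟩
    exact ((hγ t (Set.Ioo_subset_Icc_self ht)).mono
      Set.Ioo_subset_Icc_self).hasFDerivWithinAt.hasMFDerivWithinAt
  obtain ⟨γ, hγ0, hγ⟩ :=
    exists_isMIntegralCurve_of_isMIntegralCurveOn hv (by norm_num : (0 : ℝ) < 1 / 2) hloc x₀
  refine ⟨γ, hγ0, fun t => ?_⟩
  have h : HasFDerivAt γ ((1 : ℝ →L[ℝ] ℝ).smulRight (X (γ t))) t :=
    hasMFDerivAt_iff_hasFDerivAt.1 (hγ t)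
  simpa using h.hasDerivAt

end GlobalOrbits

/-! ### Vectors in the span of short integer vectors. -/

section Lattice

variable {d : ℕ}

/-- An integer vector as an element of Euclidean space. -/
noncomputable def intVec (k : Fin d → ℤ) : ActionSpace d := WithLp.toLp 2 fun i => (k i : ℝ)

theorem inner_intVec (p : ActionSpace d) (k : Fin d → ℤ) : inner ℝ (intVec k) p = dotZ p k := by
  simp [intVec, dotZ, PiLp.inner_apply]

theorem inner_intVec_intVec (k l : Fin d → ℤ) :
    inner ℝ (intVec k) (intVec l) = ((∑ i, k i * l i : ℤ) : ℝ) := by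
  rw [inner_intVec]
  push_cast
  exact Finset.sum_congr rfl fun i _ => by simp [intVec, mul_comm]

theorem norm_intVec_le {K : ℕ} {k : Fin d → ℤ} (hk : k ∈ modes d K) : ‖intVec k‖ ≤ K := by
  rw [mem_modes] at hk
  refine abs_le_of_sq_le_sq' ?_ (Nat.cast_nonneg K) |>.2
  rw [← real_inner_self_eq_norm_sq, inner_intVec_intVec]
  have : (∑ i, k i * k i : ℤ) ≤ (K : ℤ) ^ 2 := by simpa [sq] using hk
  exact_mod_cast this

/-- An adjugate entry is a determinant with one row replaced by a basis vector. Scaling that row by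
x keeps all entries at most x; the factor x on the left also avoids the exponent card - 1. -/
theorem abs_adjugate_le {n : Type*} [Fintype n] [DecidableEq n] {A : Matrix n n ℝ} {x : ℝ}
    (hx : 0 ≤ x) (hA : ∀ i j, |A i j| ≤ x) (i j : n) :
    x * |A.adjugate i j| ≤ (Fintype.card n).factorial * x ^ Fintype.card n := by
  have h1 : x * |A.adjugate i j| = |(A.updateRow j (x • Pi.single i 1)).det| := by
    rw [Matrix.det_updateRow_smul, Matrix.adjugate_apply, abs_mul, abs_of_nonneg hx]
  rw [h1]
  have h2 := Matrix.det_le (A := A.updateRow j (x • Pi.single i 1)) (abv := AbsoluteValue.abs)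
    (x := x) fun k l => ?_
  · simpa using h2
  · rw [AbsoluteValue.abs_apply, Matrix.updateRow_apply]
    split_ifs with h
    · by_cases hl : l = i
      · subst hl; simp [abs_of_nonneg hx]
      · simp [hl, hx]
    · exact hA k l

/-- A vector in the span of integer vectors of length at most `K` is controlled by its inner
products with them. -/
theorem norm_le_of_mem_span_intVec {K : ℕ} {Q : Set (Fin d → ℤ)} (hQ : ∀ k ∈ Q, k ∈ modes d K)
    {w : ActionSpace d} (hw : w ∈ Submodule.span ℝ (intVec '' Q)) {l : ℝ} (hl : 0 ≤ l)
    (hwl : ∀ k ∈ Q, |dotZ w k| ≤ l) :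
    K * ‖w‖ ≤ d * d.factorial *
      (K ^ Module.finrank ℝ (Submodule.span ℝ (intVec '' Q)) * l) := by
  classical
  obtain ⟨b, hbQ, hspan, hli⟩ := exists_linearIndependent ℝ (intVec '' Q)
  have hfin : b.Finite := hli.setFinite
  have : Fintype b := hfin.fintype
  set s := Fintype.card b with hs
  have hrank : Module.finrank ℝ (Submodule.span ℝ (intVec '' Q)) = s := by
    rw [← hspan]
    have := finrank_span_eq_card hli
    rwa [Subtype.range_coe] at this
  have hsd : s ≤ d := by
    have := Submodule.finrank_le (Submodule.span ℝ (intVec '' Q))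
    rwa [hrank, finrank_euclideanSpace_fin] at this
  choose k hkQ hk using fun x : b => hbQ x.2
  set G : Matrix b b ℝ := Matrix.gram ℝ ((↑) : b → ActionSpace d) with hG
  set Gz : Matrix b b ℤ := Matrix.of fun x y => ∑ i, k x i * k y i with hGz
  have hGG : G = Gz.map (Int.castRingHom ℝ) := by
    ext x y
    simp only [hG, hGz, Matrix.gram_apply, Matrix.map_apply, Matrix.of_apply]
    rw [← hk x, ← hk y, inner_intVec_intVec]
    rfl
  have hdet0 : 0 < G.det := (Matrix.posDef_gram_of_linearIndependent hli).det_pos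
  -- The Gram determinant of independent integer vectors is a positive integer.
  have hdet : 1 ≤ G.det := by
    have h1 : G.det = (Gz.det : ℝ) := by
      rw [hGG]
      exact ((Int.castRingHom ℝ).map_det Gz).symm
    rw [h1] at hdet0 ⊢
    have h2 : 0 < Gz.det := by exact_mod_cast hdet0
    exact_mod_cast h2
  have hentry : ∀ x y, |G x y| ≤ (K : ℝ) ^ 2 := by
    intro x y
    rw [hG, Matrix.gram_apply, ← hk x, ← hk y, sq]
    refine (abs_real_inner_le_norm _ _).trans ?_
    exact mul_le_mul (norm_intVec_le (hQ _ (hkQ x))) (norm_intVec_le (hQ _ (hkQ y)))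
      (norm_nonneg _) (Nat.cast_nonneg K)
  rw [← hspan] at hw
  obtain ⟨c, hc⟩ : ∃ c : b → ℝ, ∑ x, c x • (x : ActionSpace d) = w := by
    have h1 : b = Set.range ((↑) : b → ActionSpace d) := Subtype.range_coe.symm
    rw [h1] at hw
    exact (Submodule.mem_span_range_iff_exists_fun ℝ).1 hw
  set B : b → ℝ := fun x => inner ℝ (x : ActionSpace d) w with hB
  have hGc : G.mulVec c = B := by
    ext x
    simp only [hB, Matrix.mulVec, dotProduct, ← hc, inner_sum, inner_smul_right, hG,
      Matrix.gram_apply]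
    exact Finset.sum_congr rfl fun y _ => mul_comm _ _
  have hBl : ∀ x, |B x| ≤ l := fun x => by
    simp only [hB]
    rw [← hk x, inner_intVec]
    exact hwl _ (hkQ x)
  -- Cramer's rule for the coefficients of w in the chosen basis.
  have hadj : G.det • c = G.adjugate.mulVec B := by
    rw [← hGc, Matrix.mulVec_mulVec, Matrix.adjugate_mul, Matrix.smul_mulVec, Matrix.one_mulVec]
  have hww : ‖w‖ ^ 2 = ∑ x, c x * B x := by
    rw [← real_inner_self_eq_norm_sq]
    conv_lhs => rw [← hc, sum_inner]
    exact Finset.sum_congr rfl fun x _ => by rw [real_inner_smul_left, hc]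
  have hdw : G.det * ‖w‖ ^ 2 = ∑ x, ∑ y, B x * (G.adjugate x y * B y) := by
    rw [hww, Finset.mul_sum]
    refine Finset.sum_congr rfl fun x _ => ?_
    have h1 := congrFun hadj x
    simp only [Pi.smul_apply, smul_eq_mul, Matrix.mulVec, dotProduct] at h1
    rw [← mul_assoc, h1, mul_comm, Finset.mul_sum]
  have hmain : (K * ‖w‖) ^ 2 ≤ (s : ℝ) ^ 2 * (s.factorial * ((K : ℝ) ^ 2) ^ s * l ^ 2) := by
    calc (K * ‖w‖) ^ 2 = (K : ℝ) ^ 2 * (1 * ‖w‖ ^ 2) := by ring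
      _ ≤ (K : ℝ) ^ 2 * (G.det * ‖w‖ ^ 2) := by gcongr
      _ = ∑ x, ∑ y, (K : ℝ) ^ 2 * (B x * (G.adjugate x y * B y)) := by
        rw [hdw, Finset.mul_sum]
        exact Finset.sum_congr rfl fun x _ => Finset.mul_sum _ _ _
      _ ≤ ∑ _x : b, ∑ _y : b, s.factorial * ((K : ℝ) ^ 2) ^ s * l ^ 2 := by
        refine Finset.sum_le_sum fun x _ => Finset.sum_le_sum fun y _ => ?_
        refine (le_abs_self _).trans ?_
        rw [abs_mul, abs_mul, abs_mul, abs_of_nonneg (by positivity : (0 : ℝ) ≤ (K : ℝ) ^ 2)]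
        calc (K : ℝ) ^ 2 * (|B x| * (|G.adjugate x y| * |B y|))
            = ((K : ℝ) ^ 2 * |G.adjugate x y|) * (|B x| * |B y|) := by ring
          _ ≤ (s.factorial * ((K : ℝ) ^ 2) ^ s) * (l * l) := by
            refine mul_le_mul (abs_adjugate_le (by positivity) hentry x y)
              (mul_le_mul (hBl x) (hBl y) (abs_nonneg _) hl) (by positivity) (by positivity)
          _ = _ := by ring
      _ = _ := by
        simp only [Finset.sum_const, Finset.card_univ, nsmul_eq_mul, ← hs]
        ring
  have hfac : (1 : ℝ) ≤ s.factorial := by exact_mod_cast Nat.one_le_iff_ne_zero.2 s.factorial_ne_zero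
  have hfin : (K * ‖w‖) ^ 2 ≤ (s * s.factorial * (K ^ s * l)) ^ 2 := by
    refine hmain.trans ?_
    have h1 : (s.factorial : ℝ) ≤ (s.factorial : ℝ) ^ 2 := by nlinarith
    calc (s : ℝ) ^ 2 * (s.factorial * ((K : ℝ) ^ 2) ^ s * l ^ 2)
        ≤ (s : ℝ) ^ 2 * ((s.factorial : ℝ) ^ 2 * ((K : ℝ) ^ 2) ^ s * l ^ 2) := by gcongr
      _ = _ := by ring
  rw [hrank]
  refine (abs_le_of_sq_le_sq' hfin (by positivity)).2.trans ?_
  gcongr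

end Lattice

/-! ### A continuity argument. -/

section Bootstrap

/-- A bootstrap principle for continuous functions on an interval. -/
theorem le_of_bootstrap {φ : ℝ → ℝ} {L r r' : ℝ} (hφ : ContinuousOn φ (Set.Icc 0 L))
    (h0 : φ 0 ≤ r) (hr : r' < r)
    (h : ∀ t ∈ Set.Icc 0 L, (∀ s ∈ Set.Icc 0 t, φ s ≤ r) → φ t ≤ r') :
    ∀ t ∈ Set.Icc 0 L, φ t ≤ r' := by
  have key : ∀ t ∈ Set.Icc 0 L, φ t ≤ r := by
    by_contra! hcon
    obtain ⟨t, ht, hrt⟩ := hcon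
    have hivt : ∀ s ∈ Set.Icc 0 L, r ≤ φ s → ∃ u ∈ Set.Icc 0 s, φ u = r := fun s hs hrs =>
      intermediate_value_Icc hs.1 (hφ.mono (Set.Icc_subset_Icc_right hs.2)) ⟨h0, hrs⟩
    have hcl : IsCompact (Set.Icc 0 L ∩ φ ⁻¹' {r}) :=
      isCompact_Icc.of_isClosed_subset
        (hφ.preimage_isClosed_of_isClosed isClosed_Icc isClosed_singleton) Set.inter_subset_left
    obtain ⟨u, hu, hur⟩ := hivt t ht hrt.le
    -- At the first time the value r is attained, the hypothesis holds up to that time and forces a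
    -- value of at most r' < r.
    obtain ⟨τ, ⟨hτ, hτr⟩, hleast⟩ := hcl.exists_isLeast
      ⟨u, ⟨hu.1, hu.2.trans ht.2⟩, hur⟩
    have h1 : φ τ ≤ r' := by
      refine h τ hτ fun s hs => ?_
      by_contra! hs'
      obtain ⟨u, hu, hur⟩ := hivt s ⟨hs.1, hs.2.trans hτ.2⟩ hs'.le
      have h2 : τ ≤ u := hleast ⟨⟨hu.1, hu.2.trans (hs.2.trans hτ.2)⟩, hur⟩
      have h3 : s = τ := le_antisymm hs.2 (h2.trans hu.2)
      rw [h3] at hs'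
      exact hs'.ne' hτr
    exact absurd (hτr.symm.trans_le h1) (not_le.2 hr)
  exact fun t ht => h t ht fun s hs => key s ⟨hs.1, hs.2.trans ht.2⟩

end Bootstrap

/-! ### Resonant zones and confinement of slowly drifting curves. -/

section Resonances

variable {d : ℕ}

/-- The span of the modes `|k| ≤ K` with `|p · k| ≤ l`. -/
noncomputable def resonantSpan (K : ℕ) (p : ActionSpace d) (l : ℝ) : Submodule ℝ (ActionSpace d) :=
  Submodule.span ℝ (intVec '' {k | k ∈ modes d K ∧ |dotZ p k| ≤ l})

/-- The increasing widths of the resonant zones. -/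
noncomputable def zoneWidth (A : ℝ) (K : ℕ) (μ : ℝ) : ℕ → ℝ
  | 0 => μ
  | s + 1 => A * K ^ (s + 1) * zoneWidth A K μ s

theorem zoneWidth_eq (A : ℝ) (K : ℕ) (μ : ℝ) (s : ℕ) :
    zoneWidth A K μ s = A ^ s * K ^ (∑ i ∈ Finset.range (s + 1), i) * μ := by
  induction s with
  | zero => simp [zoneWidth]
  | succ s ih =>
    rw [zoneWidth, ih, Finset.sum_range_succ _ (s + 1), pow_add]
    ring

theorem exists_finrank_resonantSpan_le (A : ℝ) (K : ℕ) (μ : ℝ) (p : ActionSpace d) :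
    ∃ s, Module.finrank ℝ (resonantSpan K p (zoneWidth A K μ (s + 1))) ≤ s :=
  ⟨d, (Submodule.finrank_le _).trans_eq finrank_euclideanSpace_fin⟩

/-- The multiplicity of the resonances at `p`. -/
noncomputable def resonanceLevel (A : ℝ) (K : ℕ) (μ : ℝ) (p : ActionSpace d) : ℕ :=
  Nat.find (exists_finrank_resonantSpan_le A K μ p)

theorem finrank_resonantSpan_le (A : ℝ) (K : ℕ) (μ : ℝ) (p : ActionSpace d) :
    Module.finrank ℝ (resonantSpan K p (zoneWidth A K μ (resonanceLevel A K μ p + 1))) ≤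
      resonanceLevel A K μ p := by
  exact Nat.find_spec (exists_finrank_resonantSpan_le A K μ p)

theorem resonanceLevel_le (A : ℝ) (K : ℕ) (μ : ℝ) (p : ActionSpace d) :
    resonanceLevel A K μ p ≤ d := by
  exact Nat.find_min' _ ((Submodule.finrank_le _).trans_eq finrank_euclideanSpace_fin)

/-- Minimality of the level: the index s - 1 fails its defining rank bound. -/
theorem le_finrank_of_le_resonanceLevel {A : ℝ} {K : ℕ} {μ : ℝ} {p : ActionSpace d} {s : ℕ}
    (hs : s ≤ resonanceLevel A K μ p) :
    s ≤ Module.finrank ℝ (resonantSpan K p (zoneWidth A K μ s)) := by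
  cases s with
  | zero => exact Nat.zero_le _
  | succ s =>
    exact not_le.1 (Nat.find_min (exists_finrank_resonantSpan_le A K μ p) (Nat.lt_of_succ_le hs))

theorem abs_dotZ_le_norm {K : ℕ} {k : Fin d → ℤ} (hk : k ∈ modes d K) (p : ActionSpace d) :
    |dotZ p k| ≤ K * ‖p‖ := by
  rw [← inner_intVec]
  exact (abs_real_inner_le_norm _ _).trans
    (mul_le_mul_of_nonneg_right (norm_intVec_le hk) (norm_nonneg _))

section

variable {A μ : ℝ} {K : ℕ}

theorem zoneWidth_pos (hA : 1 ≤ A) (hK : 1 ≤ K) (hμ : 0 < μ) (s : ℕ) : 0 < zoneWidth A K μ s := by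
  rw [zoneWidth_eq]
  have : (0 : ℝ) < K := by exact_mod_cast hK
  positivity

theorem zoneWidth_mono (hA : 1 ≤ A) (hK : 1 ≤ K) (hμ : 0 < μ) : Monotone (zoneWidth A K μ) := by
  refine monotone_nat_of_le_succ fun s => ?_
  rw [zoneWidth]
  have h1 : (1 : ℝ) ≤ K ^ (s + 1) := one_le_pow₀ (by exact_mod_cast hK)
  exact le_mul_of_one_le_left (zoneWidth_pos hA hK hμ s).le (one_le_mul_of_one_le_of_one_le hA h1)

/-- Near p₀, modes resonant at p with width W_s remain resonant at p₀ with width W_{s+1}, whose span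
has dimension at most s. The level of p is at least s, so the span at p has dimension at least s and
the two coincide. The resonant component of p is then controlled by inner products of size W_s with
spanning integer vectors. -/
theorem exists_resonant_decomposition (hA : 1 ≤ A) (hK : 1 ≤ K) (hμ : 0 < μ)
    {p p₀ : ActionSpace d} (hlev : resonanceLevel A K μ p₀ ≤ resonanceLevel A K μ p)
    (hp : K * ‖p - p₀‖ ≤ zoneWidth A K μ (resonanceLevel A K μ p₀ + 1) -
      zoneWidth A K μ (resonanceLevel A K μ p₀)) :
    resonantSpan K p (zoneWidth A K μ (resonanceLevel A K μ p₀)) ≤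
        resonantSpan K p₀ (zoneWidth A K μ (resonanceLevel A K μ p₀ + 1)) ∧
      ∃ y ∈ resonantSpan K p₀ (zoneWidth A K μ (resonanceLevel A K μ p₀ + 1)),
        ∃ z ∈ (resonantSpan K p₀ (zoneWidth A K μ (resonanceLevel A K μ p₀ + 1)))ᗮ, p = y + z ∧
          K * ‖y‖ ≤ d * d.factorial *
            (K ^ resonanceLevel A K μ p₀ * zoneWidth A K μ (resonanceLevel A K μ p₀)) := by
  set s := resonanceLevel A K μ p₀ with hs
  set M := resonantSpan K p₀ (zoneWidth A K μ (s + 1)) with hM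
  have hle : resonantSpan K p (zoneWidth A K μ s) ≤ M := by
    refine Submodule.span_mono (Set.image_mono fun k hk => ⟨hk.1, ?_⟩)
    have h1 : dotZ p₀ k = dotZ p k - dotZ (p - p₀) k := by
      rw [eq_sub_iff_add_eq, ← dotZ_add, add_sub_cancel]
    rw [h1]
    have h2 := abs_dotZ_le_norm hk.1 (p - p₀)
    linarith [abs_sub (dotZ p k) (dotZ (p - p₀) k), hk.2]
  have hrank : Module.finrank ℝ M ≤ s := finrank_resonantSpan_le A K μ p₀
  have heq : resonantSpan K p (zoneWidth A K μ s) = M :=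
    Submodule.eq_of_le_of_finrank_le hle (hrank.trans (le_finrank_of_le_resonanceLevel hlev))
  refine ⟨hle, ?_⟩
  obtain ⟨y, hy, z, hz, hyz⟩ := M.exists_add_mem_mem_orthogonal p
  refine ⟨y, hy, z, hz, hyz, ?_⟩
  have h3 := zoneWidth_pos hA hK hμ s
  have h1 := norm_le_of_mem_span_intVec (K := K)
    (Q := {k | k ∈ modes d K ∧ |dotZ p k| ≤ zoneWidth A K μ s}) (fun k hk => hk.1) (w := y)
    (by rw [← heq] at hy; exact hy) h3.le fun k hk => ?_
  · refine h1.trans ?_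
    have h2 : (1 : ℝ) ≤ K := by exact_mod_cast hK
    gcongr
    · change Module.finrank ℝ (resonantSpan K p (zoneWidth A K μ s)) ≤ s
      rw [heq]
      exact hrank
  · have hkM : intVec k ∈ M := hle (Submodule.subset_span ⟨k, hk, rfl⟩)
    have h2 : dotZ y k = dotZ p k := by
      rw [← inner_intVec, ← inner_intVec, hyz, inner_add_right,
        Submodule.inner_right_of_mem_orthogonal hkM hz, add_zero]
    rw [h2]
    exact hk.2

/-- A curve that drifts slowly transversally to its resonances stays near its initial point, if
its initial point is least resonant. -/
theorem norm_sub_le_of_slow_drift (hA : 2 * (d * d.factorial : ℝ) + 3 ≤ A) (hK : 1 ≤ K)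
    (hμ : 0 < μ) {κ L : ℝ} (hκL : κ * L ≤ μ) (hκ : 0 ≤ κ) {q v : ℝ → ActionSpace d}
    (hq : ∀ t ∈ Set.Icc 0 L, HasDerivAt q (v t) t)
    (hv : ∀ t ∈ Set.Icc 0 L, ∀ u, (∀ k ∈ modes d K, |dotZ (q t) k| ≤ μ → dotZ u k = 0) →
      |inner ℝ (v t) u| ≤ κ * ‖u‖)
    (hmin : ∀ t ∈ Set.Icc 0 L, resonanceLevel A K μ (q 0) ≤ resonanceLevel A K μ (q t)) :
    ∀ t ∈ Set.Icc 0 L, K * ‖q t - q 0‖ ≤ (2 * (d * d.factorial) *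
      K ^ resonanceLevel A K μ (q 0) + K) * zoneWidth A K μ (resonanceLevel A K μ (q 0)) := by
  set c : ℝ := d * d.factorial with hc
  have hc0 : 0 ≤ c := by positivity
  have hA1 : 1 ≤ A := by linarith
  have hK1 : (1 : ℝ) ≤ K := by exact_mod_cast hK
  set s := resonanceLevel A K μ (q 0) with hs
  have hW := zoneWidth_pos hA1 hK hμ s
  have hWs : zoneWidth A K μ (s + 1) = A * K ^ (s + 1) * zoneWidth A K μ s := rfl
  have hKs : (K : ℝ) ^ s ≤ K ^ (s + 1) := pow_le_pow_right₀ hK1 s.le_succ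
  have hKs1 : (K : ℝ) ≤ K ^ (s + 1) := le_self_pow₀ hK1 s.succ_ne_zero
  have hWle : zoneWidth A K μ s ≤ zoneWidth A K μ (s + 1) := zoneWidth_mono hA1 hK hμ s.le_succ
  have hqc : ContinuousOn q (Set.Icc 0 L) := fun t ht => (hq t ht).continuousAt.continuousWithinAt
  refine le_of_bootstrap (r := zoneWidth A K μ (s + 1) - zoneWidth A K μ s)
    (φ := fun t => K * ‖q t - q 0‖)
    (continuousOn_const.mul (hqc.sub continuousOn_const).norm) ?_ ?_ fun t ht hr => ?_
  · simpa using hWle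
  -- The factor A K^(s+1) between consecutive widths, with A ≥ 2c + 3, makes the bound to be proved
  -- strictly smaller than the bootstrap radius.
  · rw [hWs]
    have h1 : 2 * c * K ^ s + K + 1 < A * (K : ℝ) ^ (s + 1) := by
      have h2 : (1 : ℝ) ≤ K ^ (s + 1) := one_le_pow₀ hK1
      nlinarith
    nlinarith
  · have h0t : (0 : ℝ) ∈ Set.Icc 0 t := Set.left_mem_Icc.2 ht.1
    have hdec := fun τ (hτ : τ ∈ Set.Icc 0 t) => exists_resonant_decomposition hA1 hK hμ
      (hmin τ ⟨hτ.1, hτ.2.trans ht.2⟩) (hr τ hτ)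
    obtain ⟨-, y, hy, z, hz, hyz, hyb⟩ := hdec t (Set.right_mem_Icc.2 ht.1)
    obtain ⟨-, y₀, hy₀, z₀, hz₀, hyz₀, hyb₀⟩ := hdec 0 h0t
    have hzz : z - z₀ ∈ (resonantSpan K (q 0) (zoneWidth A K μ (s + 1)))ᗮ :=
      Submodule.sub_mem _ hz hz₀
    -- All modes resonant at time τ with width μ = W_0 lie in the fixed span at the initial point,
    -- to which z - z₀ is orthogonal.
    have hdrift : ∀ τ ∈ Set.Icc 0 t, |inner ℝ (v τ) (z - z₀)| ≤ κ * ‖z - z₀‖ := by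
      intro τ hτ
      refine hv τ ⟨hτ.1, hτ.2.trans ht.2⟩ _ fun k hk hkμ => ?_
      rw [← inner_intVec]
      refine Submodule.inner_right_of_mem_orthogonal ((hdec τ hτ).1 (Submodule.subset_span ?_)) hzz
      exact ⟨k, ⟨hk, hkμ.trans (zoneWidth_mono hA1 hK hμ (Nat.zero_le s))⟩, rfl⟩
    have hder : ∀ τ ∈ Set.Icc 0 t, HasDerivWithinAt (fun τ => inner ℝ (q τ) (z - z₀))
        (inner ℝ (v τ) (z - z₀)) (Set.Icc 0 t) τ := fun τ hτ => by
      have := (hq τ ⟨hτ.1, hτ.2.trans ht.2⟩).inner ℝ (hasDerivAt_const τ (z - z₀))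
      simpa using this.hasDerivWithinAt
    have hmv := (convex_Icc 0 t).norm_image_sub_le_of_norm_hasDerivWithin_le hder hdrift h0t
      (Set.right_mem_Icc.2 ht.1)
    -- The displacement is tested against its own transversal part, so the slow drift bounds that
    -- part directly.
    have hinner : inner ℝ (q t) (z - z₀) - inner ℝ (q 0) (z - z₀) = ‖z - z₀‖ ^ 2 := by
      rw [← inner_sub_left, hyz, hyz₀, add_sub_add_comm, inner_add_left,
        Submodule.inner_right_of_mem_orthogonal (Submodule.sub_mem _ hy hy₀) hzz, zero_add,
        real_inner_self_eq_norm_sq]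
    rw [hinner, sub_zero, Real.norm_of_nonneg (by positivity), Real.norm_of_nonneg ht.1] at hmv
    have hz1 : ‖z - z₀‖ ≤ zoneWidth A K μ s := by
      have h1 : ‖z - z₀‖ ≤ κ * t := by
        by_contra! hlt
        have h2 : 0 ≤ κ * t := mul_nonneg hκ ht.1
        nlinarith
      exact h1.trans ((mul_le_mul_of_nonneg_left ht.2 hκ).trans
        (hκL.trans (zoneWidth_mono hA1 hK hμ (Nat.zero_le s))))
    have hsplit : q t - q 0 = y - y₀ + (z - z₀) := by
      nth_rewrite 1 [hyz]
      nth_rewrite 1 [hyz₀]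
      abel
    calc K * ‖q t - q 0‖ ≤ K * (‖y‖ + ‖y₀‖ + ‖z - z₀‖) := by
          rw [hsplit]
          gcongr
          exact (norm_add_le _ _).trans (by gcongr; exact norm_sub_le _ _)
      _ = K * ‖y‖ + K * ‖y₀‖ + K * ‖z - z₀‖ := by ring
      _ ≤ c * (K ^ s * zoneWidth A K μ s) + c * (K ^ s * zoneWidth A K μ s) +
          K * zoneWidth A K μ s := by gcongr
      _ = _ := by ring

end

/-- Confinement of a curve that drifts slowly transversally to its resonances. -/
theorem exists_confinement (hd : 1 ≤ d) : ∃ C : ℝ, 0 < C ∧ ∀ (K : ℕ) (μ κ T : ℝ), 1 ≤ K → 0 < μ →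
    0 ≤ κ → κ * (2 * T) ≤ μ → ∀ p v : ℝ → ActionSpace d,
    (∀ t ∈ Set.Icc (-T) T, HasDerivAt p (v t) t) →
    (∀ t ∈ Set.Icc (-T) T, ∀ u, (∀ k ∈ modes d K, |dotZ (p t) k| ≤ μ → dotZ u k = 0) →
      |inner ℝ (v t) u| ≤ κ * ‖u‖) →
    ∀ t ∈ Set.Icc (-T) T, ‖p t - p 0‖ ≤ C * K ^ (d ^ 2) * μ := by
  classical
  set c : ℝ := d * d.factorial with hc
  have hc0 : 0 ≤ c := by positivity
  set A : ℝ := 2 * c + 3 with hA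
  refine ⟨2 * ((2 * c + 1) * A ^ d), by positivity, ?_⟩
  intro K μ κ T hK hμ hκ hκT p v hp hv t ht
  have hK1 : (1 : ℝ) ≤ K := by exact_mod_cast hK
  have hA1 : 1 ≤ A := by linarith
  -- The base point is a time of least resonance level, not time 0. Comparing both p t and p 0 with
  -- it costs a factor 2, and it may be as far as 2T from t.
  have hex : ∃ n, ∃ t ∈ Set.Icc (-T) T, resonanceLevel A K μ (p t) = n := ⟨_, t, ht, rfl⟩
  obtain ⟨t₀, ht₀, hlev⟩ := Nat.find_spec hex
  have hmin : ∀ s ∈ Set.Icc (-T) T, resonanceLevel A K μ (p t₀) ≤ resonanceLevel A K μ (p s) :=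
    fun s hs => hlev ▸ Nat.find_min' hex ⟨s, hs, rfl⟩
  set s := resonanceLevel A K μ (p t₀) with hs
  have hside : ∀ τ ∈ Set.Icc (-T) T, K * ‖p τ - p t₀‖ ≤
      (2 * c * K ^ s + K) * zoneWidth A K μ s := by
    intro τ hτ
    -- The sign σ covers motion forwards and backwards from the base time.
    have hgen : ∀ σ : ℝ, (σ = 1 ∨ σ = -1) → ∀ L, 0 ≤ L → L ≤ 2 * T →
        (∀ r ∈ Set.Icc 0 L, t₀ + σ * r ∈ Set.Icc (-T) T) →
        K * ‖p (t₀ + σ * L) - p t₀‖ ≤ (2 * c * K ^ s + K) * zoneWidth A K μ s := by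
      intro σ hσ L hL hLT hmem
      have h1 := norm_sub_le_of_slow_drift (d := d) (A := A) (K := K) (μ := μ) (κ := κ) (L := L)
        (q := fun r => p (t₀ + σ * r)) (v := fun r => σ • v (t₀ + σ * r)) le_rfl hK hμ
        ((mul_le_mul_of_nonneg_left hLT hκ).trans hκT) hκ (fun r hr => ?_) (fun r hr u hu => ?_)
        (fun r hr => ?_) L (Set.right_mem_Icc.2 hL)
      · simpa using h1
      · have h2 : HasDerivAt (fun r : ℝ => t₀ + σ * r) σ r := by
          simpa using ((hasDerivAt_id r).const_mul σ).const_add t₀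
        exact (hp _ (hmem r hr)).scomp r h2
      · have h2 := hv _ (hmem r hr) u hu
        rw [real_inner_smul_left, abs_mul]
        rcases hσ with rfl | rfl <;> simpa using h2
      · simpa using hmin _ (hmem r hr)
    rcases le_total t₀ τ with h | h
    · have := hgen 1 (Or.inl rfl) (τ - t₀) (by linarith) (by linarith [hτ.2, ht₀.1])
        fun r hr => ⟨by linarith [hr.1, ht₀.1], by linarith [hr.2, hτ.2]⟩
      simpa using this
    · have := hgen (-1) (Or.inr rfl) (t₀ - τ) (by linarith) (by linarith [hτ.1, ht₀.2])
        fun r hr => ⟨by linarith [hr.2, hτ.1], by linarith [hr.1, ht₀.2]⟩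
      simpa using this
  have hT : 0 ≤ T := by linarith [ht.1, ht.2]
  have h1 := hside t ht
  have h2 := hside 0 ⟨by linarith, hT⟩
  have hsd : s ≤ d := resonanceLevel_le A K μ (p t₀)
  have hbound : (2 * c * K ^ s + K) * zoneWidth A K μ s ≤
      (2 * c + 1) * A ^ d * (K ^ (d ^ 2 + 1) * μ) := by
    have h3 : 2 * c * (K : ℝ) ^ s + K ≤ (2 * c + 1) * K ^ d := by
      have h4 : (K : ℝ) ^ s ≤ K ^ d := pow_le_pow_right₀ hK1 hsd
      have h5 : (K : ℝ) ≤ K ^ d := le_self_pow₀ hK1 (by omega)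
      nlinarith
    have h6 : zoneWidth A K μ s ≤ A ^ d * K ^ (∑ i ∈ Finset.range (d + 1), i) * μ := by
      rw [← zoneWidth_eq]
      exact zoneWidth_mono hA1 hK hμ hsd
    -- The difference of the two sides is (d - 1)(d - 2)/2. One of the d² + 1 powers of K is
    -- cancelled at the end.
    have h7 : d + ∑ i ∈ Finset.range (d + 1), i ≤ d ^ 2 + 1 := by
      have h8 := Finset.sum_range_id_mul_two (d + 1)
      rw [Nat.add_sub_cancel] at h8
      zify at h8 ⊢
      have hd' : (1 : ℤ) ≤ d := by exact_mod_cast hd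
      rcases hd'.eq_or_lt with h9 | h9
      · rw [← h9] at h8 ⊢
        nlinarith
      · nlinarith
    have h9 := (zoneWidth_pos hA1 hK hμ s).le
    calc (2 * c * K ^ s + K) * zoneWidth A K μ s
        ≤ ((2 * c + 1) * K ^ d) * (A ^ d * K ^ (∑ i ∈ Finset.range (d + 1), i) * μ) := by
          gcongr
      _ = (2 * c + 1) * A ^ d * (K ^ (d + ∑ i ∈ Finset.range (d + 1), i) * μ) := by
          rw [pow_add]; ring
      _ ≤ _ := by gcongr
  have hfin : K * ‖p t - p 0‖ ≤ K * (2 * ((2 * c + 1) * A ^ d) * K ^ (d ^ 2) * μ) := by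
    calc K * ‖p t - p 0‖ ≤ K * (‖p t - p t₀‖ + ‖p 0 - p t₀‖) := by
          gcongr
          have := norm_sub_le (p t - p t₀) (p 0 - p t₀)
          rwa [sub_sub_sub_cancel_right] at this
      _ ≤ 2 * ((2 * c + 1) * A ^ d * (K ^ (d ^ 2 + 1) * μ)) := by
          rw [mul_add]; linarith
      _ = _ := by rw [pow_succ]; ring
  exact le_of_mul_le_mul_left hfin (by linarith)

end Resonances

/-! ### Stability of the actions over long times. -/

section Stability

variable {d : ℕ}

theorem exists_mul_rpow_le_one {s : ℝ} (hs : 0 < s) {D : ℝ} (hD : 0 ≤ D) :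
    ∃ t : ℝ, 0 < t ∧ ∀ ε : ℝ, 0 < ε → ε ≤ t → D * ε ^ s ≤ 1 := by
  refine ⟨(D + 1)⁻¹ ^ s⁻¹, by positivity, fun ε h0 hε => ?_⟩
  have h1 : ε ^ s ≤ (D + 1)⁻¹ := by
    refine (Real.rpow_le_rpow h0.le hε hs.le).trans_eq ?_
    rw [← Real.rpow_mul (by positivity), inv_mul_cancel₀ hs.ne', Real.rpow_one]
  calc D * ε ^ s ≤ (D + 1) * (D + 1)⁻¹ := by gcongr; linarith
    _ = 1 := mul_inv_cancel₀ (by positivity)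

theorem SymbolBound.exists_bound {δ ε₀ m : ℝ} {α β : List (Fin d)} {f : ℝ → Phase d → ℝ}
    (h : SymbolBound δ ε₀ m α β f) {ε : ℝ} (h0 : 0 < ε) (h1 : ε < ε₀) :
    ∃ B, ∀ x, |partialPQ α β (f ε) x| ≤ B := by
  obtain ⟨C, hC⟩ := symbolBound_iff.1 h
  have hpos : 0 < (ε ^ δ) ^ α.length := pow_pos (Real.rpow_pos_of_pos h0 _) _
  exact ⟨C * ε ^ m / (ε ^ δ) ^ α.length, fun x => by
    rw [le_div_iff₀ hpos, mul_comm]; exact hC ε h0 h1 x⟩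

theorem exists_norm_hamField_le {f : Phase d → ℝ} (hp : ∀ i, ∃ B, ∀ x, |dP i f x| ≤ B)
    (hq : ∀ i, ∃ B, ∀ x, |dQ i f x| ≤ B) : ∃ B, ∀ x, ‖hamField f x‖ ≤ B := by
  choose A hA using hp
  choose B hB using hq
  refine ⟨d * ∑ i, (|A i| + |B i|), fun x => norm_hamField_le (fun i => ?_) fun i => ?_⟩
  all_goals
    have h := Finset.single_le_sum (f := fun i => |A i| + |B i|) (fun i _ => by positivity)
      (Finset.mem_univ i)
    have := abs_nonneg (A i)
    have := abs_nonneg (B i)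
  · exact (hA i x).trans (by linarith [le_abs_self (A i)])
  · exact (hB i x).trans (by linarith [le_abs_self (B i)])

theorem hamField_freeHam (x : Phase d) : hamField (fun x : Phase d => freeHam x.1) x = (0, x.1) := by
  have h1 : ∀ i, dQ i (fun x : Phase d => freeHam x.1) x = 0 := fun i =>
    (dirDeriv_freeHam _ x).trans (by simp)
  have h2 : ∀ i, dP i (fun x : Phase d => freeHam x.1) x = x.1 i := fun i =>
    (dirDeriv_freeHam _ x).trans (by simp)
  refine Prod.ext (PiLp.ext fun i => ?_) (PiLp.ext fun i => ?_)
  · simp [hamField, h1]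
  · simp [hamField, h2]

theorem inner_hamField_fst (H : Phase d → ℝ) (x : Phase d) (u : ActionSpace d) :
    inner ℝ (hamField H x).1 u = -dirDeriv (0, u) H x := by
  rw [dirDeriv_eq_sum]
  simp [hamField, PiLp.inner_apply]

/-- Only modes resonant at p have a nonzero coefficient there, and u is orthogonal to all of them,
so Z is constant along the line q + tu. -/
theorem IsInNormalForm.dirDeriv_eq_zero {δ β ε : ℝ} {Z : Phase d → ℝ}
    (hZ : IsInNormalForm δ β ε Z) {x : Phase d} (hd : DifferentiableAt ℝ Z x)
    {u : ActionSpace d}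
    (hu : ∀ k ∈ modes d (cutoffK β ε), |dotZ x.1 k| ≤ ε ^ δ → dotZ u k = 0) :
    dirDeriv (0, u) Z x = 0 := by
  have hconst : ∀ t : ℝ, Z (x.1, x.2 + t • u) = Z x := by
    intro t
    have h : (Z (x.1, x.2 + t • u) : ℂ) = Z (x.1, x.2) := by
      rw [hZ.1, hZ.1]
      refine Finset.sum_congr rfl fun k hk => ?_
      by_cases hf : fourierCoef Z k x.1 = 0
      · rw [hf, zero_mul, zero_mul]
      · have huk : dotZ u k = 0 := by
          by_cases hk0 : k = 0
          · simp [hk0, dotZ]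
          · exact hu k hk (hZ.2 k hk0 x.1 hf)
        rw [dotZ_add, dotZ_smul, huk, mul_zero, add_zero]
    exact_mod_cast h
  refine dirDeriv_eq_of_hasDerivAt hd ?_
  simp only [hconst]
  exact hasDerivAt_const _ _

theorem cutoffK_le {β ε : ℝ} (hβ : 0 < β) (h0 : 0 < ε) (h1 : ε ≤ 1) :
    (cutoffK β ε : ℝ) ≤ 2 * ε ^ (-β) := by
  have hpos := Real.rpow_pos_of_pos h0 β
  have h2 : 1 ≤ 1 / ε ^ β := by
    rw [le_div_iff₀ hpos, one_mul]
    exact Real.rpow_le_one h0.le h1 hβ.le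
  have h3 : (⌊1 / ε ^ β⌋₊ : ℝ) ≤ 1 / ε ^ β := Nat.floor_le (by positivity)
  rw [Real.rpow_neg h0.le, ← one_div]
  unfold cutoffK
  push_cast
  linarith

end Stability

/-- Transversally to the resonances only the remainder moves the actions, so the confinement result
applies with μ = ε^δ. Orbits are global because the field is (0, p) plus a bounded term. -/
theorem Normalizes.exists_stability {d : ℕ} (hd : 1 ≤ d) {δ β ε₀ : ℝ} (hδ' : δ < 1 / 2)
    (hβ : 0 < β) (hε₀ : 0 < ε₀) {P : ℝ → Phase d → ℝ} {N : ℕ} {T : ℝ → Phase d → Phase d}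
    (hT : Normalizes δ β ε₀ N P T) :
    ∃ εN : ℝ, 0 < εN ∧ εN < ε₀ ∧
      ∀ ε : ℝ, 0 < ε → ε ≤ εN → ∀ p q : ActionSpace d,
        (∃ γ : ℝ → Phase d, IsHamOrbit (fun x => fullHam P ε (T ε x)) (p, q) γ) ∧
        ∀ γ : ℝ → Phase d, IsHamOrbit (fun x => fullHam P ε (T ε x)) (p, q) γ →
          ∀ t : ℝ, |t| ≤ ε ^ (-((N : ℝ) * (1 - 2 * δ))) →
            ‖(γ t).1 - p‖ ≤ ε ^ (δ - (((d : ℝ) - 1) * ((d : ℝ) + 1) + 2) * β) := by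
  obtain ⟨-, Z, R, hZ, ⟨hRs, hRb⟩, hH⟩ := hT
  obtain ⟨C, hC0, hC⟩ := exists_confinement hd
  choose B hB using fun i : Fin d => symbolBound_iff.1 (hRb [] [i] (by simp))
  set D : ℝ := ∑ i, |B i| with hD
  have hD0 : 0 ≤ D := Finset.sum_nonneg fun _ _ => abs_nonneg _
  -- This threshold makes the drift over the whole time interval, 2Dε, at most ε^δ.
  obtain ⟨t₁, ht₁, h₁⟩ := exists_mul_rpow_le_one (s := 1 - δ) (by linarith)
    (D := D * 2) (by positivity)
  -- Confinement yields the power ε^(δ - d²β), while the exponent to reach has (d - 1)(d + 1) + 2 =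
  -- d² + 1. The spare factor ε^β absorbs the constant.
  obtain ⟨t₂, ht₂, h₂⟩ := exists_mul_rpow_le_one hβ (D := C * 2 ^ (d ^ 2)) (by positivity)
  refine ⟨min (min (ε₀ / 2) 1) (min t₁ t₂), by positivity,
    (min_le_left _ _).trans_lt ((min_le_left _ _).trans_lt (by linarith)), ?_⟩
  intro ε h0 hε p q
  simp only [le_min_iff] at hε
  obtain ⟨⟨hε₀', hε1⟩, hεt₁, hεt₂⟩ := hε
  have hlt : ε < ε₀ := by linarith
  have hHf : (fun x => fullHam P ε (T ε x)) = fun x =>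
      freeHam x.1 + (∑ j ∈ Finset.Icc 1 N, Z j ε x + R ε x) :=
    funext fun x => by rw [hH ε h0 hlt, add_assoc]
  have hZs : ∀ j ∈ Finset.Icc 1 N, ContDiff ℝ ∞ (Z j ε) := fun j hj => ((hZ j hj).1.1 ε h0 hlt).1
  have hZsum : ContDiff ℝ ∞ fun x => ∑ j ∈ Finset.Icc 1 N, Z j ε x := ContDiff.sum hZs
  have hRc : ContDiff ℝ ∞ (R ε) := (hRs ε h0 hlt).1
  have hF : ContDiff ℝ ∞ fun x => ∑ j ∈ Finset.Icc 1 N, Z j ε x + R ε x := hZsum.add hRc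
  have hder : ∀ v x, dirDeriv v (fun x => ∑ j ∈ Finset.Icc 1 N, Z j ε x + R ε x) x =
      ∑ j ∈ Finset.Icc 1 N, dirDeriv v (Z j ε) x + dirDeriv v (R ε) x := by
    intro v x
    rw [dirDeriv_add hZsum.differentiable_top hRc.differentiable_top]
    beta_reduce
    congr 1
    rw [dirDeriv, fderiv_fun_sum fun j hj => (hZs j hj).differentiable_top x, _root_.sum_apply]
    rfl
  have hham : ∀ x, hamField (fun x => fullHam P ε (T ε x)) x = (0, x.1) +
      hamField (fun x => ∑ j ∈ Finset.Icc 1 N, Z j ε x + R ε x) x := fun x => by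
    rw [hHf, hamField_add contDiff_freeHam.differentiable_top hF.differentiable_top,
      hamField_freeHam]
  have hpartial : ∀ (v : Phase d), (∀ j ∈ Finset.Icc 1 N, ∃ B, ∀ x, |dirDeriv v (Z j ε) x| ≤ B) →
      (∃ B, ∀ x, |dirDeriv v (R ε) x| ≤ B) → ∃ B, ∀ x,
        |dirDeriv v (fun x => ∑ j ∈ Finset.Icc 1 N, Z j ε x + R ε x) x| ≤ B := by
    rintro v hv ⟨b, hb⟩
    choose! a ha using hv
    refine ⟨∑ j ∈ Finset.Icc 1 N, a j + b, fun x => ?_⟩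
    rw [hder]
    exact (abs_add_le _ _).trans (add_le_add ((Finset.abs_sum_le_sum_abs _ _).trans
      (Finset.sum_le_sum fun j hj => ha j hj x)) (hb x))
  obtain ⟨G, hG⟩ := exists_norm_hamField_le
    (fun i => hpartial _ (fun j hj => ((hZ j hj).1.2 [i] []).exists_bound h0 hlt)
      ((hRb [i] [] (by simp)).exists_bound h0 hlt))
    (fun i => hpartial _ (fun j hj => ((hZ j hj).1.2 [] [i]).exists_bound h0 hlt)
      ((hRb [] [i] (by simp)).exists_bound h0 hlt))
  constructor
  · have hX : ContDiff ℝ 1 (hamField fun x => fullHam P ε (T ε x)) := by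
      rw [hHf]
      exact (contDiff_hamField (contDiff_freeHam.add hF)).of_le (by exact_mod_cast le_top)
    refine exists_global_integralCurve hX (abs_nonneg G) (fun x => ?_) (p, q)
    rw [hham]
    refine (norm_add_le _ _).trans (add_le_add ?_ ((hG x).trans (le_abs_self G)))
    rw [Prod.norm_mk, norm_zero]
    exact max_le (norm_nonneg _) (norm_fst_le x)
  · rintro γ ⟨hγ0, hγ⟩ t ht
    set κ : ℝ := D * ε ^ (1 + N * (1 - 2 * δ)) with hκ
    set τ : ℝ := ε ^ (-((N : ℝ) * (1 - 2 * δ))) with hτ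
    have hμ : 0 < ε ^ δ := Real.rpow_pos_of_pos h0 δ
    have hκτ : κ * (2 * τ) ≤ ε ^ δ := by
      calc κ * (2 * τ) = D * 2 * (ε ^ (1 + N * (1 - 2 * δ)) * ε ^ (-((N : ℝ) * (1 - 2 * δ)))) := by
            rw [hκ, hτ]; ring
        _ = D * 2 * ε ^ (1 - δ) * ε ^ δ := by
          rw [← Real.rpow_add h0, mul_assoc _ (ε ^ (1 - δ)), ← Real.rpow_add h0]
          congr 2
          ring
        _ ≤ 1 * ε ^ δ := by
          gcongr
          exact h₁ ε h0 hεt₁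
        _ = _ := one_mul _
    have hmain := hC (cutoffK β ε) (ε ^ δ) κ τ (Nat.succ_le_succ (Nat.zero_le _)) hμ
      (by positivity) hκτ (fun t => (γ t).1)
      (fun t => (hamField (fun x => fullHam P ε (T ε x)) (γ t)).1)
      (fun t _ => (hγ t).fst) (fun t _ u hu => ?_) t (abs_le.1 ht)
    · rw [hγ0] at hmain
      refine hmain.trans ?_
      have hK := cutoffK_le hβ h0 hε1
      calc C * (cutoffK β ε : ℝ) ^ (d ^ 2) * ε ^ δ
          ≤ C * (2 * ε ^ (-β)) ^ (d ^ 2) * ε ^ δ := by gcongr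
        _ = (C * 2 ^ (d ^ 2)) * (ε ^ (-β * ((d ^ 2 : ℕ) : ℝ)) * ε ^ δ) := by
          rw [mul_pow, ← Real.rpow_mul_natCast h0.le]; ring
        _ = (C * 2 ^ (d ^ 2) * ε ^ β) *
            ε ^ (δ - (((d : ℝ) - 1) * ((d : ℝ) + 1) + 2) * β) := by
          rw [mul_assoc _ (ε ^ β), ← Real.rpow_add h0, ← Real.rpow_add h0]
          congr 2
          push_cast
          ring
        _ ≤ 1 * ε ^ (δ - (((d : ℝ) - 1) * ((d : ℝ) + 1) + 2) * β) := by
          gcongr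
          exact h₂ ε h0 hεt₂
        _ = _ := one_mul _
    · have hZ0 : ∑ j ∈ Finset.Icc 1 N, dirDeriv (0, u) (Z j ε) (γ t) = 0 :=
        Finset.sum_eq_zero fun j hj => ((hZ j hj).2 ε h0 hlt).dirDeriv_eq_zero
          ((hZs j hj).differentiable_top _) hu
      rw [hham, Prod.fst_add, zero_add, inner_hamField_fst, hder, hZ0, zero_add, abs_neg,
        dirDeriv_eq_sum]
      simp only [PiLp.zero_apply, zero_mul, Finset.sum_const_zero, zero_add]
      calc |∑ i, u i * dQ i (R ε) (γ t)|
          ≤ ∑ i, ‖u‖ * (|B i| * ε ^ (1 + N * (1 - 2 * δ))) := by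
            refine (Finset.abs_sum_le_sum_abs _ _).trans (Finset.sum_le_sum fun i _ => ?_)
            rw [abs_mul]
            have h3 := hB i ε h0 hlt (γ t)
            simp only [List.length_nil, pow_zero, one_mul] at h3
            refine mul_le_mul (PiLp.norm_apply_le u i) (h3.trans ?_) (abs_nonneg _) (norm_nonneg _)
            exact mul_le_mul_of_nonneg_right (le_abs_self _) (Real.rpow_nonneg h0.le _)
        _ = κ * ‖u‖ := by
          rw [← Finset.mul_sum, ← Finset.sum_mul]
          ring

theorem proposition3p1 (d : ℕ) (hd : 1 ≤ d) (δ β ε₀ : ℝ) (hδ : 0 < δ) (hδ' : δ < 1 / 2)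
    (hβ : 0 < β) (hβ' : β < 1) (hε₀ : 0 < ε₀)
    (P : ℝ → Phase d → ℝ) (hP : IsSymbol δ ε₀ 1 P) (N : ℕ) :
    (∃ T : ℝ → Phase d → Phase d, Normalizes δ β ε₀ N P T ∧ IsNearIdentity δ ε₀ T) ∧
    ∀ T : ℝ → Phase d → Phase d, Normalizes δ β ε₀ N P T →
      ∃ εN : ℝ, 0 < εN ∧ εN < ε₀ ∧
        ∀ ε : ℝ, 0 < ε → ε ≤ εN → ∀ p q : ActionSpace d,
          (∃ γ : ℝ → Phase d, IsHamOrbit (fun x => fullHam P ε (T ε x)) (p, q) γ) ∧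
          ∀ γ : ℝ → Phase d, IsHamOrbit (fun x => fullHam P ε (T ε x)) (p, q) γ →
            ∀ t : ℝ, |t| ≤ ε ^ (-((N : ℝ) * (1 - 2 * δ))) →
              ‖(γ t).1 - p‖ ≤ ε ^ (δ - (((d : ℝ) - 1) * ((d : ℝ) + 1) + 2) * β) :=
  ⟨exists_normalizing_transformation hδ' hβ hε₀ hP N,
    fun _ hT => hT.exists_stability hd hδ' hβ hε₀⟩
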